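/- Let $S^3_1=\{x\in\mathbb R^4_1:\langle x,x\rangle=1\}$ be de Sitter 3-space in Lorentz–Minkowski 4-space with metric $-x_0y_0+x_1y_1+x_2y_2+x_3y_3$. For a smooth map $f$ from a surface $M$ to $S^3_1$ let $ds^2$ be the pull-back of the metric; a point is *singular* if $ds^2$ is degenerate there. The map $f$ is a *CMC-1 face* if (i) there is an open dense set $W\subset M$ such that $f|_W$ is a spacelike immersion of constant mean curvature $1$; (ii) every singular point has a neighbourhood $U$ and a $C^1$ function $\lambda:U\cap W\to(0,\infty)$ such that $\lambda\,ds^2$ extends to a $C^1$ Riemannian metric on $U$; (iii) $df(p)\neq0$ for all $p\in M$. Here $M$ is a Riemann surface whose complex structure is the one determined by $f$: $ds^2$ is conformal, and the mean curvature is taken with respect to the unit normal $\nu$ fixed by the orientations of $M$ and of $S^3_1$ (for one of the two orientations of $S^3_1$). The face $f$ is *complete* if there is a symmetric 2-tensor field $T$ vanishing outside a compact subset of $M$ such that $T+ds^2$ is a complete Riemannian metric on $M$. The *Hopf differential* of $f$ is the holomorphic quadratic differential $Q$ on $M$ such that the second fundamental form is $I\!I=Q+\overline Q+ds^2$ on an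 open dense set on which $f$ is a spacelike CMC-1 immersion. **Theorem.** Let $\overline M^2$ be a compact connected Riemann surface, let $p_1,\dots,p_n\in\overline M^2$ be finitely many points, and let $f:\overline M^2\setminus\{p_1,\dots,p_n\}\to S^3_1$ be a complete CMC-1 face (with the complex structure of $\overline M^2\setminus\{p_1,\dots,p_n\}$ being the one determined by $f$). Then the Hopf differential $Q$ of $f$ exists and is unique, and it is meromorphic on $\overline M^2$, that is, it has at most a pole at each $p_j$. -/

import Mathlib

open Set Filter Topology Bundle
open scoped Manifold ContDiff

noncomputable section

/-! ### Lorentz-Minkowski 4-space and de Sitter 3-space -/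

/-- The underlying vector space of Lorentz-Minkowski 4-space `ℝ⁴₁`. -/
abbrev Mink4 : Type := Fin 4 → ℝ

/-- The Lorentz metric of signature `(-,+,+,+)`. -/
def mink (x y : Mink4) : ℝ := -(x 0 * y 0) + x 1 * y 1 + x 2 * y 2 + x 3 * y 3

/-- De Sitter 3-space `S³₁`. -/
def deSitter3 : Set Mink4 := {x | mink x x = 1}

/-! ### Riemann surfaces

A Riemann surface is a type charted on `ℂ` with holomorphic changes of charts,
`[IsManifold 𝓘(ℂ) ω M]`. The (real) tangent space `TangentSpace 𝓘(ℝ, ℂ) x` is `ℂ`, a tangent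
vector at `x` being written in the preferred chart at `x`; as changes of charts are holomorphic,
multiplication by `Complex.I` on it is the complex structure, and `1`, `Complex.I` is a positively
oriented basis. -/

/-- A Riemann surface is a real (analytic) surface. -/
instance riemannSurface_isManifold_real {M : Type*} [TopologicalSpace M] [ChartedSpace ℂ M]
    [h : IsManifold 𝓘(ℂ) ω M] : IsManifold 𝓘(ℝ, ℂ) ω M := by
  refine isManifold_of_contDiffOn 𝓘(ℝ, ℂ) ω M (fun e e' he he' => ?_)
  have h1 := (contDiffGroupoid ω 𝓘(ℂ)).compatible he he'
  rw [contDiffGroupoid, mem_groupoid_of_pregroupoid] at h1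
  exact ContDiffOn.restrict_scalars ℝ h1.1

section Surface

variable {M : Type*} [TopologicalSpace M] [ChartedSpace ℂ M]

/-- The differential at `x` of a map into `ℝ⁴₁`. -/
def surfDeriv (f : M → Mink4) (x : M) (v : ℂ) : Mink4 :=
  mfderiv 𝓘(ℝ, ℂ) 𝓘(ℝ, Mink4) f x v

/-- The first fundamental form `ds²` of `f` (the pull-back of the Lorentz metric). -/
def firstForm (f : M → Mink4) (x : M) (v w : ℂ) : ℝ :=
  mink (surfDeriv f x v) (surfDeriv f x w)

/-- The second fundamental form `II = -⟨df, dν⟩` of `f` with respect to a normal field `ν`. -/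
def secondForm (f ν : M → Mink4) (x : M) (v w : ℂ) : ℝ :=
  -mink (surfDeriv f x v) (surfDeriv ν x w)

/-- The mean curvature at `x` with respect to `ν`: half the trace of `II` relative to `ds²`,
computed in the basis `1, i` of the tangent space. -/
def meanCurvature (f ν : M → Mink4) (x : M) : ℝ :=
  (firstForm f x 1 1 * secondForm f ν x Complex.I Complex.I
      - 2 * firstForm f x 1 Complex.I * secondForm f ν x 1 Complex.I
      + firstForm f x Complex.I Complex.I * secondForm f ν x 1 1) /
    (2 * (firstForm f x 1 1 * firstForm f x Complex.I Complex.I - firstForm f x 1 Complex.I ^ 2))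

/-- `ν` is the smooth (timelike) unit normal field on `W` of the oriented surface
`f : M → S³₁ ⊆ ℝ⁴₁`, the orientation of `S³₁` being given by the sign of `o`: at each point the
frame `(f, df(1), df(i), ν)` of `ℝ⁴₁` has the sign of `o`. -/
structure IsUnitNormal (o : ℝ) (f ν : M → Mink4) (W : Set M) : Prop where
  smooth : ContMDiffOn 𝓘(ℝ, ℂ) 𝓘(ℝ, Mink4) ∞ ν W
  unit : ∀ x ∈ W, mink (ν x) (ν x) = -1
  tangent : ∀ x ∈ W, mink (ν x) (f x) = 0
  normal : ∀ x ∈ W, ∀ v : ℂ, mink (ν x) (surfDeriv f x v) = 0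
  oriented : ∀ x ∈ W,
    0 < o * (Matrix.of ![f x, surfDeriv f x 1, surfDeriv f x Complex.I, ν x]).det

/-- On the open set `W`, `f` is a spacelike immersion of constant mean curvature one with respect
to the unit normal `ν` of the oriented surface. -/
structure IsSpacelikeCMC1 (o : ℝ) (f ν : M → Mink4) (W : Set M) : Prop where
  spacelike : ∀ x ∈ W, ∀ v : ℂ, v ≠ 0 → 0 < firstForm f x v v
  isUnitNormal : IsUnitNormal o f ν W
  meanCurvature_eq_one : ∀ x ∈ W, meanCurvature f ν x = 1

/-- A point where the first fundamental form degenerates. -/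
def IsSingularPoint (f : M → Mink4) (x : M) : Prop :=
  ∃ v : ℂ, v ≠ 0 ∧ ∀ w : ℂ, firstForm f x v w = 0

/-- `g` is a `C¹`-differentiable Riemannian metric on the open set `U`. -/
structure IsC1MetricOn [IsManifold 𝓘(ℂ) ω M]
    (g : ∀ x : M, TangentSpace 𝓘(ℝ, ℂ) x →L[ℝ] TangentSpace 𝓘(ℝ, ℂ) x →L[ℝ] ℝ)
    (U : Set M) : Prop where
  symm : ∀ x ∈ U, ∀ v w, g x v w = g x w v
  pos : ∀ x ∈ U, ∀ v, v ≠ 0 → 0 < g x v v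
  contMDiffOn : ContMDiffOn 𝓘(ℝ, ℂ) (𝓘(ℝ, ℂ).prod 𝓘(ℝ, ℂ →L[ℝ] ℂ →L[ℝ] ℝ)) 1
    (fun x => TotalSpace.mk' (ℂ →L[ℝ] ℂ →L[ℝ] ℝ)
      (E := fun x : M => TangentSpace 𝓘(ℝ, ℂ) x →L[ℝ] TangentSpace 𝓘(ℝ, ℂ) x →L[ℝ] ℝ) x (g x)) U

/-- `f : M → S³₁` is a CMC-1 face: a smooth map which is a spacelike CMC-1 immersion on an open
dense set `W`, such that near each singular point some positive multiple of `ds²` extends to a `C¹`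
Riemannian metric, and whose differential vanishes nowhere. The mean curvature of the oriented
surface `M` in the oriented manifold `S³₁` is taken with respect to the unit normal fixed by the
two orientations; either orientation `o` of `S³₁` is allowed. -/
structure IsCMC1Face [IsManifold 𝓘(ℂ) ω M] (f : M → Mink4) : Prop where
  mem_deSitter3 : ∀ x, f x ∈ deSitter3
  smooth : ContMDiff 𝓘(ℝ, ℂ) 𝓘(ℝ, Mink4) ∞ f
  exists_regular : ∃ W : Set M, IsOpen W ∧ Dense W ∧
    (∃ (o : ℝ) (ν : M → Mink4), IsSpacelikeCMC1 o f ν W) ∧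
    ∀ p, IsSingularPoint f p → ∃ U : Set M, IsOpen U ∧ p ∈ U ∧
      ∃ l : M → ℝ, ContMDiffOn 𝓘(ℝ, ℂ) 𝓘(ℝ, ℝ) 1 l (U ∩ W) ∧ (∀ x ∈ U ∩ W, 0 < l x) ∧
      ∃ g : ∀ x : M, TangentSpace 𝓘(ℝ, ℂ) x →L[ℝ] TangentSpace 𝓘(ℝ, ℂ) x →L[ℝ] ℝ,
        IsC1MetricOn g U ∧ ∀ x ∈ U ∩ W, ∀ v w : ℂ, g x v w = l x * firstForm f x v w
  deriv_ne_zero : ∀ x, ∃ v : ℂ, surfDeriv f x v ≠ 0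

/-- The complex structure of `M` is the one determined by `f`: the first fundamental form is
conformal, i.e. invariant under multiplication by `i`. -/
def IsConformalFace (f : M → Mink4) : Prop :=
  ∀ (x : M) (v w : ℂ), firstForm f x (Complex.I * v) (Complex.I * w) = firstForm f x v w

/-- Completeness of a Riemannian metric: every sequence that is Cauchy for the Riemannian
distance (infimum of the lengths of `C¹` paths) converges in `M`. -/
def IsCompleteMetric [IsManifold 𝓘(ℂ) ω M]
    (g : ContinuousRiemannianMetric ℂ (fun x : M => TangentSpace 𝓘(ℝ, ℂ) x)) : Prop :=
  letI : RiemannianBundle (fun x : M => TangentSpace 𝓘(ℝ, ℂ) x) := ⟨g.toRiemannianMetric⟩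
  ∀ u : ℕ → M,
    (∀ ε > 0, ∃ N, ∀ m ≥ N, ∀ n ≥ N, Manifold.riemannianEDist 𝓘(ℝ, ℂ) (u m) (u n) < ε) →
    ∃ x, Tendsto u atTop (𝓝 x)

/-- `f` is complete: there is a symmetric 2-tensor field `T` vanishing outside a compact set such
that `T + ds²` is a complete Riemannian metric on `M`. -/
def IsCompleteFace [IsManifold 𝓘(ℂ) ω M] (f : M → Mink4) : Prop :=
  ∃ T : ∀ x : M, TangentSpace 𝓘(ℝ, ℂ) x →L[ℝ] TangentSpace 𝓘(ℝ, ℂ) x →L[ℝ] ℝ,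
    (∀ x v w, T x v w = T x w v) ∧
    (∃ C : Set M, IsCompact C ∧ ∀ x, x ∉ C → T x = 0) ∧
    ∃ g : ContinuousRiemannianMetric ℂ (fun x : M => TangentSpace 𝓘(ℝ, ℂ) x),
      (∀ (x : M) (v w : ℂ), g.inner x v w = T x v w + firstForm f x v w) ∧ IsCompleteMetric g

/-! ### Quadratic differentials

A quadratic differential is a function `Q : M → ℂ`: its value at `x` is the complex quadratic form
`v ↦ Q x * v ^ 2` on the tangent space at `x` (written, as above, in the preferred chart). -/

/-- The coefficient of `Q` in the chart `e`: `Q = (quadCoeff Q e z) dz²`. -/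
def quadCoeff (Q : M → ℂ) (e : OpenPartialHomeomorph M ℂ) (z : ℂ) : ℂ :=
  Q (e.symm z) * deriv (fun ζ => chartAt ℂ (e.symm z) (e.symm ζ)) z ^ 2

/-- `Q` is a holomorphic quadratic differential. -/
def IsHolomorphicQuad (Q : M → ℂ) : Prop :=
  ∀ e ∈ atlas ℂ M, DifferentiableOn ℂ (quadCoeff Q e) e.target

/-- `Q` is a meromorphic quadratic differential (its values at the poles are irrelevant). -/
def IsMeromorphicQuad (Q : M → ℂ) : Prop :=
  ∀ e ∈ atlas ℂ M, ∀ z ∈ e.target, MeromorphicAt (quadCoeff Q e) z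

/-- `Q` is the Hopf differential of the CMC-1 face `f`: the holomorphic quadratic differential
with `II = Q + Q̄ + ds²` on an open dense set where `f` is a spacelike CMC-1 immersion. -/
def IsHopfDifferential (f : M → Mink4) (Q : M → ℂ) : Prop :=
  IsHolomorphicQuad Q ∧
  ∃ W : Set M, IsOpen W ∧ Dense W ∧ ∃ (o : ℝ) (ν : M → Mink4), IsSpacelikeCMC1 o f ν W ∧
    ∀ x ∈ W, ∀ v : ℂ, secondForm f ν x v v = 2 * (Q x * v ^ 2).re + firstForm f x v v

end Surface

section Punctured

variable {X : Type*} [TopologicalSpace X] [T1Space X]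

/-- The open subset `X ∖ {p₁, …, pₙ}`. -/
def punctured (P : Finset X) : TopologicalSpace.Opens X :=
  ⟨(P : Set X)ᶜ, P.finite_toSet.isClosed.isOpen_compl⟩

open Classical in
/-- A quadratic differential on `X ∖ P`, viewed on `X` (with the irrelevant value `0` on `P`).
The preferred chart of `X ∖ P` at a point is the restriction of that of `X`. -/
def extendQuad (P : Finset X) (Q : punctured P → ℂ) (x : X) : ℂ :=
  if h : x ∈ punctured P then Q ⟨x, h⟩ else 0

end Punctured

end

open scoped ComplexConjugate

noncomputable section

/-! Identify `ℝ⁴₁` with the Hermitian `2 × 2` matrices `X`, so that `det X = -⟨x, x⟩` and `X⁻¹ =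
-adj X` on de Sitter space. For a conformal spacelike surface, and for the sign `s` of the
identification that matches the orientation, mean curvature one makes the connection matrix `𝒜 = X_z
X⁻¹` holomorphic. Conformality makes `𝒜` traceless with `𝒜² = 0`. Its entries `cA`, `cB`, `cC` are
smooth also at singular points, so they are holomorphic there by density of the regular set. Since
`df ≠ 0`, `𝒜` has no zeros, and `𝒜 𝒜' = q 𝒜` defines a holomorphic `q` (`hopfCoeff`), which is the
coefficient of the Hopf differential on the regular set. This gives existence; uniqueness follows by
continuity once `f` is seen to determine `s` (`orientationSign_eq`).

Near a puncture the tensor `T` vanishes, so `ds²` is positive definite and complete towards the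
puncture. Pull back to the universal covering of a punctured disc by the unit disc, `puncCover r t
θ`, whose centre lies over a point `z` with `t = log (r / |z|)`. Solving `r' = -r 𝒜` there yields
`ds = |k| (1 - |g|²) |dx|` and Hopf coefficient `k g'`, with `k` zero-free, `|g| < 1` and `g 0 = 0`
(`exists_disc_normal_form`).

Write `M = cylFactor` for the density of `ds` relative to `|dz| / |z|`. Three estimates remain.
Completeness and the Schwarz lemma for a local inverse of `∫ k` bound `|k 0|` from below, so `M (1 +
t) ≥ d > 0` (`le_cylFactor_mul`, `exists_le_cylFactor`). This bound makes the logarithm of a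
suitable multiple of `|k|` a nonnegative harmonic function, and Harnack's inequality bounds `M` at
`t` by a square of its value at `t / 2`, up to elementary factors (`cylFactor_le_sq`); iteration
gives `M = O(e^{N t}) = O(|z|^{-N})`. Finally the Schwarz lemma for `g` bounds `|q| |z|² · 2t` by
`M` (`norm_hopfCoeff_le`). Hence `q` grows at most like a power of `1 / |z|`, and the singularity is
at most a pole. -/

/-! ### Algebra in complexified Lorentz-Minkowski space -/

/-- The complex bilinear extension of the Lorentz metric. -/
def cmink (x y : Fin 4 → ℂ) : ℂ := -(x 0 * y 0) + x 1 * y 1 + x 2 * y 2 + x 3 * y 3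

/-- Complexification of a vector. -/
def cvec (x : Mink4) : Fin 4 → ℂ := fun j => (x j : ℂ)

/-- The Lorentzian triple product: `cmink (tripleProd u v w) y = det (u, v, w, y)`. -/
def tripleProd (u v w : Fin 4 → ℂ) : Fin 4 → ℂ :=
  ![u 1 * (v 2 * w 3 - v 3 * w 2) - u 2 * (v 1 * w 3 - v 3 * w 1) + u 3 * (v 1 * w 2 - v 2 * w 1),
    u 0 * (v 2 * w 3 - v 3 * w 2) - u 2 * (v 0 * w 3 - v 3 * w 0) + u 3 * (v 0 * w 2 - v 2 * w 0),
    -(u 0 * (v 1 * w 3 - v 3 * w 1) - u 1 * (v 0 * w 3 - v 3 * w 0)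
      + u 3 * (v 0 * w 1 - v 1 * w 0)),
    u 0 * (v 1 * w 2 - v 2 * w 1) - u 1 * (v 0 * w 2 - v 2 * w 0) + u 2 * (v 0 * w 1 - v 1 * w 0)]

/-- With a vector `x` identified with the Hermitian matrix
`((x₀ + x₃, x₁ + i s x₂), (x₁ - i s x₂, x₀ - x₃))`, the `(1,1)` entry of `- d · adj x`. -/
def connA (s : ℝ) (d x : Fin 4 → ℂ) : ℂ :=
  -((d 0 + d 3) * (x 0 - x 3) - (d 1 + Complex.I * s * d 2) * (x 1 - Complex.I * s * x 2))

/-- The `(1,2)` entry of `- d · adj x`. -/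
def connB (s : ℝ) (d x : Fin 4 → ℂ) : ℂ :=
  (d 0 + d 3) * (x 1 + Complex.I * s * x 2) - (d 1 + Complex.I * s * d 2) * (x 0 + x 3)

/-- The `(2,1)` entry of `- d · adj x`. -/
def connC (s : ℝ) (d x : Fin 4 → ℂ) : ℂ :=
  -((d 1 - Complex.I * s * d 2) * (x 0 - x 3) - (d 0 - d 3) * (x 1 - Complex.I * s * x 2))

lemma cmink_comm (x y : Fin 4 → ℂ) : cmink x y = cmink y x := by simp only [cmink]; ring

lemma cmink_add_left (x x' y : Fin 4 → ℂ) : cmink (x + x') y = cmink x y + cmink x' y := by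
  simp only [cmink, Pi.add_apply]; ring

lemma cmink_sub_left (x x' y : Fin 4 → ℂ) : cmink (x - x') y = cmink x y - cmink x' y := by
  simp only [cmink, Pi.sub_apply]; ring

lemma cmink_smul_left (c : ℂ) (x y : Fin 4 → ℂ) : cmink (c • x) y = c * cmink x y := by
  simp only [cmink, Pi.smul_apply, smul_eq_mul]; ring

lemma cmink_cvec (x y : Mink4) : cmink (cvec x) (cvec y) = (mink x y : ℂ) := by
  simp [cmink, cvec, mink]

/-- A Gram determinant, with the sign of the Lorentz volume: the length of the normal `f × u × v` is
read off from the first fundamental form. -/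
lemma cmink_tripleProd_self (u v w : Fin 4 → ℂ) :
    cmink (tripleProd u v w) (tripleProd u v w) =
      -(cmink u u * (cmink v v * cmink w w - cmink v w ^ 2)
        - cmink u v * (cmink u v * cmink w w - cmink v w * cmink u w)
        + cmink u w * (cmink u v * cmink v w - cmink v v * cmink u w)) := by
  simp [cmink, tripleProd]; ring

lemma cmink_tripleProd_cvec (f u v n : Mink4) :
    cmink (tripleProd (cvec f) (cvec u) (cvec v)) (cvec n) =
      ((Matrix.of ![f, u, v, n]).det : ℂ) := by
  simp [Matrix.det_succ_row_zero, Fin.sum_univ_succ, cmink, tripleProd, cvec, Fin.succAbove,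
    Matrix.submatrix]
  ring

lemma cmink_tripleProd_fst (u v w : Fin 4 → ℂ) : cmink (tripleProd u v w) u = 0 := by
  simp [cmink, tripleProd]; ring

lemma cmink_tripleProd_snd (u v w : Fin 4 → ℂ) : cmink (tripleProd u v w) v = 0 := by
  simp [cmink, tripleProd]; ring

lemma cmink_tripleProd_thd (u v w : Fin 4 → ℂ) : cmink (tripleProd u v w) w = 0 := by
  simp [cmink, tripleProd]; ring

/-- A vector orthogonal to a frame vanishes. -/
lemma eq_zero_of_cmink_frame {f u v n : Mink4} (hdet : (Matrix.of ![f, u, v, n]).det ≠ 0)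
    {y : Fin 4 → ℂ} (h0 : cmink y (cvec f) = 0) (h1 : cmink y (cvec u) = 0)
    (h2 : cmink y (cvec v) = 0) (h3 : cmink y (cvec n) = 0) : y = 0 := by
  have hdet' : ((Matrix.of ![f, u, v, n]).map (Complex.ofRealHom)).det ≠ 0 := by
    rw [← RingHom.mapMatrix_apply, ← RingHom.map_det]
    simpa using hdet
  have key : ((Matrix.of ![f, u, v, n]).map (Complex.ofRealHom)).mulVec
      ![-(y 0), y 1, y 2, y 3] = 0 := by
    funext i
    simp only [cmink, cvec] at h0 h1 h2 h3
    fin_cases i <;> simp [Matrix.mulVec, dotProduct, Fin.sum_univ_succ]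
    · linear_combination h0
    · linear_combination h1
    · linear_combination h2
    · linear_combination h3
  have := Matrix.eq_zero_of_mulVec_eq_zero hdet' key
  funext i
  have h := congrFun this i
  fin_cases i <;> simpa using h

section Identities

variable {s : ℝ} {x d e : Fin 4 → ℂ}

/-- Since `x · adj x = det x`, the matrix `-x · adj x` is the scalar `⟨x, x⟩`; the off-diagonal
entries follow in the next two lemmas. -/
lemma connA_self (hs : s ^ 2 = 1) : connA s x x = cmink x x := by
  have hs' : (s : ℂ) ^ 2 = 1 := by exact_mod_cast hs
  simp only [connA, cmink]
  linear_combination (x 2 ^ 2) * hs' - (x 2 ^ 2) * s ^ 2 * Complex.I_sq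

lemma connB_self : connB s x x = 0 := by simp only [connB]; ring

lemma connC_self : connC s x x = 0 := by simp only [connC]; ring

/-- Spinor form of the cross product: for `d`, `e` tangent at `x`, the traceless part of `-d · adj
e` is, up to the factor `i s`, the connection matrix of `x × d × e`. The polynomial identities are
checked separately for `s = 1` and `s = -1`. -/
lemma connA_tripleProd (hs : s ^ 2 = 1) (hx : cmink x x = 1) (hd : cmink x d = 0)
    (he : cmink x e = 0) :
    connA s (tripleProd x d e) x = s * Complex.I * (connA s d e - cmink d e) := by
  have h : connA s (tripleProd x d e) x = s * Complex.I * (cmink x x * connA s d e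
      - cmink x d * connA s x e - cmink x e * connA s d x - cmink d e * cmink x x
      + 2 * cmink x d * cmink x e) := by
    rcases mul_self_eq_one_iff.mp ((pow_two s).symm.trans hs) with rfl | rfl <;>
      simp [connA, cmink, tripleProd] <;> ring_nf <;> simp [Complex.I_sq] <;> ring
  rw [h, hx, hd, he]; ring

lemma connB_tripleProd (hs : s ^ 2 = 1) (hx : cmink x x = 1) (hd : cmink x d = 0)
    (he : cmink x e = 0) :
    connB s (tripleProd x d e) x = s * Complex.I * connB s d e := by
  have h : connB s (tripleProd x d e) x = s * Complex.I * (cmink x x * connB s d e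
      - cmink x d * connB s x e - cmink x e * connB s d x) := by
    rcases mul_self_eq_one_iff.mp ((pow_two s).symm.trans hs) with rfl | rfl <;>
      simp [connB, cmink, tripleProd] <;> ring_nf <;> simp [Complex.I_sq] <;> ring
  rw [h, hx, hd, he]; ring

lemma connC_tripleProd (hs : s ^ 2 = 1) (hx : cmink x x = 1) (hd : cmink x d = 0)
    (he : cmink x e = 0) :
    connC s (tripleProd x d e) x = s * Complex.I * connC s d e := by
  have h : connC s (tripleProd x d e) x = s * Complex.I * (cmink x x * connC s d e
      - cmink x d * connC s x e - cmink x e * connC s d x) := by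
    rcases mul_self_eq_one_iff.mp ((pow_two s).symm.trans hs) with rfl | rfl <;>
      simp [connC, cmink, tripleProd] <;> ring_nf <;> simp [Complex.I_sq] <;> ring
  rw [h, hx, hd, he]; ring

/-- The matrix `- d · adj x` of an isotropic vector `d` orthogonal to `x` has determinant zero. -/
lemma connA_sq_add (hs : s ^ 2 = 1) (hd : cmink x d = 0) (hdd : cmink d d = 0) :
    connA s d x ^ 2 + connB s d x * connC s d x = 0 := by
  have h : connA s d x ^ 2 + connB s d x * connC s d x = 2 * cmink x d * connA s d x
      - cmink d d * cmink x x := by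
    rcases mul_self_eq_one_iff.mp ((pow_two s).symm.trans hs) with rfl | rfl <;>
      simp [connA, connB, connC, cmink] <;> ring_nf <;> simp [Complex.I_sq] <;> ring
  rw [h, hd, hdd]; ring

/-- The first columns of `-d · adj x` and `-d · adj e` both lie in the image of `d`, which has rank
at most one because `det d = -⟨d, d⟩ = 0`. So their minor vanishes. -/
lemma connC_mul_connA (hs : s ^ 2 = 1) (hdd : cmink d d = 0) :
    connC s d x * connA s d e - connA s d x * connC s d e = 0 := by
  have h : connC s d x * connA s d e - connA s d x * connC s d e =
      - cmink d d * connC s x e := by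
    rcases mul_self_eq_one_iff.mp ((pow_two s).symm.trans hs) with rfl | rfl <;>
      simp [connA, connC, cmink] <;> ring_nf <;> simp [Complex.I_sq] <;> ring
  rw [h, hdd]; ring

/-- The same vanishing minor for the second columns, with the `(2,2)` entries eliminated through the
traces `2⟨x, d⟩ = 0` and `2⟨d, e⟩`. -/
lemma connA_mul_connB (hs : s ^ 2 = 1) (hd : cmink x d = 0) (hdd : cmink d d = 0) :
    connA s d x * connB s d e - connB s d x * connA s d e = -2 * cmink d e * connB s d x := by
  have h : connA s d x * connB s d e - connB s d x * connA s d e =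
      2 * cmink x d * connB s d e - cmink d d * connB s x e - 2 * cmink d e * connB s d x := by
    rcases mul_self_eq_one_iff.mp ((pow_two s).symm.trans hs) with rfl | rfl <;>
      simp [connA, connB, cmink] <;> ring_nf <;> simp [Complex.I_sq] <;> ring
  rw [h, hd, hdd]; ring

lemma connA_lin (α β : ℂ) (t y : Fin 4 → ℂ) :
    connA s (α • t + β • y) x = α * connA s t x + β * connA s y x := by
  simp [connA]; ring

lemma connB_lin (α β : ℂ) (t y : Fin 4 → ℂ) :
    connB s (α • t + β • y) x = α * connB s t x + β * connB s y x := by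
  simp [connB]; ring

lemma connC_lin (α β : ℂ) (t y : Fin 4 → ℂ) :
    connC s (α • t + β • y) x = α * connC s t x + β * connC s y x := by
  simp [connC]; ring

end Identities

/-! ### Second-order jets of conformal CMC-1 immersions -/

/-- The `∂/∂z` derivative of a vector function with partial derivatives `u`, `v`. -/
def wirt (u v : Mink4) : Fin 4 → ℂ := (1 / 2 : ℂ) • (cvec u - Complex.I • cvec v)

/-- The `∂/∂z̄` derivative of a vector function with partial derivatives `u`, `v`. -/
def wirtBar (u v : Mink4) : Fin 4 → ℂ := (1 / 2 : ℂ) • (cvec u + Complex.I • cvec v)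

/-- The first and second derivatives at a point of a conformal CMC-1 immersion into `S³₁`, with
the normal vector `n`. -/
structure CMC1Jet (s : ℝ) (f u v n uu uv vv : Mink4) : Prop where
  s_sq : s ^ 2 = 1
  ff : mink f f = 1
  fu : mink f u = 0
  fv : mink f v = 0
  conf : mink v v = mink u u
  uv0 : mink u v = 0
  pos : 0 < mink u u
  nn : mink n n = -1
  nf : mink n f = 0
  nu : mink n u = 0
  nv : mink n v = 0
  det : 0 < -s * (Matrix.of ![f, u, v, n]).det
  uuf : mink uu f = - mink u u
  uvf : mink uv f = 0
  vvf : mink vv f = - mink u u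
  uuu : mink uu u = mink uv v
  uvu : mink uv u = mink vv v
  uuv : mink uu v = - mink uv u
  vvu : mink vv u = - mink uv v
  mean : mink uu n + mink vv n = 2 * mink u u

namespace CMC1Jet

variable {s : ℝ} {f u v n uu uv vv : Mink4}

lemma det_ne_zero (h : CMC1Jet s f u v n uu uv vv) : (Matrix.of ![f, u, v, n]).det ≠ 0 :=
  fun h0 => by simpa [h0] using h.det

lemma tripleProd_eq_det (h : CMC1Jet s f u v n uu uv vv) :
    tripleProd (cvec f) (cvec u) (cvec v) =
      (-((Matrix.of ![f, u, v, n]).det : ℂ)) • cvec n := by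
  rw [← sub_eq_zero]
  refine eq_zero_of_cmink_frame h.det_ne_zero ?_ ?_ ?_ ?_ <;>
    rw [cmink_sub_left, cmink_smul_left, cmink_cvec]
  · rw [cmink_tripleProd_fst, h.nf]; simp
  · rw [cmink_tripleProd_snd, h.nu]; simp
  · rw [cmink_tripleProd_thd, h.nv]; simp
  · rw [cmink_tripleProd_cvec, h.nn]; simp

/-- The Gram determinant gives `det² = ⟨u, u⟩²`; the orientation condition on `s` selects the root.
-/
lemma det_eq (h : CMC1Jet s f u v n uu uv vv) :
    (Matrix.of ![f, u, v, n]).det = -s * mink u u := by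
  have h1 := cmink_tripleProd_self (cvec f) (cvec u) (cvec v)
  rw [h.tripleProd_eq_det] at h1
  simp only [cmink_smul_left, cmink_cvec, h.ff, h.fu, h.fv, h.conf, h.uv0] at h1
  rw [cmink_comm, cmink_smul_left, cmink_cvec, h.nn] at h1
  have h2 : (Matrix.of ![f, u, v, n]).det ^ 2 = mink u u ^ 2 := by
    have : (((Matrix.of ![f, u, v, n]).det ^ 2 : ℝ) : ℂ) = ((mink u u ^ 2 : ℝ) : ℂ) := by
      push_cast
      push_cast at h1
      linear_combination -h1
    exact_mod_cast this
  have h3 : (-s * (Matrix.of ![f, u, v, n]).det) ^ 2 = mink u u ^ 2 := by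
    rw [mul_pow, h2, neg_sq, h.s_sq, one_mul]
  have h4 := (pow_left_inj₀ h.det.le h.pos.le two_ne_zero).mp h3
  linear_combination (-s) * h4 - (Matrix.of ![f, u, v, n]).det * h.s_sq

lemma tripleProd_eq (h : CMC1Jet s f u v n uu uv vv) :
    tripleProd (cvec f) (wirt u v) (wirtBar u v) =
      (Complex.I * s * (mink u u / 2 : ℝ)) • cvec n := by
  have h1 : tripleProd (cvec f) (wirt u v) (wirtBar u v) =
      (Complex.I / 2) • tripleProd (cvec f) (cvec u) (cvec v) := by
    funext j
    fin_cases j <;> simp [tripleProd, wirt, wirtBar] <;> ring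
  rw [h1, h.tripleProd_eq_det, h.det_eq, smul_smul]
  congr 1; push_cast; ring

lemma cmink_f_wirt (h : CMC1Jet s f u v n uu uv vv) : cmink (cvec f) (wirt u v) = 0 := by
  rw [cmink_comm, wirt, cmink_smul_left, cmink_sub_left, cmink_smul_left, cmink_comm,
    cmink_comm (cvec v), cmink_cvec, cmink_cvec, h.fu, h.fv]
  simp

lemma cmink_f_wirtBar (h : CMC1Jet s f u v n uu uv vv) : cmink (cvec f) (wirtBar u v) = 0 := by
  rw [cmink_comm, wirtBar, cmink_smul_left, cmink_add_left, cmink_smul_left, cmink_comm,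
    cmink_comm (cvec v), cmink_cvec, cmink_cvec, h.fu, h.fv]
  simp

lemma cmink_wirt_wirtBar (h : CMC1Jet s f u v n uu uv vv) :
    cmink (wirt u v) (wirtBar u v) = (mink u u / 2 : ℝ) := by
  have : cmink (wirt u v) (wirtBar u v) = (1 / 4) * (mink u u + mink v v : ℝ) := by
    simp [cmink, wirt, wirtBar, cvec, mink]; ring_nf; simp [Complex.I_sq]; ring
  rw [this, h.conf]; push_cast; ring

end CMC1Jet

lemma cmink_wirt_self {u v : Mink4} (hc : mink v v = mink u u) (h0 : mink u v = 0) :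
    cmink (wirt u v) (wirt u v) = 0 := by
  have : cmink (wirt u v) (wirt u v) =
      (1 / 4) * ((mink u u - mink v v : ℝ) - 2 * Complex.I * (mink u v : ℝ)) := by
    simp [cmink, wirt, cvec, mink]; ring_nf; simp [Complex.I_sq]; ring
  rw [this, hc, h0]; simp

namespace CMC1Jet

variable {s : ℝ} {f u v n uu uv vv : Mink4}

/-- The Laplacian has no tangential component by conformality, its component along `f` comes from
`⟨f, f⟩ = 1`, and the one along `n` from mean curvature one. Writing `n` as a triple product turns
this into an equation for `f` alone, in which the orientation enters only through `s`. -/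
lemma laplacian_eq (h : CMC1Jet s f u v n uu uv vv) :
    (1 / 4 : ℂ) • (cvec uu + cvec vv) = (-(mink u u / 2 : ℝ) : ℂ) • cvec f +
      (Complex.I * s) • tripleProd (cvec f) (wirt u v) (wirtBar u v) := by
  have hs : (s : ℂ) ^ 2 = 1 := by exact_mod_cast h.s_sq
  have h1 : cvec uu + cvec vv + (2 * mink u u : ℂ) • cvec f + (2 * mink u u : ℂ) • cvec n = 0 := by
    refine eq_zero_of_cmink_frame h.det_ne_zero ?_ ?_ ?_ ?_ <;>
      simp only [cmink_add_left, cmink_smul_left, cmink_cvec]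
    · rw [h.uuf, h.vvf, h.ff, h.nf]; push_cast; ring
    · rw [h.uuu, h.vvu, h.fu, h.nu]; push_cast; ring
    · rw [h.uuv, h.uvu, h.fv, h.nv]; push_cast; ring
    · have := h.mean
      rw [h.nn, show mink f n = 0 by rw [← h.nf]; simp only [mink]; ring]
      have h2 : (mink uu n : ℂ) + mink vv n = 2 * mink u u := by exact_mod_cast this
      push_cast
      linear_combination h2
  rw [h.tripleProd_eq, smul_smul]
  have h3 : Complex.I * s * (Complex.I * s * (mink u u / 2 : ℝ)) = -(mink u u / 2 : ℝ) := by
    linear_combination (mink u u / 2 : ℝ) * (s : ℂ) ^ 2 * Complex.I_sq - (mink u u / 2 : ℝ) * hs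
  rw [h3]
  funext j
  have := congrFun h1 j
  simp at this ⊢
  linear_combination (1 / 4) * this

/-- By the product rule the left side is `∂/∂z̄` of the connection entry. In the Laplacian the `f`
term contributes a scalar, and the triple product contributes `(i s)² = -1` times the matrix of
`F_z`, `F_z̄` minus the same scalar, so everything cancels. -/
lemma connA_laplacian (h : CMC1Jet s f u v n uu uv vv) :
    connA s ((1 / 4 : ℂ) • (cvec uu + cvec vv)) (cvec f) + connA s (wirt u v) (wirtBar u v) = 0 := by
  have hs : (s : ℂ) ^ 2 = 1 := by exact_mod_cast h.s_sq
  have hff : cmink (cvec f) (cvec f) = 1 := by rw [cmink_cvec, h.ff]; simp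
  rw [h.laplacian_eq, connA_lin, connA_self h.s_sq, hff,
    connA_tripleProd h.s_sq hff h.cmink_f_wirt h.cmink_f_wirtBar, h.cmink_wirt_wirtBar]
  linear_combination (connA s (wirt u v) (wirtBar u v) - (mink u u / 2 : ℝ)) *
    (Complex.I_sq * (s : ℂ) ^ 2 - hs)

lemma connB_laplacian (h : CMC1Jet s f u v n uu uv vv) :
    connB s ((1 / 4 : ℂ) • (cvec uu + cvec vv)) (cvec f) + connB s (wirt u v) (wirtBar u v) = 0 := by
  have hs : (s : ℂ) ^ 2 = 1 := by exact_mod_cast h.s_sq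
  have hff : cmink (cvec f) (cvec f) = 1 := by rw [cmink_cvec, h.ff]; simp
  rw [h.laplacian_eq, connB_lin, connB_self,
    connB_tripleProd h.s_sq hff h.cmink_f_wirt h.cmink_f_wirtBar]
  linear_combination (connB s (wirt u v) (wirtBar u v)) *
    (Complex.I_sq * (s : ℂ) ^ 2 - hs)

lemma connC_laplacian (h : CMC1Jet s f u v n uu uv vv) :
    connC s ((1 / 4 : ℂ) • (cvec uu + cvec vv)) (cvec f) + connC s (wirt u v) (wirtBar u v) = 0 := by
  have hs : (s : ℂ) ^ 2 = 1 := by exact_mod_cast h.s_sq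
  have hff : cmink (cvec f) (cvec f) = 1 := by rw [cmink_cvec, h.ff]; simp
  rw [h.laplacian_eq, connC_lin, connC_self,
    connC_tripleProd h.s_sq hff h.cmink_f_wirt h.cmink_f_wirtBar]
  linear_combination (connC s (wirt u v) (wirtBar u v)) *
    (Complex.I_sq * (s : ℂ) ^ 2 - hs)

/-- The coefficient of the Hopf differential. -/
def hopf (n uu uv vv : Mink4) : ℂ :=
  ((mink uu n - mink vv n) / 4 : ℝ) - Complex.I * (mink uv n / 2 : ℝ)

/-- Decomposition of `F_zz` in the moving frame: conformality leaves no `F_z̄` or `f` component, and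
the sign before `hopf` comes from `⟨n, n⟩ = -1`. -/
lemma wirt_wirt_eq (h : CMC1Jet s f u v n uu uv vv) :
    (1 / 4 : ℂ) • (cvec uu - cvec vv - (2 * Complex.I) • cvec uv) =
      ((mink uv v - Complex.I * mink uv u) / mink u u : ℂ) • wirt u v +
        (-hopf n uu uv vv) • cvec n := by
  have hE : (mink u u : ℂ) ≠ 0 := by exact_mod_cast h.pos.ne'
  have hun : mink u n = 0 := by rw [← h.nu]; simp only [mink]; ring
  have hvn : mink v n = 0 := by rw [← h.nv]; simp only [mink]; ring
  have hvu : mink v u = 0 := by rw [← h.uv0]; simp only [mink]; ring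
  have huf : mink u f = 0 := by rw [← h.fu]; simp only [mink]; ring
  have hvf : mink v f = 0 := by rw [← h.fv]; simp only [mink]; ring
  rw [← sub_eq_zero]
  refine eq_zero_of_cmink_frame h.det_ne_zero ?_ ?_ ?_ ?_ <;>
    simp only [cmink_add_left, cmink_sub_left, cmink_smul_left, cmink_cvec, wirt]
  · rw [h.uuf, h.vvf, h.uvf, huf, hvf, h.nf]; push_cast; ring
  · rw [h.uuu, h.vvu, hvu, h.nu]; push_cast; field_simp; ring
  · rw [h.uuv, h.conf, h.uv0, h.nv, ← h.uvu]; push_cast; field_simp; ring_nf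
    simp [Complex.I_sq]
  · rw [h.nn, hun, hvn, hopf]; push_cast; ring

/-- Expresses the connection matrix of the normal by first derivatives, through `n ∼ f × F_z ×
F_z̄`. -/
lemma conn_normal (h : CMC1Jet s f u v n uu uv vv) :
    (mink u u / 2 : ℝ) * connA s (cvec n) (cvec f) =
        connA s (wirt u v) (wirtBar u v) - (mink u u / 2 : ℝ) ∧
    (mink u u / 2 : ℝ) * connB s (cvec n) (cvec f) = connB s (wirt u v) (wirtBar u v) ∧
    (mink u u / 2 : ℝ) * connC s (cvec n) (cvec f) = connC s (wirt u v) (wirtBar u v) := by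
  have hs : (s : ℂ) ≠ 0 := by
    have := h.s_sq
    intro h0
    have : s = 0 := by exact_mod_cast h0
    simp [this] at *
  have hI : Complex.I * s ≠ 0 := mul_ne_zero Complex.I_ne_zero hs
  have hff : cmink (cvec f) (cvec f) = 1 := by rw [cmink_cvec, h.ff]; simp
  have hA := connA_tripleProd h.s_sq hff h.cmink_f_wirt h.cmink_f_wirtBar
  have hB := connB_tripleProd h.s_sq hff h.cmink_f_wirt h.cmink_f_wirtBar
  have hC := connC_tripleProd h.s_sq hff h.cmink_f_wirt h.cmink_f_wirtBar
  rw [h.tripleProd_eq, ← add_zero ((Complex.I * s * (mink u u / 2 : ℝ)) • cvec n),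
    ← zero_smul ℂ (cvec n)] at hA hB hC
  rw [connA_lin, h.cmink_wirt_wirtBar] at hA
  rw [connB_lin] at hB
  rw [connC_lin] at hC
  refine ⟨mul_left_cancel₀ hI ?_, mul_left_cancel₀ hI ?_, mul_left_cancel₀ hI ?_⟩
  · linear_combination hA
  · linear_combination hB
  · linear_combination hC

/-- The `(2,1)` entry of `𝒜 𝒜' = q 𝒜`. After inserting `F_zz = α F_z - q n`, the `α` terms cancel in
the minor; by `conn_normal` the rest is the minor of `F_z`, `F_z̄`, which is zero, plus a scalar
term giving `q` times the entry. -/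
lemma hopf_mul_connC (h : CMC1Jet s f u v n uu uv vv) :
    hopf n uu uv vv * connC s (wirt u v) (cvec f) =
      connC s (wirt u v) (cvec f) *
        connA s ((1 / 4 : ℂ) • (cvec uu - cvec vv - (2 * Complex.I) • cvec uv)) (cvec f) -
      connA s (wirt u v) (cvec f) *
        connC s ((1 / 4 : ℂ) • (cvec uu - cvec vv - (2 * Complex.I) • cvec uv)) (cvec f) := by
  have hE : ((mink u u / 2 : ℝ) : ℂ) ≠ 0 := by
    exact_mod_cast (half_pos h.pos).ne'
  obtain ⟨hA, -, hC⟩ := h.conn_normal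
  have h1 := connC_mul_connA (x := cvec f) (e := wirtBar u v) h.s_sq
    (cmink_wirt_self h.conf h.uv0)
  rw [h.wirt_wirt_eq, connA_lin, connC_lin]
  refine mul_left_cancel₀ hE ?_
  linear_combination (hopf n uu uv vv) * (connC s (wirt u v) (cvec f) * hA
    - connA s (wirt u v) (cvec f) * hC + h1)

lemma hopf_mul_connB (h : CMC1Jet s f u v n uu uv vv) :
    hopf n uu uv vv * connB s (wirt u v) (cvec f) =
      connA s (wirt u v) (cvec f) *
        connB s ((1 / 4 : ℂ) • (cvec uu - cvec vv - (2 * Complex.I) • cvec uv)) (cvec f) -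
      connB s (wirt u v) (cvec f) *
        connA s ((1 / 4 : ℂ) • (cvec uu - cvec vv - (2 * Complex.I) • cvec uv)) (cvec f) := by
  have hE : ((mink u u / 2 : ℝ) : ℂ) ≠ 0 := by
    exact_mod_cast (half_pos h.pos).ne'
  obtain ⟨hA, hB, -⟩ := h.conn_normal
  have h1 := connA_mul_connB (x := cvec f) (e := wirtBar u v) h.s_sq h.cmink_f_wirt
    (cmink_wirt_self h.conf h.uv0)
  rw [h.cmink_wirt_wirtBar] at h1
  rw [h.wirt_wirt_eq, connA_lin, connB_lin]
  refine mul_left_cancel₀ hE ?_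
  linear_combination (hopf n uu uv vv) * (connA s (wirt u v) (cvec f) * hB
    - connB s (wirt u v) (cvec f) * hA + h1)

end CMC1Jet

/-! ### Conformal CMC-1 coordinates -/

lemma mink_comm (x y : Mink4) : mink x y = mink y x := by simp only [mink]; ring

/-- The Lorentz metric as a continuous bilinear map. -/
def minkL : Mink4 →L[ℝ] Mink4 →L[ℝ] ℝ :=
  (LinearMap.mk₂ ℝ mink (by intros; simp [mink]; ring) (by intros; simp [mink]; ring)
    (by intros; simp [mink]; ring) (by intros; simp [mink]; ring)).toContinuousBilinearMap

@[simp] lemma minkL_apply (x y : Mink4) : minkL x y = mink x y := rfl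

/-- `connA` as a continuous bilinear map of a pair of partial derivatives and a position. -/
def connAL (s : ℝ) : (Mink4 × Mink4) →L[ℝ] Mink4 →L[ℝ] ℂ :=
  (LinearMap.mk₂ ℝ (fun p x => connA s (wirt p.1 p.2) (cvec x))
    (by intros; simp [connA, wirt, cvec]; ring) (by intros; simp [connA, wirt, cvec]; ring)
    (by intros; simp [connA, wirt, cvec]; ring)
    (by intros; simp [connA, wirt, cvec]; ring)).toContinuousBilinearMap

/-- `connB` as a continuous bilinear map of a pair of partial derivatives and a position. -/
def connBL (s : ℝ) : (Mink4 × Mink4) →L[ℝ] Mink4 →L[ℝ] ℂ :=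
  (LinearMap.mk₂ ℝ (fun p x => connB s (wirt p.1 p.2) (cvec x))
    (by intros; simp [connB, wirt, cvec]; ring) (by intros; simp [connB, wirt, cvec]; ring)
    (by intros; simp [connB, wirt, cvec]; ring)
    (by intros; simp [connB, wirt, cvec]; ring)).toContinuousBilinearMap

/-- `connC` as a continuous bilinear map of a pair of partial derivatives and a position. -/
def connCL (s : ℝ) : (Mink4 × Mink4) →L[ℝ] Mink4 →L[ℝ] ℂ :=
  (LinearMap.mk₂ ℝ (fun p x => connC s (wirt p.1 p.2) (cvec x))
    (by intros; simp [connC, wirt, cvec]; ring) (by intros; simp [connC, wirt, cvec]; ring)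
    (by intros; simp [connC, wirt, cvec]; ring)
    (by intros; simp [connC, wirt, cvec]; ring)).toContinuousBilinearMap

@[simp] lemma connAL_apply (s : ℝ) (p : Mink4 × Mink4) (x : Mink4) :
    connAL s p x = connA s (wirt p.1 p.2) (cvec x) := rfl

@[simp] lemma connBL_apply (s : ℝ) (p : Mink4 × Mink4) (x : Mink4) :
    connBL s p x = connB s (wirt p.1 p.2) (cvec x) := rfl

@[simp] lemma connCL_apply (s : ℝ) (p : Mink4 × Mink4) (x : Mink4) :
    connCL s p x = connC s (wirt p.1 p.2) (cvec x) := rfl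

/-- The first partial derivative. -/
def dX (F : ℂ → Mink4) (z : ℂ) : Mink4 := fderiv ℝ F z 1

/-- The second partial derivative. -/
def dY (F : ℂ → Mink4) (z : ℂ) : Mink4 := fderiv ℝ F z Complex.I

lemma fderiv_one_eq (F : ℂ → Mink4) (z : ℂ) : fderiv ℝ F z 1 = dX F z := rfl

lemma fderiv_I_eq (F : ℂ → Mink4) (z : ℂ) : fderiv ℝ F z Complex.I = dY F z := rfl

/-- The `(1,1)` entry of the connection matrix `X_z X⁻¹`. -/
def cA (s : ℝ) (F : ℂ → Mink4) (z : ℂ) : ℂ := connA s (wirt (dX F z) (dY F z)) (cvec (F z))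

/-- The `(1,2)` entry of the connection matrix `X_z X⁻¹`. -/
def cB (s : ℝ) (F : ℂ → Mink4) (z : ℂ) : ℂ := connB s (wirt (dX F z) (dY F z)) (cvec (F z))

/-- The `(2,1)` entry of the connection matrix `X_z X⁻¹`. -/
def cC (s : ℝ) (F : ℂ → Mink4) (z : ℂ) : ℂ := connC s (wirt (dX F z) (dY F z)) (cvec (F z))

/-- A conformal (possibly degenerate) smooth map into `S³₁` with nowhere vanishing differential
and holomorphic connection matrix. -/
structure IsCMC1Coord (s : ℝ) (F : ℂ → Mink4) (Ω : Set ℂ) : Prop where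
  isOpen : IsOpen Ω
  s_sq : s ^ 2 = 1
  smooth : ContDiffOn ℝ ∞ F Ω
  unit : ∀ z ∈ Ω, mink (F z) (F z) = 1
  conf : ∀ z ∈ Ω, mink (dY F z) (dY F z) = mink (dX F z) (dX F z)
  orth : ∀ z ∈ Ω, mink (dX F z) (dY F z) = 0
  imm : ∀ z ∈ Ω, fderiv ℝ F z ≠ 0
  holA : DifferentiableOn ℂ (cA s F) Ω
  holB : DifferentiableOn ℂ (cB s F) Ω
  holC : DifferentiableOn ℂ (cC s F) Ω

lemma fderiv_mink {u v : ℂ → Mink4} {z : ℂ} (hu : DifferentiableAt ℝ u z)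
    (hv : DifferentiableAt ℝ v z) (d : ℂ) :
    fderiv ℝ (fun ζ => mink (u ζ) (v ζ)) z d =
      mink (u z) (fderiv ℝ v z d) + mink (fderiv ℝ u z d) (v z) := by
  have := (minkL.hasFDerivAt_of_bilinear hu.hasFDerivAt hv.hasFDerivAt).fderiv
  simp only [minkL_apply] at this
  rw [this]
  simp

lemma mink_fderiv_eq_of_eventually {u v u' v' : ℂ → Mink4} {z : ℂ} (hu : DifferentiableAt ℝ u z)
    (hv : DifferentiableAt ℝ v z) (hu' : DifferentiableAt ℝ u' z)
    (hv' : DifferentiableAt ℝ v' z)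
    (h : ∀ᶠ ζ in 𝓝 z, mink (u ζ) (v ζ) = mink (u' ζ) (v' ζ)) (d : ℂ) :
    mink (u z) (fderiv ℝ v z d) + mink (fderiv ℝ u z d) (v z) =
      mink (u' z) (fderiv ℝ v' z d) + mink (fderiv ℝ u' z d) (v' z) := by
  rw [← fderiv_mink hu hv, ← fderiv_mink hu' hv', Filter.EventuallyEq.fderiv_eq h]

lemma mink_fderiv_eq_zero {u v : ℂ → Mink4} {z : ℂ} (hu : DifferentiableAt ℝ u z)
    (hv : DifferentiableAt ℝ v z) {c : ℝ} (h : ∀ᶠ ζ in 𝓝 z, mink (u ζ) (v ζ) = c) (d : ℂ) :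
    mink (u z) (fderiv ℝ v z d) + mink (fderiv ℝ u z d) (v z) = 0 := by
  rw [← fderiv_mink hu hv,
    Filter.EventuallyEq.fderiv_eq (f := fun _ => c) (f₁ := fun ζ => mink (u ζ) (v ζ)) h]
  simp

section Smooth

variable {s : ℝ} {F : ℂ → Mink4} {Ω : Set ℂ} {z : ℂ}

lemma contDiffOn_fderiv_apply (hΩ : IsOpen Ω) (hF : ContDiffOn ℝ ∞ F Ω) (v : ℂ) :
    ContDiffOn ℝ ∞ (fun z => fderiv ℝ F z v) Ω :=
  (hF.fderiv_of_isOpen hΩ (by simp)).clm_apply contDiffOn_const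

lemma contDiffOn_dX (hΩ : IsOpen Ω) (hF : ContDiffOn ℝ ∞ F Ω) : ContDiffOn ℝ ∞ (dX F) Ω :=
  contDiffOn_fderiv_apply hΩ hF 1

lemma contDiffOn_dY (hΩ : IsOpen Ω) (hF : ContDiffOn ℝ ∞ F Ω) : ContDiffOn ℝ ∞ (dY F) Ω :=
  contDiffOn_fderiv_apply hΩ hF Complex.I

lemma ContDiffOn.differentiableAt_of_isOpen (hΩ : IsOpen Ω) (hF : ContDiffOn ℝ ∞ F Ω)
    (hz : z ∈ Ω) : DifferentiableAt ℝ F z :=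
  ((hF.contDiffAt (hΩ.mem_nhds hz)).differentiableAt (by simp))

lemma fderiv_dX_I (hΩ : IsOpen Ω) (hF : ContDiffOn ℝ ∞ F Ω) (hz : z ∈ Ω) :
    fderiv ℝ (dX F) z Complex.I = fderiv ℝ (dY F) z 1 := by
  have h := (hF.contDiffAt (hΩ.mem_nhds hz)).isSymmSndFDerivAt (n := ∞)
    (by
      simp only [minSmoothness_of_isRCLikeNormedField]
      exact WithTop.coe_le_coe.2 (le_top (a := (2 : ℕ∞))))
  have h1 : DifferentiableAt ℝ (fderiv ℝ F) z :=
    ((hF.fderiv_of_isOpen hΩ (m := ∞) (by simp)).contDiffAt (hΩ.mem_nhds hz)).differentiableAt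
      (by simp)
  have h2 : ∀ v w : ℂ, fderiv ℝ (fun ζ => fderiv ℝ F ζ v) z w = fderiv ℝ (fderiv ℝ F) z w v := by
    intro v w
    rw [fderiv_clm_apply h1 (differentiableAt_const v)]
    simp
  change fderiv ℝ (fun ζ => fderiv ℝ F ζ 1) z Complex.I =
    fderiv ℝ (fun ζ => fderiv ℝ F ζ Complex.I) z 1
  rw [h2, h2]
  exact h.eq _ _

lemma hasFDerivAt_bilin (B : (Mink4 × Mink4) →L[ℝ] Mink4 →L[ℝ] ℂ) (hΩ : IsOpen Ω)
    (hF : ContDiffOn ℝ ∞ F Ω) (hz : z ∈ Ω) :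
    DifferentiableAt ℝ (fun ζ => B (dX F ζ, dY F ζ) (F ζ)) z ∧
    ∀ d, fderiv ℝ (fun ζ => B (dX F ζ, dY F ζ) (F ζ)) z d =
      B (dX F z, dY F z) (fderiv ℝ F z d) +
        B (fderiv ℝ (dX F) z d, fderiv ℝ (dY F) z d) (F z) := by
  have hX := ((contDiffOn_dX hΩ hF).differentiableAt_of_isOpen hΩ hz).hasFDerivAt
  have hY := ((contDiffOn_dY hΩ hF).differentiableAt_of_isOpen hΩ hz).hasFDerivAt
  have h := B.hasFDerivAt_of_bilinear (hX.prodMk hY)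
    (hF.differentiableAt_of_isOpen hΩ hz).hasFDerivAt
  refine ⟨h.differentiableAt, fun d => ?_⟩
  rw [h.fderiv]
  simp

lemma contDiffOn_bilin (B : (Mink4 × Mink4) →L[ℝ] Mink4 →L[ℝ] ℂ) (hΩ : IsOpen Ω)
    (hF : ContDiffOn ℝ ∞ F Ω) : ContDiffOn ℝ ∞ (fun ζ => B (dX F ζ, dY F ζ) (F ζ)) Ω :=
  (B.contDiff.comp_contDiffOn ((contDiffOn_dX hΩ hF).prodMk (contDiffOn_dY hΩ hF))).clm_apply hF

/-- A continuously differentiable function that satisfies the Cauchy-Riemann equations on a dense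
subset of an open set is holomorphic. -/
lemma differentiableOn_of_dense {h : ℂ → ℂ} {W : Set ℂ} (hΩ : IsOpen Ω)
    (hh : ContDiffOn ℝ ∞ h Ω) (hW : Ω ⊆ closure (W ∩ Ω))
    (hcr : ∀ z ∈ W ∩ Ω, fderiv ℝ h z Complex.I = Complex.I • fderiv ℝ h z 1) :
    DifferentiableOn ℂ h Ω := by
  intro z hz
  have hc : ContinuousOn (fderiv ℝ h) Ω :=
    (hh.fderiv_of_isOpen hΩ (m := ∞) (by simp)).continuousOn
  have h1 : ContinuousOn (fun z => fderiv ℝ h z Complex.I - Complex.I • fderiv ℝ h z 1) Ω := by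
    fun_prop
  have h2 : fderiv ℝ h z Complex.I - Complex.I • fderiv ℝ h z 1 = 0 := by
    have : (fun z => fderiv ℝ h z Complex.I - Complex.I • fderiv ℝ h z 1) z ∈
        closure ((fun z => fderiv ℝ h z Complex.I - Complex.I • fderiv ℝ h z 1) '' (W ∩ Ω)) :=
      ((h1 z hz).mono inter_subset_right).mem_closure_image (hW hz)
    have h3 : (fun z => fderiv ℝ h z Complex.I - Complex.I • fderiv ℝ h z 1) '' (W ∩ Ω) ⊆ {0} := by
      rintro _ ⟨w, hw, rfl⟩
      simp only [mem_singleton_iff]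
      rw [hcr w hw, sub_self]
    have := closure_mono h3 this
    simpa using this
  refine (differentiableAt_complex_iff_differentiableAt_real.mpr
    ⟨(hh.contDiffAt (hΩ.mem_nhds hz)).differentiableAt (by simp), sub_eq_zero.mp h2⟩).differentiableWithinAt

end Smooth

section Jets

variable {s : ℝ} (f u v uu uv vv : Mink4)


/-- For any `h` one has `h_y - i h_x = -2i ∂h/∂z̄`; the hypothesis says that `∂/∂z̄` of the entry is
zero. -/
lemma connA_cr (h : connA s ((1 / 4 : ℂ) • (cvec uu + cvec vv)) (cvec f)
      + connA s (wirt u v) (wirtBar u v) = 0) :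
    connA s (wirt u v) (cvec v) + connA s (wirt uv vv) (cvec f) =
      Complex.I • (connA s (wirt u v) (cvec u) + connA s (wirt uu uv) (cvec f)) := by
  simp only [connA, wirt, wirtBar, cvec, Pi.smul_apply, Pi.add_apply, Pi.sub_apply,
    smul_eq_mul] at h ⊢
  rw [← sub_eq_zero]
  have := congrArg (fun t => -2 * Complex.I * t) h
  simp only [mul_zero] at this
  rw [← this]
  generalize Complex.I * (s : ℂ) = t
  ring_nf
  simp only [Complex.I_sq, Complex.I_pow_three]
  ring

/-- Once the Cauchy-Riemann equation holds, `∂/∂x` equals `∂/∂z`, and the product rule for `∂/∂z`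
gives the two terms on the right. -/
lemma connA_wirt_wirt (hc : connA s (wirt u v) (cvec v) + connA s (wirt uv vv) (cvec f) =
      Complex.I • (connA s (wirt u v) (cvec u) + connA s (wirt uu uv) (cvec f))) :
    connA s (wirt u v) (cvec u) + connA s (wirt uu uv) (cvec f) =
      connA s ((1 / 4 : ℂ) • (cvec uu - cvec vv - (2 * Complex.I) • cvec uv)) (cvec f)
        + connA s (wirt u v) (wirt u v) := by
  have h1 : connA s ((1 / 4 : ℂ) • (cvec uu - cvec vv - (2 * Complex.I) • cvec uv)) (cvec f)
      + connA s (wirt u v) (wirt u v) =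
      (1 / 2) * ((connA s (wirt u v) (cvec u) + connA s (wirt uu uv) (cvec f)) -
        Complex.I * (connA s (wirt u v) (cvec v) + connA s (wirt uv vv) (cvec f))) := by
    simp only [connA, wirt, cvec, Pi.smul_apply, Pi.sub_apply, smul_eq_mul]
    generalize Complex.I * (s : ℂ) = t
    ring_nf
    simp only [Complex.I_sq]
    ring
  rw [h1, hc, smul_eq_mul]
  linear_combination (1 / 2) * (connA s (wirt u v) (cvec u)
    + connA s (wirt uu uv) (cvec f)) * Complex.I_sq

lemma connB_cr (h : connB s ((1 / 4 : ℂ) • (cvec uu + cvec vv)) (cvec f)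
      + connB s (wirt u v) (wirtBar u v) = 0) :
    connB s (wirt u v) (cvec v) + connB s (wirt uv vv) (cvec f) =
      Complex.I • (connB s (wirt u v) (cvec u) + connB s (wirt uu uv) (cvec f)) := by
  simp only [connB, wirt, wirtBar, cvec, Pi.smul_apply, Pi.add_apply, Pi.sub_apply,
    smul_eq_mul] at h ⊢
  rw [← sub_eq_zero]
  have := congrArg (fun t => -2 * Complex.I * t) h
  simp only [mul_zero] at this
  rw [← this]
  generalize Complex.I * (s : ℂ) = t
  ring_nf
  simp only [Complex.I_sq]
  ring

lemma connB_wirt_wirt (hc : connB s (wirt u v) (cvec v) + connB s (wirt uv vv) (cvec f) =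
      Complex.I • (connB s (wirt u v) (cvec u) + connB s (wirt uu uv) (cvec f))) :
    connB s (wirt u v) (cvec u) + connB s (wirt uu uv) (cvec f) =
      connB s ((1 / 4 : ℂ) • (cvec uu - cvec vv - (2 * Complex.I) • cvec uv)) (cvec f)
        + connB s (wirt u v) (wirt u v) := by
  have h1 : connB s ((1 / 4 : ℂ) • (cvec uu - cvec vv - (2 * Complex.I) • cvec uv)) (cvec f)
      + connB s (wirt u v) (wirt u v) =
      (1 / 2) * ((connB s (wirt u v) (cvec u) + connB s (wirt uu uv) (cvec f)) -
        Complex.I * (connB s (wirt u v) (cvec v) + connB s (wirt uv vv) (cvec f))) := by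
    simp only [connB, wirt, cvec, Pi.smul_apply, Pi.sub_apply, smul_eq_mul]
    generalize Complex.I * (s : ℂ) = t
    ring_nf
    simp only [Complex.I_sq]
    ring
  rw [h1, hc, smul_eq_mul]
  linear_combination (1 / 2) * (connB s (wirt u v) (cvec u)
    + connB s (wirt uu uv) (cvec f)) * Complex.I_sq

lemma connC_cr (h : connC s ((1 / 4 : ℂ) • (cvec uu + cvec vv)) (cvec f)
      + connC s (wirt u v) (wirtBar u v) = 0) :
    connC s (wirt u v) (cvec v) + connC s (wirt uv vv) (cvec f) =
      Complex.I • (connC s (wirt u v) (cvec u) + connC s (wirt uu uv) (cvec f)) := by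
  simp only [connC, wirt, wirtBar, cvec, Pi.smul_apply, Pi.add_apply, Pi.sub_apply,
    smul_eq_mul] at h ⊢
  rw [← sub_eq_zero]
  have := congrArg (fun t => -2 * Complex.I * t) h
  simp only [mul_zero] at this
  rw [← this]
  generalize Complex.I * (s : ℂ) = t
  ring_nf
  simp only [Complex.I_sq]
  ring

lemma connC_wirt_wirt (hc : connC s (wirt u v) (cvec v) + connC s (wirt uv vv) (cvec f) =
      Complex.I • (connC s (wirt u v) (cvec u) + connC s (wirt uu uv) (cvec f))) :
    connC s (wirt u v) (cvec u) + connC s (wirt uu uv) (cvec f) =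
      connC s ((1 / 4 : ℂ) • (cvec uu - cvec vv - (2 * Complex.I) • cvec uv)) (cvec f)
        + connC s (wirt u v) (wirt u v) := by
  have h1 : connC s ((1 / 4 : ℂ) • (cvec uu - cvec vv - (2 * Complex.I) • cvec uv)) (cvec f)
      + connC s (wirt u v) (wirt u v) =
      (1 / 2) * ((connC s (wirt u v) (cvec u) + connC s (wirt uu uv) (cvec f)) -
        Complex.I * (connC s (wirt u v) (cvec v) + connC s (wirt uv vv) (cvec f))) := by
    simp only [connC, wirt, cvec, Pi.smul_apply, Pi.sub_apply, smul_eq_mul]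
    generalize Complex.I * (s : ℂ) = t
    ring_nf
    simp only [Complex.I_sq]
    ring
  rw [h1, hc, smul_eq_mul]
  linear_combination (1 / 2) * (connC s (wirt u v) (cvec u)
    + connC s (wirt uu uv) (cvec f)) * Complex.I_sq

end Jets

/-- The jet of a conformal CMC-1 immersion. -/
lemma CMC1Jet.of_normal {s : ℝ} {F ν : ℂ → Mink4} {W : Set ℂ} (hW : IsOpen W) (hs : s ^ 2 = 1)
    (hF : ContDiffOn ℝ ∞ F W) (hν : ContDiffOn ℝ ∞ ν W)
    (unit : ∀ z ∈ W, mink (F z) (F z) = 1)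
    (conf : ∀ z ∈ W, mink (dY F z) (dY F z) = mink (dX F z) (dX F z))
    (orth : ∀ z ∈ W, mink (dX F z) (dY F z) = 0)
    (pos : ∀ z ∈ W, 0 < mink (dX F z) (dX F z))
    (nn : ∀ z ∈ W, mink (ν z) (ν z) = -1) (nf : ∀ z ∈ W, mink (ν z) (F z) = 0)
    (nu : ∀ z ∈ W, mink (ν z) (dX F z) = 0) (nv : ∀ z ∈ W, mink (ν z) (dY F z) = 0)
    (det : ∀ z ∈ W, 0 < -s * (Matrix.of ![F z, dX F z, dY F z, ν z]).det)
    (mean : ∀ z ∈ W, mink (dX F z) (dX ν z) + mink (dY F z) (dY ν z) = -2 * mink (dX F z) (dX F z))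
    {z : ℂ} (hz : z ∈ W) :
    CMC1Jet s (F z) (dX F z) (dY F z) (ν z) (dX (dX F) z) (dY (dX F) z) (dY (dY F) z) ∧
    mink (dX (dX F) z) (ν z) = -mink (dX F z) (dX ν z) ∧
    mink (dY (dX F) z) (ν z) = -mink (dX F z) (dY ν z) ∧
    mink (dY (dX F) z) (ν z) = -mink (dY F z) (dX ν z) ∧
    mink (dY (dY F) z) (ν z) = -mink (dY F z) (dY ν z) := by
  have dF := hF.differentiableAt_of_isOpen hW hz
  have dν := hν.differentiableAt_of_isOpen hW hz
  have dU := (contDiffOn_dX hW hF).differentiableAt_of_isOpen hW hz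
  have dV := (contDiffOn_dY hW hF).differentiableAt_of_isOpen hW hz
  have sym : fderiv ℝ (dX F) z Complex.I = fderiv ℝ (dY F) z 1 := fderiv_dX_I hW hF hz
  have mem := hW.mem_nhds hz
  have hfu : ∀ ζ ∈ W, ∀ d, mink (F ζ) (fderiv ℝ F ζ d) = 0 := by
    intro ζ hζ d
    have dF := hF.differentiableAt_of_isOpen hW hζ
    have := mink_fderiv_eq_zero dF dF (Filter.eventually_of_mem (hW.mem_nhds hζ) unit) d
    rw [mink_comm (fderiv ℝ F ζ d)] at this
    linarith
  have e1 := mink_fderiv_eq_zero (c := 0) dF dU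
    (Filter.eventually_of_mem mem fun ζ hζ => hfu ζ hζ 1)
  have e2 := mink_fderiv_eq_zero (c := 0) dF dV
    (Filter.eventually_of_mem mem fun ζ hζ => hfu ζ hζ Complex.I)
  have e3 := mink_fderiv_eq_of_eventually dV dV dU dU (Filter.eventually_of_mem mem conf)
  have e4 := mink_fderiv_eq_zero dU dV (Filter.eventually_of_mem mem orth)
  have e5 := mink_fderiv_eq_zero dν dU (Filter.eventually_of_mem mem nu)
  have e6 := mink_fderiv_eq_zero dν dV (Filter.eventually_of_mem mem nv)
  have a1 := e1 1
  have a2 := e1 Complex.I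
  have a3 := e2 Complex.I
  have b1 := e3 1
  have b2 := e3 Complex.I
  have c1 := e4 1
  have c2 := e4 Complex.I
  have d1 := e5 1
  have d2 := e5 Complex.I
  have d3 := e6 1
  have d4 := e6 Complex.I
  have o := orth z hz
  have cf := conf z hz
  have mn := mean z hz
  simp only [← sym] at a1 a2 a3 b1 b2 c1 c2 d1 d2 d3 d4
  simp only [fderiv_one_eq, fderiv_I_eq] at a1 a2 a3 b1 b2 c1 c2 d1 d2 d3 d4
  have k0 := mink_comm (F z) (dX (dX F) z)
  have k1 := mink_comm (F z) (dY (dX F) z)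
  have k2 := mink_comm (F z) (dY (dY F) z)
  have k3 := mink_comm (dX F z) (dX (dX F) z)
  have k4 := mink_comm (dX F z) (dY (dX F) z)
  have k5 := mink_comm (dX F z) (dY (dY F) z)
  have k6 := mink_comm (dY F z) (dX (dX F) z)
  have k7 := mink_comm (dY F z) (dY (dX F) z)
  have k8 := mink_comm (dY F z) (dY (dY F) z)
  have k9 := mink_comm (ν z) (dX (dX F) z)
  have k10 := mink_comm (ν z) (dY (dX F) z)
  have k11 := mink_comm (ν z) (dY (dY F) z)
  have k12 := mink_comm (dX F z) (dX ν z)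
  have k13 := mink_comm (dX F z) (dY ν z)
  have k14 := mink_comm (dY F z) (dX ν z)
  have k15 := mink_comm (dY F z) (dY ν z)
  have k16 := mink_comm (dX F z) (dY F z)
  refine ⟨⟨hs, unit z hz, hfu z hz 1, hfu z hz Complex.I, cf, o, pos z hz, nn z hz, nf z hz,
    nu z hz, nv z hz, det z hz, ?_, ?_, ?_, ?_, ?_, ?_, ?_, ?_⟩, ?_, ?_, ?_, ?_⟩
  all_goals linarith

/-! ### The Hopf coefficient from the connection matrix -/

section Normal

variable {s : ℝ} {F ν : ℂ → Mink4} {Ω W : Set ℂ}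

/-- The coefficient `q` of the Hopf differential, characterized by `A A' = q A` for the connection
matrix `A`. -/
def hopfCoeff (s : ℝ) (F : ℂ → Mink4) (z : ℂ) : ℂ :=
  if cC s F z ≠ 0 then
    (cC s F z * deriv (cA s F) z - cA s F z * deriv (cC s F) z) / cC s F z
  else (cA s F z * deriv (cB s F) z - cB s F z * deriv (cA s F) z) / cB s F z

lemma conn_cr_of_jet {n : Mink4} (hΩ : IsOpen Ω) (hF : ContDiffOn ℝ ∞ F Ω) {z : ℂ} (hz : z ∈ Ω)
    (h : CMC1Jet s (F z) (dX F z) (dY F z) n (dX (dX F) z) (dY (dX F) z) (dY (dY F) z)) :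
    fderiv ℝ (cA s F) z Complex.I = Complex.I • fderiv ℝ (cA s F) z 1 ∧
    fderiv ℝ (cB s F) z Complex.I = Complex.I • fderiv ℝ (cB s F) z 1 ∧
    fderiv ℝ (cC s F) z Complex.I = Complex.I • fderiv ℝ (cC s F) z 1 := by
  have hA := (hasFDerivAt_bilin (connAL s) hΩ hF hz).2
  have hB := (hasFDerivAt_bilin (connBL s) hΩ hF hz).2
  have hC := (hasFDerivAt_bilin (connCL s) hΩ hF hz).2
  have sym : fderiv ℝ (dX F) z Complex.I = fderiv ℝ (dY F) z 1 := fderiv_dX_I hΩ hF hz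
  refine ⟨?_, ?_, ?_⟩
  · refine (hA Complex.I).trans (Eq.trans ?_ (congrArg (Complex.I • ·) (hA 1)).symm)
    simp only [connAL_apply, ← sym]
    exact connA_cr _ _ _ _ _ _ h.connA_laplacian
  · refine (hB Complex.I).trans (Eq.trans ?_ (congrArg (Complex.I • ·) (hB 1)).symm)
    simp only [connBL_apply, ← sym]
    exact connB_cr _ _ _ _ _ _ h.connB_laplacian
  · refine (hC Complex.I).trans (Eq.trans ?_ (congrArg (Complex.I • ·) (hC 1)).symm)
    simp only [connCL_apply, ← sym]
    exact connC_cr _ _ _ _ _ _ h.connC_laplacian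

lemma deriv_eq_fderiv_one {h : ℂ → ℂ} {z : ℂ} (hh : DifferentiableAt ℂ h z) :
    deriv h z = fderiv ℝ h z 1 := by
  simp [hh.fderiv_restrictScalars ℝ]

lemma deriv_conn_of_jet {n : Mink4} (hc : IsCMC1Coord s F Ω) {z : ℂ} (hz : z ∈ Ω)
    (h : CMC1Jet s (F z) (dX F z) (dY F z) n (dX (dX F) z) (dY (dX F) z) (dY (dY F) z)) :
    let t := (1 / 4 : ℂ) • (cvec (dX (dX F) z) - cvec (dY (dY F) z)
      - (2 * Complex.I) • cvec (dY (dX F) z))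
    deriv (cA s F) z = connA s t (cvec (F z)) ∧ deriv (cB s F) z = connB s t (cvec (F z)) ∧
      deriv (cC s F) z = connC s t (cvec (F z)) := by
  intro t
  have hA := (hasFDerivAt_bilin (connAL s) hc.isOpen hc.smooth hz).2 1
  have hB := (hasFDerivAt_bilin (connBL s) hc.isOpen hc.smooth hz).2 1
  have hC := (hasFDerivAt_bilin (connCL s) hc.isOpen hc.smooth hz).2 1
  have sym : fderiv ℝ (dX F) z Complex.I = fderiv ℝ (dY F) z 1 :=
    fderiv_dX_I hc.isOpen hc.smooth hz
  rw [← sym] at hA hB hC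
  rw [deriv_eq_fderiv_one (hc.holA.differentiableAt (hc.isOpen.mem_nhds hz)),
    deriv_eq_fderiv_one (hc.holB.differentiableAt (hc.isOpen.mem_nhds hz)),
    deriv_eq_fderiv_one (hc.holC.differentiableAt (hc.isOpen.mem_nhds hz))]
  refine ⟨hA.trans ?_, hB.trans ?_, hC.trans ?_⟩
  · simp only [connAL_apply]
    refine (connA_wirt_wirt _ _ _ _ _ _ (connA_cr _ _ _ _ _ _ h.connA_laplacian)).trans ?_
    rw [connA_self h.s_sq, cmink_wirt_self h.conf h.uv0, add_zero]
    rfl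
  · simp only [connBL_apply]
    refine (connB_wirt_wirt _ _ _ _ _ _ (connB_cr _ _ _ _ _ _ h.connB_laplacian)).trans ?_
    rw [connB_self, add_zero]
    rfl
  · simp only [connCL_apply]
    refine (connC_wirt_wirt _ _ _ _ _ _ (connC_cr _ _ _ _ _ _ h.connC_laplacian)).trans ?_
    rw [connC_self, add_zero]
    rfl

end Normal

lemma cmink_cvec_wirt {f u v : Mink4} (hu : mink f u = 0) (hv : mink f v = 0) :
    cmink (cvec f) (wirt u v) = 0 := by
  rw [cmink_comm, wirt, cmink_smul_left, cmink_sub_left, cmink_smul_left, cmink_comm,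
    cmink_comm (cvec v), cmink_cvec, cmink_cvec, hu, hv]
  simp

/-- The equation `X_z = A X`, entry by entry. -/
lemma wirt_eq_conn {s : ℝ} (hs : s ^ 2 = 1) {x d : Fin 4 → ℂ} (hx : cmink x x = 1)
    (hd : cmink x d = 0) :
    d 0 + d 3 = connA s d x * (x 0 + x 3) + connB s d x * (x 1 - Complex.I * s * x 2) ∧
    d 1 + Complex.I * s * d 2 =
      connA s d x * (x 1 + Complex.I * s * x 2) + connB s d x * (x 0 - x 3) ∧
    d 1 - Complex.I * s * d 2 =
      connC s d x * (x 0 + x 3) - connA s d x * (x 1 - Complex.I * s * x 2) ∧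
    d 0 - d 3 = connC s d x * (x 1 + Complex.I * s * x 2) - connA s d x * (x 0 - x 3) := by
  simp only [cmink] at hx hd
  simp only [connA, connB, connC]
  have hI : (Complex.I * s) ^ 2 = -1 := by
    rw [mul_pow, Complex.I_sq]; norm_cast; rw [hs]; simp
  generalize Complex.I * (s : ℂ) = t at *
  refine ⟨?_, ?_, ?_, ?_⟩
  · linear_combination (-(d 0 + d 3)) * hx + (d 0 + d 3) * (x 2 ^ 2) * hI 
  · linear_combination (-(d 1 + t * d 2)) * hx + (d 1 + t * d 2) * (x 2 ^ 2) * hI 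
  · linear_combination (-(d 1 - t * d 2)) * hx + (d 1 - t * d 2) * (x 2 ^ 2) * hI
      + 2 * (x 1 - t * x 2) * hd - 2 * (x 1 - t * x 2) * x 2 * d 2 * hI
  · linear_combination (-(d 0 - d 3)) * hx + (d 0 - d 3) * (x 2 ^ 2) * hI 
      + 2 * (x 0 - x 3) * hd - 2 * (x 0 - x 3) * x 2 * d 2 * hI

namespace IsCMC1Coord

variable {s : ℝ} {F : ℂ → Mink4} {Ω : Set ℂ} {z : ℂ}

lemma mink_fderiv (hc : IsCMC1Coord s F Ω) (hz : z ∈ Ω) (d : ℂ) :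
    mink (F z) (fderiv ℝ F z d) = 0 := by
  have dF := hc.smooth.differentiableAt_of_isOpen hc.isOpen hz
  have := mink_fderiv_eq_zero dF dF
    (Filter.eventually_of_mem (hc.isOpen.mem_nhds hz) hc.unit) d
  rw [mink_comm (fderiv ℝ F z d)] at this
  linarith

lemma cmink_self (hc : IsCMC1Coord s F Ω) (hz : z ∈ Ω) :
    cmink (cvec (F z)) (cvec (F z)) = 1 := by
  rw [cmink_cvec, hc.unit z hz]; simp

lemma cmink_wirt (hc : IsCMC1Coord s F Ω) (hz : z ∈ Ω) :
    cmink (cvec (F z)) (wirt (dX F z) (dY F z)) = 0 :=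
  cmink_cvec_wirt (hc.mink_fderiv hz 1) (hc.mink_fderiv hz Complex.I)

lemma conn_sq (hc : IsCMC1Coord s F Ω) (hz : z ∈ Ω) :
    cA s F z ^ 2 + cB s F z * cC s F z = 0 :=
  connA_sq_add hc.s_sq (hc.cmink_wirt hz) (cmink_wirt_self (hc.conf z hz) (hc.orth z hz))

/-- If both off-diagonal entries vanish, nilpotency kills the diagonal too. Then `X_z = 𝒜 X = 0`,
and as `F` is real its whole differential vanishes. -/
lemma conn_ne_zero (hc : IsCMC1Coord s F Ω) (hz : z ∈ Ω) : cB s F z ≠ 0 ∨ cC s F z ≠ 0 := by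
  by_contra! h
  have hA : cA s F z = 0 := by
    have := hc.conn_sq hz
    rw [h.1] at this
    simpa using this
  obtain ⟨h1, h2, h3, h4⟩ := wirt_eq_conn hc.s_sq (hc.cmink_self hz) (hc.cmink_wirt hz)
  rw [← cA, ← cB, hA, h.1] at h1 h2
  rw [← cA, ← cC, hA, h.2] at h3 h4
  simp only [zero_mul, add_zero, sub_zero] at h1 h2 h3 h4
  have hs : (s : ℂ) ≠ 0 := by
    have := hc.s_sq
    intro h0
    have : s = 0 := by exact_mod_cast h0
    simp [this] at *
  have hw : ∀ j, wirt (dX F z) (dY F z) j = 0 := by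
    intro j
    fin_cases j
    · change wirt (dX F z) (dY F z) 0 = 0
      linear_combination (1 / 2) * (h1 + h4)
    · change wirt (dX F z) (dY F z) 1 = 0
      linear_combination (1 / 2) * (h2 + h3)
    · change wirt (dX F z) (dY F z) 2 = 0
      refine mul_left_cancel₀ (mul_ne_zero Complex.I_ne_zero hs) ?_
      linear_combination (1 / 2) * (h2 - h3)
    · change wirt (dX F z) (dY F z) 3 = 0
      linear_combination (1 / 2) * (h1 - h4)
  have hXY : ∀ j, dX F z j = 0 ∧ dY F z j = 0 := by
    intro j
    have := hw j
    simp only [wirt, cvec, Pi.smul_apply, Pi.sub_apply, smul_eq_mul] at this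
    have h5 := congrArg Complex.re this
    have h6 := congrArg Complex.im this
    simp at h5 h6
    exact ⟨h5, h6⟩
  refine hc.imm z hz (ContinuousLinearMap.ext fun v => ?_)
  have hv : v = v.re • (1 : ℂ) + v.im • Complex.I := by
    simp [Complex.real_smul, Complex.re_add_im]
  rw [hv, map_add, map_smul, map_smul, fderiv_one_eq, fderiv_I_eq]
  funext j
  simp [hXY j]

/-- The two quotients in the definition agree because of the derivative of `𝒜² = 0`. Where `cC = 0`
also `cA = 0` and `cB ≠ 0`, so that only the second quotient is available. -/
lemma hopfCoeff_spec (hc : IsCMC1Coord s F Ω) (hz : z ∈ Ω) :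
    hopfCoeff s F z * cC s F z = cC s F z * deriv (cA s F) z - cA s F z * deriv (cC s F) z ∧
    hopfCoeff s F z * cB s F z = cA s F z * deriv (cB s F) z - cB s F z * deriv (cA s F) z := by
  have mem := hc.isOpen.mem_nhds hz
  have dA := (hc.holA.differentiableAt mem).hasDerivAt
  have dB := (hc.holB.differentiableAt mem).hasDerivAt
  have dC := (hc.holC.differentiableAt mem).hasDerivAt
  have h0 := hc.conn_sq hz
  have h1 : 2 * cA s F z * deriv (cA s F) z + (deriv (cB s F) z * cC s F z
      + cB s F z * deriv (cC s F) z) = 0 := by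
    have h2 := ((dA.fun_pow 2).fun_add (dB.fun_mul dC)).deriv
    have h3 : deriv (fun ζ => cA s F ζ ^ 2 + cB s F ζ * cC s F ζ) z = 0 := by
      rw [Filter.EventuallyEq.deriv_eq (f := fun _ => (0 : ℂ))
        (Filter.eventually_of_mem mem fun ζ hζ => hc.conn_sq hζ)]
      simp
    rw [h3] at h2
    simp at h2
    linear_combination -h2
  by_cases hC : cC s F z = 0
  · have hA : cA s F z = 0 := by rw [hC] at h0; simpa using h0
    have hB : cB s F z ≠ 0 := (hc.conn_ne_zero hz).resolve_right (by simpa using hC)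
    have hC' : deriv (cC s F) z = 0 := by
      rw [hC, hA] at h1
      simpa [hB] using h1
    simp only [hopfCoeff, hC, ne_eq, not_true_eq_false, if_false]
    refine ⟨by simp [hA], div_mul_cancel₀ _ hB⟩
  · simp only [hopfCoeff, ne_eq, hC, not_false_eq_true, if_true]
    refine ⟨div_mul_cancel₀ _ hC, ?_⟩
    rw [div_mul_eq_mul_div, div_eq_iff hC]
    linear_combination (deriv (cA s F) z * 2) * h0 - cA s F z * h1

lemma hopfCoeff_unique (hc : IsCMC1Coord s F Ω) (hz : z ∈ Ω) {q : ℂ}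
    (h1 : q * cC s F z = cC s F z * deriv (cA s F) z - cA s F z * deriv (cC s F) z)
    (h2 : q * cB s F z = cA s F z * deriv (cB s F) z - cB s F z * deriv (cA s F) z) :
    q = hopfCoeff s F z := by
  obtain ⟨h3, h4⟩ := hc.hopfCoeff_spec hz
  rcases hc.conn_ne_zero hz with h | h
  · exact mul_right_cancel₀ h (h2.trans h4.symm)
  · exact mul_right_cancel₀ h (h1.trans h3.symm)

/-- Near each point one of the two quotients has a nonvanishing denominator on a whole
neighbourhood, whatever branch the definition takes pointwise. -/
lemma differentiableOn_hopfCoeff (hc : IsCMC1Coord s F Ω) :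
    DifferentiableOn ℂ (hopfCoeff s F) Ω := by
  have dA' := hc.holA.deriv hc.isOpen
  have dB' := hc.holB.deriv hc.isOpen
  have dC' := hc.holC.deriv hc.isOpen
  intro z hz
  have mem := hc.isOpen.mem_nhds hz
  have a := hc.holA.differentiableAt mem
  have b := hc.holB.differentiableAt mem
  have c := hc.holC.differentiableAt mem
  have a' := dA'.differentiableAt mem
  have b' := dB'.differentiableAt mem
  have c' := dC'.differentiableAt mem
  refine DifferentiableAt.differentiableWithinAt ?_
  rcases hc.conn_ne_zero hz with h | h
  · have : (fun ζ => (cA s F ζ * deriv (cB s F) ζ - cB s F ζ * deriv (cA s F) ζ) / cB s F ζ)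
        =ᶠ[𝓝 z] hopfCoeff s F := by
      filter_upwards [mem, b.continuousAt.eventually_ne h] with ζ hζ hb
      rw [div_eq_iff hb, (hc.hopfCoeff_spec hζ).2]
    exact (((a.fun_mul b').fun_sub (b.fun_mul a')).fun_div b h).congr_of_eventuallyEq this.symm
  · have : (fun ζ => (cC s F ζ * deriv (cA s F) ζ - cA s F ζ * deriv (cC s F) ζ) / cC s F ζ)
        =ᶠ[𝓝 z] hopfCoeff s F := by
      filter_upwards [mem, c.continuousAt.eventually_ne h] with ζ hζ hb
      rw [div_eq_iff hb, (hc.hopfCoeff_spec hζ).1]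
    exact (((c.fun_mul a').fun_sub (a.fun_mul c')).fun_div c h).congr_of_eventuallyEq this.symm

end IsCMC1Coord

lemma clm_complex_apply (L : ℂ →L[ℝ] Mink4) (v : ℂ) :
    L v = v.re • L 1 + v.im • L Complex.I := by
  conv_lhs => rw [show v = v.re • (1 : ℂ) + v.im • Complex.I by
    simp [Complex.real_smul, Complex.re_add_im], map_add, map_smul, map_smul]

lemma CMC1Jet.tripleProd_ne_zero {s : ℝ} {f u v n uu uv vv : Mink4}
    (h : CMC1Jet s f u v n uu uv vv) : tripleProd (cvec f) (wirt u v) (wirtBar u v) ≠ 0 := by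
  have hs : (s : ℂ) ≠ 0 := by
    have := h.s_sq
    intro h0
    have : s = 0 := by exact_mod_cast h0
    simp [this] at *
  have hE : ((mink u u / 2 : ℝ) : ℂ) ≠ 0 := by
    exact_mod_cast (half_pos h.pos).ne'
  rw [h.tripleProd_eq]
  intro h0
  have hn : cvec n = 0 := (smul_eq_zero.mp h0).resolve_left
    (mul_ne_zero (mul_ne_zero Complex.I_ne_zero hs) hE)
  have h1 := cmink_cvec n n
  rw [hn, h.nn] at h1
  simp [cmink] at h1

/-- The component of the Laplacian of `F` normal to `F`. -/
def normalLaplacian (F : ℂ → Mink4) (z : ℂ) : Fin 4 → ℂ :=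
  (1 / 4 : ℂ) • (cvec (dX (dX F) z) + cvec (dY (dY F) z)) +
    ((mink (dX F z) (dX F z) / 2 : ℝ) : ℂ) • cvec (F z)

/-- A conformal map that is, on a dense open set, a spacelike CMC-1 immersion with normal `ν`. -/
lemma IsCMC1Coord.of_normal {s : ℝ} {F ν : ℂ → Mink4} {Ω W : Set ℂ} (hΩ : IsOpen Ω)
    (hW : IsOpen W) (hWΩ : W ⊆ Ω) (hdense : Ω ⊆ closure W) (hs : s ^ 2 = 1)
    (hF : ContDiffOn ℝ ∞ F Ω) (hν : ContDiffOn ℝ ∞ ν W)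
    (unit : ∀ z ∈ Ω, mink (F z) (F z) = 1)
    (conf : ∀ z ∈ Ω, mink (dY F z) (dY F z) = mink (dX F z) (dX F z))
    (orth : ∀ z ∈ Ω, mink (dX F z) (dY F z) = 0)
    (imm : ∀ z ∈ Ω, fderiv ℝ F z ≠ 0)
    (pos : ∀ z ∈ W, 0 < mink (dX F z) (dX F z))
    (nn : ∀ z ∈ W, mink (ν z) (ν z) = -1) (nf : ∀ z ∈ W, mink (ν z) (F z) = 0)
    (nu : ∀ z ∈ W, mink (ν z) (dX F z) = 0) (nv : ∀ z ∈ W, mink (ν z) (dY F z) = 0)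
    (det : ∀ z ∈ W, 0 < -s * (Matrix.of ![F z, dX F z, dY F z, ν z]).det)
    (mean : ∀ z ∈ W,
      mink (dX F z) (dX ν z) + mink (dY F z) (dY ν z) = -2 * mink (dX F z) (dX F z)) :
    IsCMC1Coord s F Ω ∧ (∀ z ∈ W, ∀ v : ℂ, -mink (fderiv ℝ F z v) (fderiv ℝ ν z v) =
      2 * (hopfCoeff s F z * v ^ 2).re + mink (fderiv ℝ F z v) (fderiv ℝ F z v)) ∧
    ∀ z ∈ W, normalLaplacian F z = (Complex.I * s) • tripleProd (cvec (F z))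
        (wirt (dX F z) (dY F z)) (wirtBar (dX F z) (dY F z)) ∧
      tripleProd (cvec (F z)) (wirt (dX F z) (dY F z)) (wirtBar (dX F z) (dY F z)) ≠ 0 := by
  have jet := fun z hz => CMC1Jet.of_normal hW hs (hF.mono hWΩ) hν (fun z hz => unit z (hWΩ hz))
    (fun z hz => conf z (hWΩ hz)) (fun z hz => orth z (hWΩ hz)) pos nn nf nu nv det mean (z := z) hz
  have hWW : Ω ⊆ closure (W ∩ Ω) := by rwa [inter_eq_left.mpr hWΩ]
  have cr := fun z (hz : z ∈ W ∩ Ω) => conn_cr_of_jet hΩ hF hz.2 (jet z hz.1).1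
  -- The Cauchy-Riemann equations are known only on `W`, but the connection entries are smooth on
  -- all of `Ω`, so they extend to the singular points by density.
  have hc : IsCMC1Coord s F Ω := ⟨hΩ, hs, hF, unit, conf, orth, imm,
    differentiableOn_of_dense hΩ (contDiffOn_bilin (connAL s) hΩ hF) hWW fun z hz => (cr z hz).1,
    differentiableOn_of_dense hΩ (contDiffOn_bilin (connBL s) hΩ hF) hWW fun z hz => (cr z hz).2.1,
    differentiableOn_of_dense hΩ (contDiffOn_bilin (connCL s) hΩ hF) hWW fun z hz => (cr z hz).2.2⟩
  refine ⟨hc, fun z hz v => ?_, fun z hz => ⟨?_, (jet z hz).1.tripleProd_ne_zero⟩⟩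
  swap
  · rw [normalLaplacian, (jet z hz).1.laplacian_eq, neg_smul]
    abel
  obtain ⟨j, h1, h2, h3, h4⟩ := jet z hz
  obtain ⟨dA, dB, dC⟩ := deriv_conn_of_jet hc (hWΩ hz) j
  -- The coefficient computed from the normal satisfies the relations that characterize `hopfCoeff`.
  have hq : CMC1Jet.hopf (ν z) (dX (dX F) z) (dY (dX F) z) (dY (dY F) z) = hopfCoeff s F z := by
    refine hc.hopfCoeff_unique (hWΩ hz) ?_ ?_
    · rw [dA, dC]; exact j.hopf_mul_connC
    · rw [dA, dB]; exact j.hopf_mul_connB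
  rw [← hq, clm_complex_apply (fderiv ℝ F z), clm_complex_apply (fderiv ℝ ν z), CMC1Jet.hopf,
    fderiv_one_eq, fderiv_one_eq, fderiv_I_eq, fderiv_I_eq]
  have e1 : ∀ (a b : ℝ) (p q p' q' : Mink4), mink (a • p + b • q) (a • p' + b • q') =
      a ^ 2 * mink p p' + a * b * (mink p q' + mink q p') + b ^ 2 * mink q q' := by
    intros; simp only [mink, Pi.add_apply, Pi.smul_apply, smul_eq_mul]; ring
  have e2 : (((((mink (dX (dX F) z) (ν z) - mink (dY (dY F) z) (ν z)) / 4 : ℝ) : ℂ)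
      - Complex.I * (mink (dY (dX F) z) (ν z) / 2 : ℝ)) * v ^ 2).re =
      (mink (dX (dX F) z) (ν z) - mink (dY (dY F) z) (ν z)) / 4 * (v.re ^ 2 - v.im ^ 2)
        + mink (dY (dX F) z) (ν z) * (v.re * v.im) := by
    rw [pow_two v]
    simp only [Complex.mul_re, Complex.sub_re, Complex.ofReal_re, Complex.I_re, Complex.I_im,
      Complex.ofReal_im, Complex.sub_im, Complex.mul_im]
    ring
  rw [e1, e1, e2]
  have o := orth z (hWΩ hz)
  have o' := mink_comm (dX F z) (dY F z)
  have c := conf z (hWΩ hz)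
  have m := mean z hz
  rw [← o', c, o]
  linear_combination (-(v.re ^ 2 - v.im ^ 2) / 2) * (h1 - h4) - v.re * v.im * (h2 + h3)
    - (v.re ^ 2 + v.im ^ 2) / 2 * m

/-! ### Change of coordinates -/

section Congr

variable {s : ℝ} {F G : ℂ → Mink4} {z : ℂ}

lemma conn_congr (h : F =ᶠ[𝓝 z] G) :
    cA s F =ᶠ[𝓝 z] cA s G ∧ cB s F =ᶠ[𝓝 z] cB s G ∧ cC s F =ᶠ[𝓝 z] cC s G := by
  have h' := h.fderiv (𝕜 := ℝ)
  refine ⟨?_, ?_, ?_⟩ <;> filter_upwards [h, h'] with ζ h1 h2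
  · simp only [cA, dX, dY, h1, h2]
  · simp only [cB, dX, dY, h1, h2]
  · simp only [cC, dX, dY, h1, h2]

lemma hopfCoeff_congr (h : F =ᶠ[𝓝 z] G) : hopfCoeff s F z = hopfCoeff s G z := by
  obtain ⟨hA, hB, hC⟩ := conn_congr (s := s) h
  simp only [hopfCoeff, hA.deriv_eq, hB.deriv_eq, hC.deriv_eq, hA.eq_of_nhds, hB.eq_of_nhds,
    hC.eq_of_nhds]

end Congr

section Comp

variable {s : ℝ} {F : ℂ → Mink4} {τ : ℂ → ℂ} {z : ℂ}

lemma fderiv_comp_holomorphic (hF : DifferentiableAt ℝ F (τ z)) (hτ : DifferentiableAt ℂ τ z)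
    (v : ℂ) : fderiv ℝ (fun ζ => F (τ ζ)) z v = fderiv ℝ F (τ z) (deriv τ z * v) := by
  have h := (hF.hasFDerivAt.comp z (hτ.hasFDerivAt.restrictScalars ℝ)).fderiv
  have h2 : fderiv ℝ (fun ζ => F (τ ζ)) z = _ := h
  rw [h2]
  simp [mul_comm]

lemma dX_comp (hF : DifferentiableAt ℝ F (τ z)) (hτ : DifferentiableAt ℂ τ z) :
    dX (fun ζ => F (τ ζ)) z = (deriv τ z).re • dX F (τ z) + (deriv τ z).im • dY F (τ z) := by
  rw [dX, fderiv_comp_holomorphic hF hτ, mul_one, clm_complex_apply]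
  rfl

lemma dY_comp (hF : DifferentiableAt ℝ F (τ z)) (hτ : DifferentiableAt ℂ τ z) :
    dY (fun ζ => F (τ ζ)) z = (-(deriv τ z).im) • dX F (τ z) + (deriv τ z).re • dY F (τ z) := by
  rw [dY, fderiv_comp_holomorphic hF hτ, clm_complex_apply]
  simp [dX, dY]

lemma mink_lin (a b c d : ℝ) (p q : Mink4) : mink (a • p + b • q) (c • p + d • q) =
    a * c * mink p p + (a * d + b * c) * mink p q + b * d * mink q q := by
  simp only [mink, Pi.add_apply, Pi.smul_apply, smul_eq_mul]; ring

lemma conn_comp (hF : DifferentiableAt ℝ F (τ z)) (hτ : DifferentiableAt ℂ τ z) :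
    cA s (fun ζ => F (τ ζ)) z = deriv τ z * cA s F (τ z) ∧
    cB s (fun ζ => F (τ ζ)) z = deriv τ z * cB s F (τ z) ∧
    cC s (fun ζ => F (τ ζ)) z = deriv τ z * cC s F (τ z) := by
  have hw : wirt (dX (fun ζ => F (τ ζ)) z) (dY (fun ζ => F (τ ζ)) z) =
      deriv τ z • wirt (dX F (τ z)) (dY F (τ z)) := by
    rw [dX_comp hF hτ, dY_comp hF hτ]
    funext j
    have h := Complex.re_add_im (deriv τ z)
    simp only [wirt, cvec, Pi.smul_apply, Pi.sub_apply, Pi.add_apply, smul_eq_mul,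
      Complex.ofReal_add, Complex.ofReal_mul, Complex.ofReal_neg]
    linear_combination (1 / 2 * (dX F (τ z) j - Complex.I * dY F (τ z) j) : ℂ) * h
      + (1 / 2 * ((deriv τ z).im * (dY F (τ z) j)) : ℂ) * Complex.I_sq
  refine ⟨?_, ?_, ?_⟩
  · simp only [cA, hw, connA, Pi.smul_apply, smul_eq_mul]; ring
  · simp only [cB, hw, connB, Pi.smul_apply, smul_eq_mul]; ring
  · simp only [cC, hw, connC, Pi.smul_apply, smul_eq_mul]; ring

lemma mink_dX_comp (hF : DifferentiableAt ℝ F (τ z)) (hτ : DifferentiableAt ℂ τ z)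
    (conf : mink (dY F (τ z)) (dY F (τ z)) = mink (dX F (τ z)) (dX F (τ z)))
    (orth : mink (dX F (τ z)) (dY F (τ z)) = 0) :
    mink (dX (fun ζ => F (τ ζ)) z) (dX (fun ζ => F (τ ζ)) z) =
      ‖deriv τ z‖ ^ 2 * mink (dX F (τ z)) (dX F (τ z)) := by
  rw [dX_comp hF hτ, mink_lin, conf, orth, ← Complex.normSq_eq_norm_sq, Complex.normSq_apply]
  ring

variable {Ω Ω' : Set ℂ}

/-- The connection matrix transforms by the factor `τ'`. In `𝒜 𝒜' = q 𝒜` the terms with `τ''`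
cancel, so `q` picks up `τ'²`, as a quadratic differential should. -/
lemma IsCMC1Coord.comp (hc : IsCMC1Coord s F Ω) (hΩ' : IsOpen Ω') (hτ : DifferentiableOn ℂ τ Ω')
    (hmaps : MapsTo τ Ω' Ω) (hne : ∀ z ∈ Ω', deriv τ z ≠ 0) :
    IsCMC1Coord s (fun ζ => F (τ ζ)) Ω' ∧
    ∀ z ∈ Ω', hopfCoeff s (fun ζ => F (τ ζ)) z = deriv τ z ^ 2 * hopfCoeff s F (τ z) := by
  have dτ := fun z (hz : z ∈ Ω') => hτ.differentiableAt (hΩ'.mem_nhds hz)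
  have dF := fun z hz => hc.smooth.differentiableAt_of_isOpen hc.isOpen (hmaps (x := z) hz)
  have hτ' := hτ.deriv hΩ'
  have key := fun z hz => conn_comp (s := s) (dF z hz) (dτ z hz)
  have hcc : IsCMC1Coord s (fun ζ => F (τ ζ)) Ω' := by
    refine ⟨hΩ', hc.s_sq, ?_, fun z hz => hc.unit _ (hmaps hz), ?_, ?_, ?_, ?_, ?_, ?_⟩
    · exact hc.smooth.comp ((hτ.contDiffOn hΩ').restrict_scalars ℝ) hmaps
    · intro z hz
      rw [mink_dX_comp (dF z hz) (dτ z hz) (hc.conf _ (hmaps hz)) (hc.orth _ (hmaps hz)),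
        dY_comp (dF z hz) (dτ z hz), mink_lin, hc.conf _ (hmaps hz), hc.orth _ (hmaps hz),
        ← Complex.normSq_eq_norm_sq, Complex.normSq_apply]
      ring
    · intro z hz
      rw [dX_comp (dF z hz) (dτ z hz), dY_comp (dF z hz) (dτ z hz), mink_lin,
        hc.conf _ (hmaps hz), hc.orth _ (hmaps hz)]
      ring
    · intro z hz h0
      refine hc.imm _ (hmaps hz) (ContinuousLinearMap.ext fun v => ?_)
      have := fderiv_comp_holomorphic (dF z hz) (dτ z hz) ((deriv τ z)⁻¹ * v)
      rw [h0, mul_inv_cancel_left₀ (hne z hz)] at this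
      simpa using this.symm
    · exact (hτ'.fun_mul (hc.holA.comp hτ hmaps)).congr fun z hz => (key z hz).1
    · exact (hτ'.fun_mul (hc.holB.comp hτ hmaps)).congr fun z hz => (key z hz).2.1
    · exact (hτ'.fun_mul (hc.holC.comp hτ hmaps)).congr fun z hz => (key z hz).2.2
  refine ⟨hcc, fun z hz => (hcc.hopfCoeff_unique hz ?_ ?_).symm⟩
  all_goals
    have mem := hΩ'.mem_nhds hz
    have mem' := hc.isOpen.mem_nhds (hmaps hz)
    have t := (dτ z hz).hasDerivAt
    have t' := (hτ'.differentiableAt mem).hasDerivAt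
    have dA : deriv (cA s fun ζ => F (τ ζ)) z = deriv (deriv τ) z * cA s F (τ z) +
        deriv τ z * (deriv (cA s F) (τ z) * deriv τ z) := by
      rw [Filter.EventuallyEq.deriv_eq (f := fun ζ => deriv τ ζ * cA s F (τ ζ))
        (Filter.eventually_of_mem mem fun ζ hζ => (key ζ hζ).1)]
      exact (t'.fun_mul ((hc.holA.differentiableAt mem').hasDerivAt.comp z t)).deriv
    have dB : deriv (cB s fun ζ => F (τ ζ)) z = deriv (deriv τ) z * cB s F (τ z) +
        deriv τ z * (deriv (cB s F) (τ z) * deriv τ z) := by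
      rw [Filter.EventuallyEq.deriv_eq (f := fun ζ => deriv τ ζ * cB s F (τ ζ))
        (Filter.eventually_of_mem mem fun ζ hζ => (key ζ hζ).2.1)]
      exact (t'.fun_mul ((hc.holB.differentiableAt mem').hasDerivAt.comp z t)).deriv
    have dC : deriv (cC s fun ζ => F (τ ζ)) z = deriv (deriv τ) z * cC s F (τ z) +
        deriv τ z * (deriv (cC s F) (τ z) * deriv τ z) := by
      rw [Filter.EventuallyEq.deriv_eq (f := fun ζ => deriv τ ζ * cC s F (τ ζ))
        (Filter.eventually_of_mem mem fun ζ hζ => (key ζ hζ).2.2)]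
      exact (t'.fun_mul ((hc.holC.differentiableAt mem').hasDerivAt.comp z t)).deriv
    obtain ⟨s1, s2⟩ := hc.hopfCoeff_spec (hmaps hz)
    obtain ⟨k1, k2, k3⟩ := key z hz
  · rw [dA, dC, k1, k3]
    linear_combination (deriv τ z ^ 3) * s1
  · rw [dA, dB, k1, k2]
    linear_combination (deriv τ z ^ 3) * s2

end Comp

/-! ### Linear holomorphic differential equations on a disc -/

section LinearODE

variable {E : Type*} [NormedAddCommGroup E] [NormedSpace ℂ E] [CompleteSpace E]

/-- A linear holomorphic differential equation on a disc has a global solution. -/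
theorem exists_linear_ode_solution {R : ℝ} {A : ℂ → E →L[ℂ] E}
    (hA : DifferentiableOn ℂ A (Metric.ball 0 R)) (y₀ : E) :
    ∃ Y : ℂ → E, Y 0 = y₀ ∧ ∀ z ∈ Metric.ball (0 : ℂ) R, HasDerivAt Y (A z (Y z)) z := by
  classical
  -- One Picard step: the primitive of `A h` on the disc that vanishes at `0`.
  have step : ∀ h : {h : ℂ → E // DifferentiableOn ℂ h (Metric.ball 0 R)},
      ∃ g : {h : ℂ → E // DifferentiableOn ℂ h (Metric.ball 0 R)}, g.1 0 = 0 ∧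
        ∀ z ∈ Metric.ball (0 : ℂ) R, HasDerivAt g.1 (A z (h.1 z)) z := by
    intro h
    obtain ⟨g, hg0, hg⟩ := ((hA.clm_apply h.2).isExactOn_ball).with_val_at 0 0
    exact ⟨⟨g, fun z hz => (hg z hz).differentiableAt.differentiableWithinAt⟩, hg0, hg⟩
  choose I hI0 hI using step
  let Y : ℕ → {h : ℂ → E // DifferentiableOn ℂ h (Metric.ball 0 R)} := fun n =>
    Nat.rec ⟨fun _ => y₀, differentiableOn_const _⟩ (fun _ h => I h) n
  have Y0 : ∀ z, (Y 0).1 z = y₀ := fun z => rfl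
  have Ysucc : ∀ n, Y (n + 1) = I (Y n) := fun n => rfl
  let Y' : ℕ → ℂ → E := fun n z => Nat.casesOn n 0 fun m => A z ((Y m).1 z)
  have hY' : ∀ n, ∀ z ∈ Metric.ball (0 : ℂ) R, HasDerivAt (Y n).1 (Y' n z) z := by
    intro n z hz
    cases n with
    | zero => exact hasDerivAt_const z y₀
    | succ m => rw [Ysucc]; exact hI (Y m) z hz
  -- The `n`-th term `Y n` of the Picard series is bounded like a term of the exponential series, by
  -- comparison of growth along the segment from `0` to `z`.
  have bound : ∀ r < R, ∀ K : ℝ, (∀ z ∈ Metric.ball (0 : ℂ) r, ‖A z‖ ≤ K) → ∀ n,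
      ∀ z ∈ Metric.ball (0 : ℂ) r, ‖(Y n).1 z‖ ≤ ‖y₀‖ * (K * ‖z‖) ^ n / n.factorial := by
    intro r hr K hK n
    induction n with
    | zero => intro z _; simp [Y0]
    | succ m ih =>
      intro z hz
      have hseg : ∀ t ∈ Icc (0 : ℝ) 1, (t : ℂ) * z ∈ Metric.ball (0 : ℂ) r := by
        intro t ht
        rw [mem_ball_zero_iff] at hz ⊢
        rw [norm_mul, Complex.norm_real, Real.norm_of_nonneg ht.1]
        exact (mul_le_of_le_one_left (norm_nonneg z) ht.2).trans_lt hz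
      have hd : ∀ t ∈ Icc (0 : ℝ) 1, HasDerivAt (fun t : ℝ => (Y (m + 1)).1 ((t : ℂ) * z))
          (z • A ((t : ℂ) * z) ((Y m).1 ((t : ℂ) * z))) t := by
        intro t ht
        have h1 := hY' (m + 1) _ (Metric.ball_subset_ball hr.le (hseg t ht))
        have h2 : HasDerivAt (fun t : ℝ => (t : ℂ) * z) z t := by
          simpa using (Complex.ofRealCLM.hasDerivAt (x := t)).mul_const z
        exact h1.scomp t h2
      have key := image_norm_le_of_norm_deriv_right_le_deriv_boundary
        (f := fun t : ℝ => (Y (m + 1)).1 ((t : ℂ) * z)) (a := 0) (b := 1)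
        (B := fun t => ‖y₀‖ * (K * (t * ‖z‖)) ^ (m + 1) / (m + 1).factorial)
        (B' := fun t => ‖z‖ * (K * (‖y₀‖ * (K * (t * ‖z‖)) ^ m / m.factorial)))
        (fun t ht => (hd t ht).continuousAt.continuousWithinAt)
        (fun t ht => (hd t (Ico_subset_Icc_self ht)).hasDerivWithinAt)
        (by simp only [Complex.ofReal_zero, zero_mul, Ysucc, hI0]; simp)
        (fun t => by
          have h1 : HasDerivAt (fun t : ℝ => K * (t * ‖z‖)) (K * ‖z‖) t := by
            simpa using ((hasDerivAt_id t).mul_const ‖z‖).const_mul K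
          have h2 := ((h1.fun_pow (m + 1)).const_mul ‖y₀‖).div_const ((m + 1).factorial : ℝ)
          refine h2.congr_deriv ?_
          rw [Nat.factorial_succ]
          have : (m.factorial : ℝ) ≠ 0 := by exact_mod_cast m.factorial_ne_zero
          push_cast
          field_simp)
        (fun t ht => by
          have ht' := Ico_subset_Icc_self ht
          rw [norm_smul]
          have h1 := ih _ (hseg t ht')
          rw [norm_mul, Complex.norm_real, Real.norm_of_nonneg ht'.1] at h1
          exact mul_le_mul_of_nonneg_left (((A _).le_opNorm _).trans (mul_le_mul
            (hK _ (hseg t ht')) h1 (norm_nonneg _) ((norm_nonneg _).trans (hK _ (hseg t ht')))))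
            (norm_nonneg z))
        (right_mem_Icc.mpr zero_le_one)
      simpa using key
  refine ⟨fun z => ∑' n, (Y n).1 z, ?_, fun z hz => ?_⟩
  · beta_reduce
    rw [tsum_eq_single 0]
    · exact Y0 0
    · intro n hn
      obtain ⟨m, rfl⟩ := Nat.exists_eq_succ_of_ne_zero hn
      exact hI0 (Y m)
  · rw [mem_ball_zero_iff] at hz
    obtain ⟨r, hzr, hrR⟩ := exists_between hz
    have hr0 : 0 < r := (norm_nonneg z).trans_lt hzr
    obtain ⟨K, hK⟩ : ∃ K, ∀ z ∈ Metric.ball (0 : ℂ) r, ‖A z‖ ≤ K := by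
      obtain ⟨K, hK⟩ := (isCompact_closedBall (0 : ℂ) r).exists_bound_of_continuousOn
        (hA.continuousOn.mono (Metric.closedBall_subset_ball hrR))
      exact ⟨K, fun z hz => hK z (Metric.ball_subset_closedBall hz)⟩
    have hK0 : 0 ≤ K := (norm_nonneg _).trans (hK 0 (Metric.mem_ball_self hr0))
    have hb := bound r hrR K hK
    have hb' : ∀ n, ∀ w ∈ Metric.ball (0 : ℂ) r, ‖(Y n).1 w‖ ≤ ‖y₀‖ * (K * r) ^ n / n.factorial := by
      intro n w hw
      refine (hb n w hw).trans ?_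
      have := (mem_ball_zero_iff.mp hw).le
      gcongr
    have hsum : Summable fun n : ℕ => ‖y₀‖ * (K * r) ^ n / n.factorial := by
      simpa [mul_div_assoc] using (Real.summable_pow_div_factorial (K * r)).mul_left ‖y₀‖
    have hsumY : ∀ w ∈ Metric.ball (0 : ℂ) r, Summable fun n => (Y n).1 w := fun w hw =>
      Summable.of_norm_bounded hsum fun n => hb' n w hw
    -- The majorant for the derivatives starts with `0`, since the zeroth term is constant; the
    -- others satisfy `(Y (m + 1))' = A (Y m)`.
    have hsum' : Summable fun n : ℕ =>
        (Nat.casesOn n 0 fun m => K * (‖y₀‖ * (K * r) ^ m / m.factorial) : ℝ) := by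
      rw [← summable_nat_add_iff 1]
      exact hsum.mul_left K
    have hzr' : z ∈ Metric.ball (0 : ℂ) r := mem_ball_zero_iff.mpr hzr
    have hd := hasDerivAt_tsum_of_isPreconnected hsum' Metric.isOpen_ball
      (convex_ball (0 : ℂ) r).isPreconnected
      (fun n w hw => hY' n w (Metric.ball_subset_ball hrR.le hw))
      (fun n w hw => by
        cases n with
        | zero => simp [Y']
        | succ m => exact ((A w).le_opNorm _).trans (mul_le_mul (hK w hw) (hb' m w hw)
            (norm_nonneg _) hK0))
      (Metric.mem_ball_self hr0) (hsumY 0 (Metric.mem_ball_self hr0)) hzr'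
    refine hd.congr_deriv ?_
    have hs' : Summable fun n => Y' n z := by
      rw [← summable_nat_add_iff 1]
      exact (A z).summable (hsumY z hzr')
    rw [(A z).map_tsum (hsumY z hzr'), hs'.tsum_eq_zero_add]
    exact zero_add _

end LinearODE

/-! ### The normal form on a disc -/

/-- The Hermitian matrix of `x` as a sesquilinear form on row vectors. -/
def hermForm (s : ℝ) (x : Mink4) (a b c d : ℂ) : ℂ :=
  a * (x 0 + x 3) * conj c + a * (x 1 + Complex.I * s * x 2) * conj d +
    b * (x 1 - Complex.I * s * x 2) * conj c + b * (x 0 - x 3) * conj d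

lemma conj_hermForm (s : ℝ) (x : Mink4) (a b c d : ℂ) :
    conj (hermForm s x a b c d) = hermForm s x c d a b := by
  simp [hermForm]; ring

lemma hermForm_self_im (s : ℝ) (x : Mink4) (a b : ℂ) : (hermForm s x a b a b).im = 0 :=
  Complex.conj_eq_iff_im.mp (conj_hermForm s x a b a b)

/-- The polarization in rows `(a, b)`, `(c, d)` of the quadratic form of a traceless matrix. -/
def connForm (A B C a b c d : ℂ) : ℂ := (a * A + b * C) * d - (a * B - b * A) * c

/-- A row vector `r` with `r' = - r A` for the connection matrix `A`. -/
def IsDualSol (s : ℝ) (F : ℂ → Mink4) (Ω : Set ℂ) (r₁ r₂ : ℂ → ℂ) : Prop :=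
  ∀ z ∈ Ω, HasDerivAt r₁ (-(r₁ z * cA s F z + r₂ z * cC s F z)) z ∧
    HasDerivAt r₂ (-(r₁ z * cB s F z - r₂ z * cA s F z)) z

section DualSol

variable {s : ℝ} {F : ℂ → Mink4}

lemma exists_isDualSol {R : ℝ} (hc : IsCMC1Coord s F (Metric.ball 0 R)) (a b : ℂ) :
    ∃ r₁ r₂ : ℂ → ℂ, r₁ 0 = a ∧ r₂ 0 = b ∧ IsDualSol s F (Metric.ball 0 R) r₁ r₂ := by
  let p₁ := ContinuousLinearMap.fst ℂ ℂ ℂ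
  let p₂ := ContinuousLinearMap.snd ℂ ℂ ℂ
  let A : ℂ → (ℂ × ℂ) →L[ℂ] (ℂ × ℂ) := fun z =>
    cA s F z • ((-p₁).prod p₂) + cB s F z • (ContinuousLinearMap.prod 0 (-p₁))
      + cC s F z • (ContinuousLinearMap.prod (-p₂) 0)
  have hA : DifferentiableOn ℂ A (Metric.ball 0 R) :=
    ((hc.holA.smul_const _).add (hc.holB.smul_const _)).add (hc.holC.smul_const _)
  obtain ⟨Y, hY0, hY⟩ := exists_linear_ode_solution hA (a, b)
  refine ⟨fun z => (Y z).1, fun z => (Y z).2, by simp [hY0], by simp [hY0], fun z hz => ?_⟩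
  have h := hY z hz
  refine ⟨(p₁.hasFDerivAt.comp_hasDerivAt z h).congr_deriv ?_,
    (p₂.hasFDerivAt.comp_hasDerivAt z h).congr_deriv ?_⟩
  · simp [A, p₁, p₂]; ring
  · simp [A, p₁, p₂]; ring

lemma real_mul_mem_ball {R : ℝ} {z : ℂ} (hz : z ∈ Metric.ball (0 : ℂ) R) {t : ℝ}
    (ht : t ∈ Icc (0 : ℝ) 1) : (t : ℂ) * z ∈ Metric.ball (0 : ℂ) R := by
  rw [mem_ball_zero_iff] at hz ⊢
  rw [norm_mul, Complex.norm_real, Real.norm_of_nonneg ht.1]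
  exact (mul_le_of_le_one_left (norm_nonneg z) ht.2).trans_lt hz

lemma hasDerivAt_real_mul (z : ℂ) (t : ℝ) : HasDerivAt (fun t : ℝ => (t : ℂ) * z) z t := by
  simpa using (Complex.ofRealCLM.hasDerivAt (x := t)).mul_const z

/-- A function on a disc that is constant along radii is constant. -/
lemma eq_of_radial_deriv_zero {R : ℝ} {h : ℂ → ℂ}
    (hd : ∀ z ∈ Metric.ball (0 : ℂ) R, ∀ t ∈ Icc (0 : ℝ) 1,
      HasDerivAt (fun t : ℝ => h ((t : ℂ) * z)) 0 t) :
    ∀ z ∈ Metric.ball (0 : ℂ) R, h z = h 0 := by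
  intro z hz
  have := constant_of_has_deriv_right_zero (f := fun t : ℝ => h ((t : ℂ) * z)) (a := 0) (b := 1)
    (fun t ht => (hd z hz t ht).continuousAt.continuousWithinAt)
    (fun t ht => (hd z hz t (Ico_subset_Icc_self ht)).hasDerivWithinAt) 1
    (right_mem_Icc.mpr zero_le_one)
  simpa using this

/-- The Wronskian of two solutions is constant because the connection matrix is traceless. -/
lemma det_isDualSol {R : ℝ} {r₁ r₂ ρ₁ ρ₂ : ℂ → ℂ}
    (hr : IsDualSol s F (Metric.ball 0 R) r₁ r₂) (hρ : IsDualSol s F (Metric.ball 0 R) ρ₁ ρ₂) :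
    ∀ z ∈ Metric.ball (0 : ℂ) R,
      r₁ z * ρ₂ z - r₂ z * ρ₁ z = r₁ 0 * ρ₂ 0 - r₂ 0 * ρ₁ 0 := by
  refine eq_of_radial_deriv_zero (h := fun z => r₁ z * ρ₂ z - r₂ z * ρ₁ z) fun z hz t ht => ?_
  have hm := real_mul_mem_ball hz ht
  have h1 : HasDerivAt (fun z => r₁ z * ρ₂ z - r₂ z * ρ₁ z) 0 ((t : ℂ) * z) :=
    (((hr _ hm).1.fun_mul (hρ _ hm).2).fun_sub ((hr _ hm).2.fun_mul (hρ _ hm).1)).congr_deriv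
      (by ring)
  exact (h1.scomp t (hasDerivAt_real_mul z t)).congr_deriv (smul_zero _)

lemma ofReal_fderiv_apply (F : ℂ → Mink4) (z v : ℂ) (j : Fin 4) :
    ((fderiv ℝ F z v j : ℝ) : ℂ) = v * wirt (dX F z) (dY F z) j
      + conj (v * wirt (dX F z) (dY F z) j) := by
  rw [clm_complex_apply, fderiv_one_eq, fderiv_I_eq]
  simp only [wirt, cvec, Pi.add_apply, Pi.smul_apply, Pi.sub_apply, smul_eq_mul]
  apply Complex.ext
  · simp; ring
  · simp; ring

/-- As `X` is Hermitian, `dX = 𝒜 X dz + X 𝒜* dz̄`, which cancels exactly against `dr = -r 𝒜 dz` and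
`dρ* = -𝒜* ρ* dz̄`. In a frame of solutions the surface thus becomes a constant Hermitian matrix. -/
lemma hermForm_isDualSol {R : ℝ} (hc : IsCMC1Coord s F (Metric.ball 0 R)) {r₁ r₂ ρ₁ ρ₂ : ℂ → ℂ}
    (hr : IsDualSol s F (Metric.ball 0 R) r₁ r₂) (hρ : IsDualSol s F (Metric.ball 0 R) ρ₁ ρ₂) :
    ∀ z ∈ Metric.ball (0 : ℂ) R, hermForm s (F z) (r₁ z) (r₂ z) (ρ₁ z) (ρ₂ z) =
      hermForm s (F 0) (r₁ 0) (r₂ 0) (ρ₁ 0) (ρ₂ 0) := by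
  refine eq_of_radial_deriv_zero
    (h := fun z => hermForm s (F z) (r₁ z) (r₂ z) (ρ₁ z) (ρ₂ z)) fun z hz t ht => ?_
  have hm := real_mul_mem_ball hz ht
  have hseg := hasDerivAt_real_mul z t
  have hF := ((hc.smooth.differentiableAt_of_isOpen hc.isOpen hm).hasFDerivAt.comp_hasDerivAt t
    hseg)
  have hFj : ∀ j, HasDerivAt (fun t : ℝ => ((F ((t : ℂ) * z) j : ℝ) : ℂ))
      (fderiv ℝ F ((t : ℂ) * z) z j : ℝ) t := fun j =>
    ((hasDerivAt_pi.mp hF) j).ofReal_comp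
  have d1 := (hr _ hm).1.scomp t hseg
  have d2 := (hr _ hm).2.scomp t hseg
  have d3 := Complex.conjCLE.hasFDerivAt.comp_hasDerivAt t ((hρ _ hm).1.scomp t hseg)
  have d4 := Complex.conjCLE.hasFDerivAt.comp_hasDerivAt t ((hρ _ hm).2.scomp t hseg)
  have D := ((((d1.fun_mul ((hFj 0).fun_add (hFj 3))).fun_mul d3).fun_add
    ((d1.fun_mul ((hFj 1).fun_add ((hFj 2).const_mul (Complex.I * s)))).fun_mul d4)).fun_add
    ((d2.fun_mul ((hFj 1).fun_sub ((hFj 2).const_mul (Complex.I * s)))).fun_mul d3)).fun_add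
    ((d2.fun_mul ((hFj 0).fun_sub (hFj 3))).fun_mul d4)
  refine D.congr_deriv ?_
  obtain ⟨h1, h2, h3, h4⟩ := wirt_eq_conn hc.s_sq (hc.cmink_self hm) (hc.cmink_wirt hm)
  have g1 := congrArg conj h1
  have g2 := congrArg conj h2
  have g3 := congrArg conj h3
  have g4 := congrArg conj h4
  rw [← cA, ← cB] at h1 h2 g1 g2
  rw [← cA, ← cC] at h3 h4 g3 g4
  simp only [ofReal_fderiv_apply, Function.comp, smul_eq_mul, map_mul, map_add, map_sub, map_neg,
    Complex.conj_I, Complex.conj_ofReal, ContinuousLinearEquiv.coe_coe, cvec,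
    Complex.conjCLE_apply] at *
  generalize (t : ℂ) * z = ζ at *
  linear_combination r₁ ζ * conj (ρ₁ ζ) * (z * h1 + conj z * g1)
    + r₁ ζ * conj (ρ₂ ζ) * (z * h2 + conj z * g3)
    + r₂ ζ * conj (ρ₁ ζ) * (z * h3 + conj z * g2)
    + r₂ ζ * conj (ρ₂ ζ) * (z * h4 + conj z * g4)

end DualSol

lemma hermForm_lin_left (s : ℝ) (x : Mink4) (μ κ a b a' b' c d : ℂ) :
    hermForm s x (μ * a + κ * a') (μ * b + κ * b') c d =
      μ * hermForm s x a b c d + κ * hermForm s x a' b' c d := by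
  simp only [hermForm]; ring

/-- Multiplicativity of the determinant for `P X P*`, where `P` has rows `(a, b)`, `(c, d)` and `det
X = -⟨x, x⟩`. -/
lemma hermForm_det {s : ℝ} (hs : s ^ 2 = 1) (x : Mink4) (a b c d : ℂ) :
    hermForm s x a b a b * hermForm s x c d c d - hermForm s x a b c d * hermForm s x c d a b =
      (a * d - b * c) * conj (a * d - b * c) * (-(mink x x : ℝ)) := by
  have hI : (Complex.I * s) ^ 2 = -1 := by
    rw [mul_pow, Complex.I_sq]; norm_cast; rw [hs]; simp
  simp only [hermForm, mink, map_sub, map_mul, Complex.ofReal_add, Complex.ofReal_mul,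
    Complex.ofReal_neg]
  generalize Complex.I * (s : ℂ) = t at *
  linear_combination ((a * d - b * c) * (conj a * conj d - conj b * conj c) * (x 2 : ℂ) ^ 2) * hI

/-! ### Adapted frames and the first fundamental form -/

section Pointwise

variable {s : ℝ} {F : ℂ → Mink4} {Ω : Set ℂ} {z : ℂ}

/-- The derivative of the Hermitian form in terms of the connection matrix. -/
lemma hermForm_dX (hc : IsCMC1Coord s F Ω) (hz : z ∈ Ω) (a b c d : ℂ) :
    hermForm s (dX F z) a b c d =
      hermForm s (F z) (a * cA s F z + b * cC s F z) (a * cB s F z - b * cA s F z) c d +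
      conj (hermForm s (F z) (c * cA s F z + d * cC s F z) (c * cB s F z - d * cA s F z) a b) := by
  obtain ⟨h1, h2, h3, h4⟩ := wirt_eq_conn hc.s_sq (hc.cmink_self hz) (hc.cmink_wirt hz)
  have hX : ∀ j, (dX F z j : ℂ) = wirt (dX F z) (dY F z) j + conj (wirt (dX F z) (dY F z) j) := by
    intro j
    have := ofReal_fderiv_apply F z 1 j
    simpa [fderiv_one_eq] using this
  have g1 := congrArg conj h1
  have g2 := congrArg conj h2
  have g3 := congrArg conj h3
  have g4 := congrArg conj h4
  rw [← cA, ← cB] at h1 h2 g1 g2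
  rw [← cA, ← cC] at h3 h4 g3 g4
  simp only [hermForm, hX, map_mul, map_add, map_sub, Complex.conj_I, Complex.conj_ofReal,
    Complex.conj_conj, cvec] at *
  linear_combination a * conj c * (h1 + g1) + a * conj d * (h2 + g3) + b * conj c * (h3 + g2)
    + b * conj d * (h4 + g4)

lemma ofReal_norm_sq (x : ℂ) : ((‖x‖ : ℝ) : ℂ) ^ 2 = x * conj x := by
  rw [Complex.mul_conj, Complex.normSq_eq_norm_sq]; push_cast; ring

/-- The first fundamental form in an adapted frame of dual solutions. -/
lemma mink_dX_eq (hc : IsCMC1Coord s F Ω) (hz : z ∈ Ω) {r₁ r₂ ρ₁ ρ₂ : ℂ} {σ : ℝ}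
    (hσ : σ ^ 2 = 1) (hdet : r₁ * ρ₂ - r₂ * ρ₁ = 1)
    (hrr : hermForm s (F z) r₁ r₂ r₁ r₂ = σ) (hρρ : hermForm s (F z) ρ₁ ρ₂ ρ₁ ρ₂ = -σ)
    (hrρ : hermForm s (F z) r₁ r₂ ρ₁ ρ₂ = 0) :
    connForm (cA s F z) (cB s F z) (cC s F z) r₁ r₂ ρ₁ ρ₂ ^ 2 =
      connForm (cA s F z) (cB s F z) (cC s F z) ρ₁ ρ₂ ρ₁ ρ₂ *
        connForm (cA s F z) (cB s F z) (cC s F z) r₁ r₂ r₁ r₂ ∧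
    mink (dX F z) (dX F z) =
      (‖connForm (cA s F z) (cB s F z) (cC s F z) ρ₁ ρ₂ ρ₁ ρ₂‖ -
        ‖connForm (cA s F z) (cB s F z) (cC s F z) r₁ r₂ r₁ r₂‖) ^ 2 := by
  have hsq := hc.conn_sq hz
  have hρr : hermForm s (F z) ρ₁ ρ₂ r₁ r₂ = 0 := by
    rw [← conj_hermForm, hrρ, map_zero]
  have e11 := hermForm_dX hc hz r₁ r₂ r₁ r₂
  have e12 := hermForm_dX hc hz r₁ r₂ ρ₁ ρ₂
  have e21 := hermForm_dX hc hz ρ₁ ρ₂ r₁ r₂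
  have e22 := hermForm_dX hc hz ρ₁ ρ₂ ρ₁ ρ₂
  have hd := hermForm_det hc.s_sq (dX F z) r₁ r₂ ρ₁ ρ₂
  set a := cA s F z
  set b := cB s F z
  set c := cC s F z
  set k := connForm a b c ρ₁ ρ₂ ρ₁ ρ₂ with hk
  set m := connForm a b c r₁ r₂ ρ₁ ρ₂ with hm
  set l := connForm a b c r₁ r₂ r₁ r₂ with hl
  have hkl : m ^ 2 = k * l := by
    rw [hm, hk, hl]
    simp only [connForm]
    linear_combination ((r₁ * ρ₂ - r₂ * ρ₁) ^ 2) * hsq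
  -- In the frame `(r, ρ)` the connection matrix has rows `(m, -l)` and `(k, -m)`. The Hermitian
  -- matrix of `F_x` then has diagonal entries `σ (m + m̄)` and off-diagonal ones `σ (l + k̄)` and
  -- its conjugate; its determinant with `m² = k l` gives the formula.
  have ra1 : r₁ * a + r₂ * c = m * r₁ + (-l) * ρ₁ := by
    rw [hm, hl]; simp only [connForm]; linear_combination (-(r₁ * a + r₂ * c)) * hdet
  have ra2 : r₁ * b - r₂ * a = m * r₂ + (-l) * ρ₂ := by
    rw [hm, hl]; simp only [connForm]; linear_combination (-(r₁ * b - r₂ * a)) * hdet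
  have rb1 : ρ₁ * a + ρ₂ * c = k * r₁ + (-m) * ρ₁ := by
    rw [hm, hk]; simp only [connForm]; linear_combination (-(ρ₁ * a + ρ₂ * c)) * hdet
  have rb2 : ρ₁ * b - ρ₂ * a = k * r₂ + (-m) * ρ₂ := by
    rw [hm, hk]; simp only [connForm]; linear_combination (-(ρ₁ * b - ρ₂ * a)) * hdet
  rw [ra1, ra2, hermForm_lin_left, hrr, hρr] at e11
  rw [ra1, ra2, rb1, rb2, hermForm_lin_left, hermForm_lin_left, hrr, hρρ, hrρ, hρr] at e12 e21
  rw [rb1, rb2, hermForm_lin_left, hρρ, hrρ] at e22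
  rw [e11, e12, e21, e22, hdet] at hd
  refine ⟨hkl, ?_⟩
  have hσ' : (σ : ℂ) ^ 2 = 1 := by exact_mod_cast hσ
  have hmm : ‖m‖ ^ 2 = ‖k‖ * ‖l‖ := by rw [← norm_pow, hkl, norm_mul]
  have hmm' : m * conj m = (‖k‖ : ℂ) * ‖l‖ := by
    rw [← ofReal_norm_sq]; exact_mod_cast hmm
  have hkl' := congrArg conj hkl
  have : ((mink (dX F z) (dX F z) : ℝ) : ℂ) = (((‖k‖ - ‖l‖) ^ 2 : ℝ) : ℂ) := by
    simp only [map_add, map_mul, map_neg, map_zero, map_one, Complex.conj_ofReal, map_pow] at hd hkl'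
    push_cast
    linear_combination hd - ofReal_norm_sq k - ofReal_norm_sq l - 2 * hmm' - hkl - hkl'
      - (m ^ 2 + conj m ^ 2 + 2 * m * conj m - l * k - l * conj l - k * conj k
        - conj k * conj l) * hσ'
  exact_mod_cast this

end Pointwise

section Initial

variable {s : ℝ} {F : ℂ → Mink4} {Ω : Set ℂ} {z : ℂ}

/-- At a spacelike point there is a frame in which the connection matrix is lower triangular. -/
lemma exists_initial_frame (hc : IsCMC1Coord s F Ω) (hz : z ∈ Ω)
    (hpos : 0 < mink (dX F z) (dX F z)) :
    ∃ (r₁ r₂ ρ₁ ρ₂ : ℂ) (σ : ℝ), σ ^ 2 = 1 ∧ r₁ * ρ₂ - r₂ * ρ₁ = 1 ∧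
      hermForm s (F z) r₁ r₂ r₁ r₂ = σ ∧ hermForm s (F z) ρ₁ ρ₂ ρ₁ ρ₂ = -σ ∧
      hermForm s (F z) r₁ r₂ ρ₁ ρ₂ = 0 ∧
      r₁ * cA s F z + r₂ * cC s F z = 0 ∧ r₁ * cB s F z - r₂ * cA s F z = 0 := by
  have hsq := hc.conn_sq hz
  -- an isotropic left null vector of the connection matrix is impossible
  obtain ⟨n₁, n₂, hn1, hn2, hN⟩ : ∃ n₁ n₂ : ℂ, n₁ * cA s F z + n₂ * cC s F z = 0 ∧
      n₁ * cB s F z - n₂ * cA s F z = 0 ∧ hermForm s (F z) n₁ n₂ n₁ n₂ ≠ 0 := by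
    -- The determinant of the Hermitian matrix of `F_x`, written through `𝒜`, is `-⟨F_x, F_x⟩`. It
    -- would vanish if the null row were isotropic.
    have hdet := hermForm_det hc.s_sq (dX F z) 1 0 0 1
    rw [hermForm_dX hc hz, hermForm_dX hc hz, hermForm_dX hc hz, hermForm_dX hc hz] at hdet
    have hE : ((mink (dX F z) (dX F z) : ℝ) : ℂ) ≠ 0 := by exact_mod_cast hpos.ne'
    by_cases hC : cC s F z = 0
    · have hA : cA s F z = 0 := by rw [hC] at hsq; simpa using hsq
      refine ⟨0, 1, by simp [hC], by simp [hA], fun h0 => hE ?_⟩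
      rw [hA, hC] at hdet
      simp [hermForm] at hdet h0
      rw [h0] at hdet
      have h5 : (0 : ℂ) = (mink (dX F z) (dX F z) : ℝ) := by simpa using hdet
      exact h5.symm
    · refine ⟨cC s F z, -cA s F z, by ring, by linear_combination hsq, fun h0 => hE ?_⟩
      have hsq' := congrArg conj hsq
      have h0' := congrArg conj h0
      have hC' : conj (cC s F z) ≠ 0 := by simpa using hC
      refine mul_left_cancel₀ (mul_ne_zero hC hC') ?_
      rw [mul_zero]
      simp [hermForm] at hdet h0 h0' hsq'
      generalize conj (cA s F z) = a' at *
      generalize conj (cB s F z) = b' at *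
      generalize conj (cC s F z) = c' at *
      generalize cA s F z = a at *
      generalize cB s F z = b at *
      generalize cC s F z = c at *
      generalize Complex.I * (s : ℂ) = t at *
      generalize (F z 0 : ℂ) = x₀ at *
      generalize (F z 1 : ℂ) = x₁ at *
      generalize (F z 2 : ℂ) = x₂ at *
      generalize (F z 3 : ℂ) = x₃ at *
      linear_combination c * c' * hdet
        - (c' * (x₁ - t * x₂) * (c * (x₁ + t * x₂) - a * (x₀ - x₃)
            + (c' * (x₁ - t * x₂) - a' * (x₀ - x₃)))
          - (x₀ - x₃) * c' * (c * (x₀ + x₃) - a * (x₁ - t * x₂)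
            + (a' * (x₁ - t * x₂) + b' * (x₀ - x₃)))) * hsq
        - (c * (x₁ + t * x₂) * (c * (x₁ + t * x₂) - a * (x₀ - x₃)
            + (c' * (x₁ - t * x₂) - a' * (x₀ - x₃)))
          - (x₀ - x₃) * (a * (c * (x₁ + t * x₂) - a * (x₀ - x₃))
            + c * (c' * (x₀ + x₃) - a' * (x₁ + t * x₂)))) * hsq'
        + (c * (c' * (x₀ + x₃) - a' * (x₁ + t * x₂))
          - a * (c' * (x₁ - t * x₂) - a' * (x₀ - x₃))) * h0
  have hNim := hermForm_self_im s (F z) n₁ n₂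
  set N : ℝ := (hermForm s (F z) n₁ n₂ n₁ n₂).re with hNdef
  have hNeq : hermForm s (F z) n₁ n₂ n₁ n₂ = N := by
    apply Complex.ext <;> simp [hNim, hNdef]
  have hN0 : N ≠ 0 := fun h => hN (by rw [hNeq, h]; simp)
  -- Rescaling makes the Hermitian form on the null row equal to `σ = ±1`.
  set q : ℝ := (Real.sqrt |N|)⁻¹ with hq
  have hq2 : q ^ 2 * |N| = 1 := by
    rw [hq, inv_pow, Real.sq_sqrt (abs_nonneg N), inv_mul_cancel₀ (abs_ne_zero.mpr hN0)]
  set σ : ℝ := q ^ 2 * N with hσ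
  have hσ2 : σ ^ 2 = 1 := by
    rw [hσ, mul_pow, ← sq_abs N, ← mul_pow, hq2, one_pow]
  set r₁ : ℂ := q * n₁ with hr1
  set r₂ : ℂ := q * n₂ with hr2
  have hrr : hermForm s (F z) r₁ r₂ r₁ r₂ = σ := by
    have : hermForm s (F z) r₁ r₂ r₁ r₂ = (q : ℂ) ^ 2 * hermForm s (F z) n₁ n₂ n₁ n₂ := by
      simp only [hr1, hr2, hermForm, map_mul, Complex.conj_ofReal]; ring
    rw [this, hNeq, hσ]; push_cast; ring
  have hσc : (σ : ℂ) ^ 2 = 1 := by exact_mod_cast hσ2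
  have hu := hc.unit z hz
  have huc : -((F z 0 : ℂ) * F z 0) + F z 1 * F z 1 + F z 2 * F z 2 + F z 3 * F z 3 = 1 := by
    rw [mink] at hu; exact_mod_cast hu
  have hI : (Complex.I * s) ^ 2 = -1 := by
    rw [mul_pow, Complex.I_sq]; norm_cast; rw [hc.s_sq]; simp
  -- The second row spans the orthogonal complement of the first for the Hermitian form; its factor
  -- `σ` makes the determinant `σ² = 1`. Since `det X = -1`, the form takes the value `-σ` on it.
  refine ⟨r₁, r₂,
    -σ * ((F z 1 - Complex.I * s * F z 2) * conj r₁ + (F z 0 - F z 3) * conj r₂),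
    σ * ((F z 0 + F z 3) * conj r₁ + (F z 1 + Complex.I * s * F z 2) * conj r₂),
    σ, hσ2, ?_, hrr, ?_, ?_, ?_, ?_⟩
  · have : r₁ * (σ * ((F z 0 + F z 3) * conj r₁ + (F z 1 + Complex.I * s * F z 2) * conj r₂))
      - r₂ * (-σ * ((F z 1 - Complex.I * s * F z 2) * conj r₁ + (F z 0 - F z 3) * conj r₂)) =
      σ * hermForm s (F z) r₁ r₂ r₁ r₂ := by simp only [hermForm]; ring
    rw [this, hrr, ← hσc]; ring
  · have hrr' := hrr
    simp only [hermForm, map_mul, map_add, map_sub, map_neg, Complex.conj_I, Complex.conj_ofReal,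
      Complex.conj_conj, neg_mul] at hrr ⊢
    generalize Complex.I * (s : ℂ) = t at *
    linear_combination (σ : ℂ) ^ 2 * ((F z 0 : ℂ) ^ 2 - (F z 3 : ℂ) ^ 2 - (F z 1 : ℂ) ^ 2
      + t ^ 2 * (F z 2 : ℂ) ^ 2) * hrr + (σ : ℂ) ^ 3 * (-huc + (F z 2 : ℂ) ^ 2 * hI) - σ * hσc
  · simp only [hermForm, map_mul, map_add, map_sub, map_neg, Complex.conj_I, Complex.conj_ofReal,
      Complex.conj_conj] at hrr ⊢
    ring
  · rw [hr1, hr2]; linear_combination (q : ℂ) * hn1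
  · rw [hr1, hr2]; linear_combination (q : ℂ) * hn2

end Initial

namespace IsCMC1Coord

variable {s : ℝ} {F : ℂ → Mink4} {Ω : Set ℂ} {z : ℂ}

lemma deriv_conn_sq (hc : IsCMC1Coord s F Ω) (hz : z ∈ Ω) :
    2 * cA s F z * deriv (cA s F) z + (deriv (cB s F) z * cC s F z
      + cB s F z * deriv (cC s F) z) = 0 := by
  have mem := hc.isOpen.mem_nhds hz
  have dA := (hc.holA.differentiableAt mem).hasDerivAt
  have dB := (hc.holB.differentiableAt mem).hasDerivAt
  have dC := (hc.holC.differentiableAt mem).hasDerivAt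
  have h2 := ((dA.fun_pow 2).fun_add (dB.fun_mul dC)).deriv
  have h3 : deriv (fun ζ => cA s F ζ ^ 2 + cB s F ζ * cC s F ζ) z = 0 := by
    rw [Filter.EventuallyEq.deriv_eq (f := fun _ => (0 : ℂ))
      (Filter.eventually_of_mem mem fun ζ hζ => hc.conn_sq hζ)]
    simp
  rw [h3] at h2
  simp at h2
  linear_combination -h2

/-- The diagonal entries of `A A' = q A`. -/
lemma hopfCoeff_mul_cA (hc : IsCMC1Coord s F Ω) (hz : z ∈ Ω) :
    hopfCoeff s F z * cA s F z = cA s F z * deriv (cA s F) z + cB s F z * deriv (cC s F) z := by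
  have h0 := hc.conn_sq hz
  have h1 := hc.deriv_conn_sq hz
  obtain ⟨h2, h3⟩ := hc.hopfCoeff_spec hz
  rcases hc.conn_ne_zero hz with h | h
  · refine mul_left_cancel₀ h ?_
    linear_combination cA s F z * h3 + deriv (cB s F) z * h0 - cB s F z * h1
  · refine mul_left_cancel₀ h ?_
    linear_combination cA s F z * h2 - deriv (cC s F) z * h0

end IsCMC1Coord

section ConnForm

variable {s : ℝ} {F : ℂ → Mink4} {Ω : Set ℂ} {z : ℂ} {r₁ r₂ ρ₁ ρ₂ : ℂ → ℂ}

/-- Only the matrix gets differentiated: the contributions of the two dual solutions cancel because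
the matrix is traceless. -/
lemma hasDerivAt_connForm (hc : IsCMC1Coord s F Ω) (hz : z ∈ Ω) (hr : IsDualSol s F Ω r₁ r₂)
    (hρ : IsDualSol s F Ω ρ₁ ρ₂) :
    HasDerivAt (fun z => connForm (cA s F z) (cB s F z) (cC s F z) (r₁ z) (r₂ z) (ρ₁ z) (ρ₂ z))
      (connForm (deriv (cA s F) z) (deriv (cB s F) z) (deriv (cC s F) z)
        (r₁ z) (r₂ z) (ρ₁ z) (ρ₂ z)) z := by
  have mem := hc.isOpen.mem_nhds hz
  have dA := (hc.holA.differentiableAt mem).hasDerivAt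
  have dB := (hc.holB.differentiableAt mem).hasDerivAt
  have dC := (hc.holC.differentiableAt mem).hasDerivAt
  obtain ⟨d1, d2⟩ := hr z hz
  obtain ⟨d3, d4⟩ := hρ z hz
  have h := ((((d1.fun_mul dA).fun_add (d2.fun_mul dC)).fun_mul d4).fun_sub
    (((d1.fun_mul dB).fun_sub (d2.fun_mul dA)).fun_mul d3))
  refine h.congr_deriv ?_
  simp only [connForm]
  ring

end ConnForm

/-- The normal form of a spacelike CMC-1 immersion of the unit disc: the first fundamental form is
`(|k| (1 - |g|²))² |dz|²` with `g 0 = 0`, and the Hopf differential is `k g' dz²`. -/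
theorem exists_disc_normal_form {s : ℝ} {F : ℂ → Mink4} (hc : IsCMC1Coord s F (Metric.ball 0 1))
    (hpos : ∀ z ∈ Metric.ball (0 : ℂ) 1, 0 < mink (dX F z) (dX F z)) :
    ∃ k g : ℂ → ℂ, DifferentiableOn ℂ k (Metric.ball 0 1) ∧
      DifferentiableOn ℂ g (Metric.ball 0 1) ∧ g 0 = 0 ∧ ∀ z ∈ Metric.ball (0 : ℂ) 1,
        k z ≠ 0 ∧ ‖g z‖ < 1 ∧ Real.sqrt (mink (dX F z) (dX F z)) = ‖k z‖ * (1 - ‖g z‖ ^ 2) ∧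
        hopfCoeff s F z = k z * deriv g z := by
  have h0 : (0 : ℂ) ∈ Metric.ball (0 : ℂ) 1 := Metric.mem_ball_self one_pos
  obtain ⟨a, b, c, d, σ, hσ, hdet, h11, h22, h12, hn1, hn2⟩ :=
    exists_initial_frame hc h0 (hpos 0 h0)
  obtain ⟨r₁, r₂, hr1, hr2, hr⟩ := exists_isDualSol hc a b
  obtain ⟨ρ₁, ρ₂, hρ1, hρ2, hρ⟩ := exists_isDualSol hc c d
  have Hdet := det_isDualSol hr hρ
  have H11 := hermForm_isDualSol hc hr hr
  have H22 := hermForm_isDualSol hc hρ hρ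
  have H12 := hermForm_isDualSol hc hr hρ
  rw [hr1, hr2, hρ1, hρ2] at Hdet H12
  rw [hr1, hr2] at H11
  rw [hρ1, hρ2] at H22
  set k : ℂ → ℂ := fun z => connForm (cA s F z) (cB s F z) (cC s F z) (ρ₁ z) (ρ₂ z) (ρ₁ z) (ρ₂ z)
    with hk
  set m : ℂ → ℂ := fun z => connForm (cA s F z) (cB s F z) (cC s F z) (r₁ z) (r₂ z) (ρ₁ z) (ρ₂ z)
    with hm
  set l : ℂ → ℂ := fun z => connForm (cA s F z) (cB s F z) (cC s F z) (r₁ z) (r₂ z) (r₁ z) (r₂ z)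
    with hl
  have key := fun z (hz : z ∈ Metric.ball (0 : ℂ) 1) => mink_dX_eq hc hz hσ
    ((Hdet z hz).trans hdet) ((H11 z hz).trans h11) ((H22 z hz).trans h22) ((H12 z hz).trans h12)
  have hkd := fun z (hz : z ∈ Metric.ball (0 : ℂ) 1) => hasDerivAt_connForm hc hz hρ hρ
  have hmd := fun z (hz : z ∈ Metric.ball (0 : ℂ) 1) => hasDerivAt_connForm hc hz hr hρ
  have hld := fun z (hz : z ∈ Metric.ball (0 : ℂ) 1) => hasDerivAt_connForm hc hz hr hr
  have kdiff : DifferentiableOn ℂ k (Metric.ball 0 1) := fun z hz =>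
    (hkd z hz).differentiableAt.differentiableWithinAt
  have mdiff : DifferentiableOn ℂ m (Metric.ball 0 1) := fun z hz =>
    (hmd z hz).differentiableAt.differentiableWithinAt
  have ldiff : DifferentiableOn ℂ l (Metric.ball 0 1) := fun z hz =>
    (hld z hz).differentiableAt.differentiableWithinAt
  -- The initial row `r` is a left null vector of `𝒜` at `0`; this is what makes `g 0 = 0`.
  have hm0 : m 0 = 0 := by
    simp only [hm, connForm, hr1, hr2, hn1, hn2]; ring
  have hl0 : l 0 = 0 := by
    simp only [hl, connForm, hr1, hr2, hn1, hn2]; ring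
  -- `|k| - |l|` never vanishes because `ds² = (|k| - |l|)² |dz|²` is nondegenerate, and it is
  -- nonnegative at `0`; connectedness of the disc fixes its sign.
  have hlt : ∀ z ∈ Metric.ball (0 : ℂ) 1, ‖l z‖ < ‖k z‖ := by
    have hne : ∀ z ∈ Metric.ball (0 : ℂ) 1, ‖k z‖ - ‖l z‖ ≠ 0 := by
      intro z hz h
      have h1 := (key z hz).2
      have h2 := hpos z hz
      rw [h1] at h2
      change 0 < (‖k z‖ - ‖l z‖) ^ 2 at h2
      rw [h] at h2
      simp at h2
    have hcont : ContinuousOn (fun z => ‖k z‖ - ‖l z‖) (Metric.ball 0 1) :=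
      kdiff.continuousOn.norm.sub ldiff.continuousOn.norm
    have hpre := (convex_ball (0 : ℂ) 1).isPreconnected
    intro z hz
    by_contra! hle
    have h1 : ‖k z‖ - ‖l z‖ ≤ 0 := by linarith
    have h2 : 0 ≤ ‖k 0‖ - ‖l 0‖ := by rw [hl0]; simp
    obtain ⟨w, hw, hw0⟩ := hpre.intermediate_value hz h0 hcont ⟨h1, h2⟩
    exact hne w hw hw0
  have hk0 : ∀ z ∈ Metric.ball (0 : ℂ) 1, k z ≠ 0 := fun z hz =>
    norm_pos_iff.mp ((norm_nonneg _).trans_lt (hlt z hz))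
  refine ⟨k, fun z => m z / k z, kdiff, mdiff.fun_div kdiff hk0, by simp [hm0], fun z hz => ?_⟩
  have hkz := norm_pos_iff.mpr (hk0 z hz)
  have hml : ‖m z‖ ^ 2 = ‖k z‖ * ‖l z‖ := by
    rw [← norm_pow, ← norm_mul]; exact congrArg norm (key z hz).1
  have hg : ‖m z / k z‖ ^ 2 = ‖l z‖ / ‖k z‖ := by
    rw [norm_div, div_pow, hml]; field_simp
  refine ⟨hk0 z hz, ?_, ?_, ?_⟩
  · rw [← sq_lt_one_iff₀ (norm_nonneg _), hg, div_lt_one hkz]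
    exact hlt z hz
  · rw [hg, (key z hz).2]
    change Real.sqrt ((‖k z‖ - ‖l z‖) ^ 2) = _
    rw [Real.sqrt_sq (sub_nonneg.mpr (hlt z hz).le)]
    field_simp
  · have hd := ((hmd z hz).fun_div (hkd z hz) (hk0 z hz)).deriv
    have hd' : deriv (fun z => m z / k z) z = _ := hd
    rw [hd']
    change _ = k z * (_ / k z ^ 2)
    rw [mul_div_assoc', eq_div_iff (pow_ne_zero 2 (hk0 z hz))]
    obtain ⟨q1, q2⟩ := hc.hopfCoeff_spec hz
    have q3 := hc.hopfCoeff_mul_cA hz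
    have q4 := hc.deriv_conn_sq hz
    have hD := (Hdet z hz).trans hdet
    -- The relation `𝒜 𝒜' = q 𝒜` read in the frame: the Wronskian of `m` and `k` is `q k`, so `g = m
    -- / k` satisfies `k g' = q`.
    have hW : connForm (deriv (cA s F) z) (deriv (cB s F) z) (deriv (cC s F) z)
          (r₁ z) (r₂ z) (ρ₁ z) (ρ₂ z) * k z - m z * connForm (deriv (cA s F) z)
          (deriv (cB s F) z) (deriv (cC s F) z) (ρ₁ z) (ρ₂ z) (ρ₁ z) (ρ₂ z)
        = hopfCoeff s F z * k z := by
      simp only [hk, hm, connForm]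
      linear_combination -(r₁ z * ρ₂ z - r₂ z * ρ₁ z) * ρ₂ z ^ 2 * q1
        + (r₁ z * ρ₂ z - r₂ z * ρ₁ z) * ρ₁ z ^ 2 * q2
        + (r₁ z * ρ₂ z - r₂ z * ρ₁ z) * ρ₁ z * ρ₂ z * (-2 * q3 - q4)
        + hopfCoeff s F z * (2 * cA s F z * ρ₁ z * ρ₂ z + cC s F z * ρ₂ z ^ 2
          - cB s F z * ρ₁ z ^ 2) * hD
    linear_combination -k z * hW

/-! ### Lifting rays through a local homeomorphism -/

section PathLift

variable {E X : Type*} [TopologicalSpace E]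

/-- `γ` lifts the curve `c` through `p` on `[0, τ)` or `[0, τ]`, starting at `e₀`. -/
structure IsLiftOn (p : E → X) (c : ℝ → X) (e₀ : E) (S : Set ℝ) (γ : ℝ → E) : Prop where
  cont : ContinuousOn γ S
  lift : ∀ s ∈ S, p (γ s) = c s
  init : γ 0 = e₀

lemma IsLiftOn.mono {p : E → X} {c : ℝ → X} {e₀ : E} {S S' : Set ℝ} {γ : ℝ → E}
    (h : IsLiftOn p c e₀ S γ) (hS : S' ⊆ S) : IsLiftOn p c e₀ S' γ :=
  ⟨h.cont.mono hS, fun s hs => h.lift s (hS hs), h.init⟩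

variable [TopologicalSpace X]

lemma IsLiftOn.eqOn [T2Space E] {p : E → X} (hp : IsLocalHomeomorph p) {c : ℝ → X} {e₀ : E}
    {S : Set ℝ} {γ γ' : ℝ → E} (h : IsLiftOn p c e₀ S γ) (h' : IsLiftOn p c e₀ S γ')
    (hS : IsPreconnected S) (h0 : 0 ∈ S) : EqOn γ γ' S :=
  (T2Space.isSeparatedMap p).eqOn_of_comp_eqOn hp.isLocallyInjective hS h.cont h'.cont
    (fun s hs => (h.lift s hs).trans (h'.lift s hs).symm) h0 (h.init.trans h'.init.symm)

lemma IsLiftOn.extend [T2Space X] {p : E → X} (hp : IsLocalHomeomorph p) {c : ℝ → X}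
    (hc : Continuous c) {e₀ y : E} {τ : ℝ} (hτ : 0 < τ) {γ : ℝ → E}
    (h : IsLiftOn p c e₀ (Ico 0 τ) γ) (hy : Tendsto γ (𝓝[<] τ) (𝓝 y)) :
    IsLiftOn p c e₀ (Icc 0 τ) (Function.update γ τ y) := by
  have hcont : ContinuousOn (Function.update γ τ y) (Icc 0 τ) := by
    rw [continuousOn_update_iff]
    have hset : Icc 0 τ \ {τ} = Ico 0 τ := by ext s; simp [lt_iff_le_and_ne]
    rw [hset]
    exact ⟨h.cont, fun _ => hy.mono_left (nhdsWithin_mono _ fun s hs => hs.2)⟩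
  refine ⟨hcont, fun s hs => ?_, ?_⟩
  · rcases hs.2.eq_or_lt with rfl | hlt
    · rw [Function.update_self]
      refine tendsto_nhds_unique ((hp.continuous.tendsto y).comp hy) ?_
      refine ((hc.tendsto s).mono_left nhdsWithin_le_nhds).congr' ?_
      filter_upwards [Ioo_mem_nhdsLT hτ] with r hr
      exact (h.lift r ⟨hr.1.le, hr.2⟩).symm
    · rw [Function.update_of_ne hlt.ne]
      exact h.lift s ⟨hs.1, hlt⟩
  · rw [Function.update_of_ne hτ.ne]
    exact h.init

lemma IsLiftOn.exists_gt {p : E → X} (hp : IsLocalHomeomorph p) {c : ℝ → X}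
    (hc : Continuous c) {e₀ : E} {τ : ℝ} (hτ : 0 ≤ τ) {γ : ℝ → E}
    (h : IsLiftOn p c e₀ (Icc 0 τ) γ) :
    ∃ δ > 0, ∃ γ', IsLiftOn p c e₀ (Icc 0 (τ + δ)) γ' := by
  classical
  obtain ⟨e, he, hpe⟩ := hp (γ τ)
  have hτ' : τ ∈ Icc 0 τ := ⟨hτ, le_rfl⟩
  have hcτ : c τ ∈ e.target := by
    rw [← h.lift τ hτ', hpe]; exact e.map_source he
  obtain ⟨δ, hδ, hball⟩ := Metric.mem_nhds_iff.mp
    (hc.continuousAt.preimage_mem_nhds (e.open_target.mem_nhds hcτ))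
  have hmem : ∀ s ∈ Icc τ (τ + δ / 2), c s ∈ e.target := fun s hs => hball (by
    rw [Metric.mem_ball, Real.dist_eq, abs_of_nonneg (by linarith [hs.1])]; linarith [hs.2])
  refine ⟨δ / 2, half_pos hδ, fun s => if s ≤ τ then γ s else e.symm (c s), ?_, ?_, ?_⟩
  · have hu : Icc 0 (τ + δ / 2) = Icc 0 τ ∪ Icc τ (τ + δ / 2) :=
      (Icc_union_Icc_eq_Icc hτ (by linarith)).symm
    rw [hu]
    refine ContinuousOn.union_of_isClosed ?_ ?_ isClosed_Icc isClosed_Icc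
    · exact h.cont.congr fun s hs => if_pos hs.2
    · refine (e.continuousOn_symm.comp hc.continuousOn hmem).congr fun s hs => ?_
      by_cases hs' : s ≤ τ
      · have : s = τ := le_antisymm hs' hs.1
        subst this
        simp only [le_refl, if_true, Function.comp]
        rw [← h.lift s hτ', hpe, e.left_inv he]
      · simp [hs']
  · intro s hs
    by_cases hs' : s ≤ τ
    · simp only [hs', if_true]; exact h.lift s ⟨hs.1, hs'⟩
    · simp only [hs', if_false]
      rw [hpe, e.right_inv (hmem s ⟨by linarith, hs.2⟩)]
  · simp only [hτ, if_true]; exact h.init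

/-- A curve lifts through a local homeomorphism if its partial lifts converge. -/
lemma exists_isLiftOn [T2Space E] [T2Space X] {p : E → X} (hp : IsLocalHomeomorph p) {c : ℝ → X}
    (hc : Continuous c) {e₀ : E} (h0 : p e₀ = c 0)
    (hlim : ∀ τ ∈ Ioc (0 : ℝ) 1, ∀ γ, IsLiftOn p c e₀ (Ico 0 τ) γ →
      ∃ y, Tendsto γ (𝓝[<] τ) (𝓝 y)) :
    ∃ γ, IsLiftOn p c e₀ (Icc 0 1) γ := by
  let S : Set ℝ := {τ | ∃ γ, IsLiftOn p c e₀ (Icc 0 τ) γ}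
  have hdown : ∀ τ ∈ S, ∀ τ' ≤ τ, τ' ∈ S := fun τ ⟨γ, hγ⟩ τ' hle =>
    ⟨γ, hγ.mono (Icc_subset_Icc_right hle)⟩
  have hzero : (0 : ℝ) ∈ S := ⟨fun _ => e₀, continuousOn_const, fun s hs => by
    obtain rfl : s = 0 := le_antisymm hs.2 hs.1
    exact h0, rfl⟩
  suffices h : Icc (0 : ℝ) 1 ⊆ S from h ⟨zero_le_one, le_rfl⟩
  refine IsClosed.Icc_subset_of_forall_exists_gt ?_ hzero ?_
  · refine isClosed_of_closure_subset fun τ hτ => ?_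
    have hτ1 : τ ∈ Icc (0 : ℝ) 1 := closure_minimal inter_subset_right isClosed_Icc hτ
    refine ⟨?_, hτ1⟩
    by_contra hnot
    have hpos : 0 < τ := hτ1.1.lt_of_ne fun h => hnot (h ▸ hzero)
    have hlt : ∀ s < τ, s ∈ S := by
      intro s hs
      obtain ⟨r, hr, hrS⟩ := mem_closure_iff.mp hτ (Ioi s) isOpen_Ioi hs
      exact hdown r hrS.1 s (le_of_lt hr)
    have : Nonempty E := ⟨e₀⟩
    choose! γ hγ using hlt
    -- By uniqueness the lifts on the intervals `[0, s]` are compatible, so the diagonal `s ↦ γ s s`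
    -- is a lift on `[0, τ)`, to which the hypothesis on limits applies.
    have hagree : ∀ r s, 0 ≤ s → s ≤ r → r < τ → γ r s = γ s s := fun r s h1 h2 h3 =>
      ((hγ r h3).mono (Icc_subset_Icc_right h2)).eqOn hp (hγ s (h2.trans_lt h3))
        isPreconnected_Icc ⟨le_rfl, h1⟩ ⟨h1, le_rfl⟩
    have hΓ : IsLiftOn p c e₀ (Ico 0 τ) (fun s => γ s s) := by
      refine ⟨fun s hs => ?_, fun s hs => (hγ s hs.2).lift s ⟨hs.1, le_rfl⟩, (hγ 0 hpos).init⟩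
      obtain ⟨r, hr1, hr2⟩ := exists_between hs.2
      have h1 : ContinuousWithinAt (γ r) (Icc 0 r) s := (hγ r hr2).cont s ⟨hs.1, hr1.le⟩
      have h2 : ContinuousWithinAt (fun s => γ s s) (Icc 0 r) s :=
        h1.congr (fun q hq => (hagree r q hq.1 hq.2 hr2).symm) (hagree r s hs.1 hr1.le hr2).symm
      refine h2.mono_of_mem_nhdsWithin ?_
      filter_upwards [self_mem_nhdsWithin, mem_nhdsWithin_of_mem_nhds (Iio_mem_nhds hr1)]
        with q hq hq'
      exact ⟨hq.1, le_of_lt hq'⟩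
    obtain ⟨y, hy⟩ := hlim τ ⟨hpos, hτ1.2⟩ _ hΓ
    exact hnot ⟨_, hΓ.extend hp hc hpos hy⟩
  · rintro τ ⟨⟨γ, hγ⟩, hτ⟩ y hy
    obtain ⟨δ, hδ, hγ'⟩ := hγ.exists_gt hp hc hτ.1
    refine ⟨min (τ + δ) y, hdown _ hγ' _ (min_le_left _ _), lt_min (by linarith) hy,
      min_le_right _ _⟩

end PathLift

/-- If all the rays of length less than `R` lift through the primitive `w` of the nonvanishing
function `k` on the unit disc, then `|k 0| ≥ R`. -/
theorem le_norm_of_forall_tendsto {k w : ℂ → ℂ} {R : ℝ} (hR : 0 < R)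
    (hw : ∀ z ∈ Metric.ball (0 : ℂ) 1, HasDerivAt w (k z) z)
    (hk : ∀ z ∈ Metric.ball (0 : ℂ) 1, k z ≠ 0) (hw0 : w 0 = 0)
    (hlim : ∀ a : ℂ, ‖a‖ < R → ∀ τ ∈ Ioc (0 : ℝ) 1, ∀ γ : ℝ → ℂ, γ 0 = 0 →
      (∀ s ∈ Ico 0 τ, γ s ∈ Metric.ball (0 : ℂ) 1 ∧
        HasDerivWithinAt γ (a / k (γ s)) (Ico 0 τ) s) →
      ∃ y ∈ Metric.ball (0 : ℂ) 1, Tendsto γ (𝓝[<] τ) (𝓝 y)) :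
    R ≤ ‖k 0‖ := by
  set D := Metric.ball (0 : ℂ) 1 with hD
  have hDo : IsOpen D := Metric.isOpen_ball
  have h0 : (0 : ℂ) ∈ D := Metric.mem_ball_self one_pos
  have wdiff : DifferentiableOn ℂ w D := fun z hz =>
    (hw z hz).differentiableAt.differentiableWithinAt
  have hloc : IsLocalHomeomorphOn w D := by
    refine IsLocalHomeomorphOn.mk _ _ fun z hz => ?_
    have hs : HasStrictDerivAt w (k z) z := by
      have h1 := (wdiff.analyticAt (hDo.mem_nhds hz)).hasStrictDerivAt
      rwa [(hw z hz).deriv] at h1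
    have hs' := hs.hasStrictFDerivAt_equiv (hk z hz)
    exact ⟨hs'.toOpenPartialHomeomorph w, hs'.mem_toOpenPartialHomeomorph_source, fun _ _ => rfl⟩
  let p : D → ℂ := fun x => w x
  have hp : IsLocalHomeomorph p := by
    rw [isLocalHomeomorph_iff_isLocalHomeomorphOn_univ]
    exact hloc.comp (hDo.isOpenEmbedding_subtypeVal.isLocalHomeomorph.isLocalHomeomorphOn)
      fun x _ => x.2
  -- Local inverses of `w` have derivative `1 / k`, so the lift of the ray `s ↦ s a` solves `γ' = a
  -- / k(γ)`.
  have hinv : ∀ x : D, ∃ e : OpenPartialHomeomorph D ℂ, x ∈ e.source ∧ p = e ∧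
      ∀ a ∈ e.target, HasDerivAt (fun b => ((e.symm b : D) : ℂ)) (k (e.symm a))⁻¹ a := by
    intro x
    obtain ⟨e, he, hpe⟩ := hp x
    refine ⟨e, he, hpe, fun a ha => ?_⟩
    refine (hw _ (e.symm a).2).of_local_left_inverse
      (continuousAt_subtype_val.comp (e.symm.continuousAt ha)) (hk _ (e.symm a).2) ?_
    filter_upwards [e.open_target.mem_nhds ha] with b hb
    change p (e.symm b) = b
    rw [hpe, e.right_inv hb]
  let e₀ : D := ⟨0, h0⟩
  have hray : ∀ a : ℂ, ‖a‖ < R →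
      ∃ γ, IsLiftOn p (fun s : ℝ => (s : ℂ) * a) e₀ (Icc 0 1) γ := by
    intro a ha
    refine exists_isLiftOn hp (by fun_prop) (by simp [p, e₀, hw0]) fun τ hτ γ hγ => ?_
    have hder : ∀ s ∈ Ico 0 τ,
        HasDerivWithinAt (fun s => (γ s : ℂ)) (a / k (γ s)) (Ico 0 τ) s := by
      intro s hs
      obtain ⟨e, he, hpe, hder⟩ := hinv (γ s)
      have hps : (s : ℂ) * a = e (γ s) := by rw [← hpe]; exact (hγ.lift s hs).symm
      have h1 := hder (s * a) (hps ▸ e.map_source he)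
      rw [hps, e.left_inv he, ← hps] at h1
      have h2 : HasDerivAt (fun r : ℝ => (r : ℂ) * a) a s := by
        simpa using (Complex.ofRealCLM.hasDerivAt (x := s)).mul_const a
      have h3 := (h1.comp_of_eq s h2 rfl).hasDerivWithinAt (s := Ico 0 τ)
      rw [div_eq_inv_mul]
      refine h3.congr_of_eventuallyEq ?_ ?_
      · filter_upwards [hγ.cont s hs (e.open_source.mem_nhds he), self_mem_nhdsWithin]
          with r hr hr'
        simp only [Function.comp]
        rw [← hγ.lift r hr', hpe, e.left_inv hr]
      · simp only [Function.comp]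
        rw [hps, e.left_inv he]
    obtain ⟨y, hy, hlim'⟩ := hlim a ha τ hτ (fun s => (γ s : ℂ)) (by simp [hγ.init, e₀])
      fun s hs => ⟨(γ s).2, hder s hs⟩
    exact ⟨⟨y, hy⟩, tendsto_subtype_rng.mpr hlim'⟩
  choose! γ hγ using hray
  let A := Metric.ball (0 : ℂ) R
  have mem : ∀ (t : unitInterval), (t : ℝ) ∈ Icc (0 : ℝ) 1 := fun t => t.2
  have hA : ∀ a : A, ‖(a : ℂ)‖ < R := fun a => mem_ball_zero_iff.mp a.2
  -- Lifts of a family of rays depend continuously on the parameter, so the endpoint map `φ` is a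
  -- continuous, hence holomorphic, branch of `w⁻¹` on the disc of radius `R`.
  have hcont : Continuous fun x : unitInterval × A => γ x.2 x.1 := by
    refine hp.continuous_lift (T2Space.isSeparatedMap p)
      ⟨fun x : unitInterval × A => ((x.1 : ℝ) : ℂ) * (x.2 : ℂ), by fun_prop⟩ ?_ ?_ ?_
    · funext x
      exact (hγ x.2 (hA _)).lift _ (mem x.1)
    · exact continuous_const.congr fun a => ((hγ a (hA _)).init).symm
    · intro a
      exact (hγ a (hA _)).cont.comp_continuous continuous_subtype_val mem
  let φ : ℂ → ℂ := fun a => γ a 1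
  have hφw : ∀ a ∈ A, w (φ a) = a := fun a ha => by
    simpa using (hγ a (mem_ball_zero_iff.mp ha)).lift 1 ⟨zero_le_one, le_rfl⟩
  have hφc : ContinuousOn φ A := by
    rw [continuousOn_iff_continuous_domRestrict]
    exact continuous_subtype_val.comp (hcont.comp (Continuous.prodMk_right (1 : unitInterval)))
  have hφd : ∀ a ∈ A, HasDerivAt φ (k (φ a))⁻¹ a := fun a ha =>
    (hw _ (γ a 1).2).of_local_left_inverse
      (hφc.continuousAt (Metric.isOpen_ball.mem_nhds ha)) (hk _ (γ a 1).2) (by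
        filter_upwards [Metric.isOpen_ball.mem_nhds ha] with b hb
        exact hφw b hb)
  have hA0 : (0 : ℂ) ∈ A := Metric.mem_ball_self hR
  have hφ0 : φ 0 = 0 := by
    have h1 := (hγ 0 (by simpa)).eqOn hp (γ' := fun _ => e₀)
      ⟨continuousOn_const, fun s _ => by simp [p, e₀, hw0], rfl⟩ isPreconnected_Icc
      ⟨le_rfl, zero_le_one⟩ (⟨zero_le_one, le_rfl⟩ : (1 : ℝ) ∈ Icc (0 : ℝ) 1)
    simp [φ, h1, e₀]
  -- Schwarz lemma for `φ`, from the disc of radius `R` to the unit disc, with `φ' 0 = 1 / k 0`.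
  have hs := Complex.norm_deriv_le_div_of_mapsTo_ball (f := φ) (c := 0) (R₁ := R) (R₂ := 1)
    (fun a ha => (hφd a ha).differentiableAt.differentiableWithinAt)
    (fun a _ => by rw [hφ0]; exact Metric.ball_subset_closedBall (γ a 1).2) hR
  rw [(hφd 0 hA0).deriv, hφ0, norm_inv, one_div] at hs
  exact (inv_le_inv₀ (norm_pos_iff.mpr (hk 0 h0)) hR).mp hs

/-! ### Universal coverings of punctured discs -/

/-- The Cayley transform from the unit disc to the right half-plane. -/
def cayley (x : ℂ) : ℂ := (1 + x) / (1 - x)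

lemma one_sub_ne_zero_of_mem_ball {x : ℂ} (hx : x ∈ Metric.ball (0 : ℂ) 1) : 1 - x ≠ 0 := by
  rintro h
  rw [mem_ball_zero_iff, ← sub_eq_zero.mp h] at hx
  simp at hx

lemma hasDerivAt_cayley {x : ℂ} (hx : x ∈ Metric.ball (0 : ℂ) 1) :
    HasDerivAt cayley (2 / (1 - x) ^ 2) x := by
  have hne := one_sub_ne_zero_of_mem_ball hx
  refine (((hasDerivAt_id x).const_add 1).fun_div ((hasDerivAt_id x).const_sub 1) hne).congr_deriv ?_
  simp only [id]
  congr 1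
  ring

lemma cayley_re {x : ℂ} (hx : x ∈ Metric.ball (0 : ℂ) 1) :
    (cayley x).re = (1 - ‖x‖ ^ 2) / ‖1 - x‖ ^ 2 := by
  have hne := one_sub_ne_zero_of_mem_ball hx
  rw [cayley, Complex.div_re, ← Complex.normSq_eq_norm_sq, ← Complex.normSq_eq_norm_sq, ← add_div]
  congr 1
  simp [Complex.normSq_apply]
  ring

lemma cayley_re_pos {x : ℂ} (hx : x ∈ Metric.ball (0 : ℂ) 1) : 0 < (cayley x).re := by
  rw [cayley_re hx]
  have h1 := norm_pos_iff.mpr (one_sub_ne_zero_of_mem_ball hx)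
  have h2 : ‖x‖ ^ 2 < 1 := (sq_lt_one_iff₀ (norm_nonneg x)).mpr (mem_ball_zero_iff.mp hx)
  have h3 : 0 < 1 - ‖x‖ ^ 2 := by linarith
  positivity

/-- The inverse of the Cayley transform. -/
lemma cayley_inv_mem_ball {u : ℂ} (hu : 0 < u.re) : (u - 1) / (u + 1) ∈ Metric.ball (0 : ℂ) 1 := by
  have hne : u + 1 ≠ 0 := fun h => by
    have := congrArg Complex.re h
    simp at this
    linarith
  rw [mem_ball_zero_iff, norm_div, div_lt_one (norm_pos_iff.mpr hne),
    ← sq_lt_sq₀ (norm_nonneg _) (norm_nonneg _), ← Complex.normSq_eq_norm_sq,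
    ← Complex.normSq_eq_norm_sq]
  simp [Complex.normSq_apply]
  nlinarith

lemma cayley_left_inv {x : ℂ} (hx : x ∈ Metric.ball (0 : ℂ) 1) :
    (cayley x - 1) / (cayley x + 1) = x := by
  have hne := one_sub_ne_zero_of_mem_ball hx
  rw [cayley]
  field_simp
  ring

/-- The universal covering of the disc of radius `r` punctured at `0` by the unit disc, which maps
`0` to `r exp (i θ - t)`. -/
def puncCover (r t θ : ℝ) (x : ℂ) : ℂ := r * Complex.exp (θ * Complex.I - t * cayley x)

section PuncCover

variable {r t θ : ℝ} {x : ℂ}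

lemma puncCover_ne_zero (hr : 0 < r) : puncCover r t θ x ≠ 0 :=
  mul_ne_zero (Complex.ofReal_ne_zero.mpr hr.ne') (Complex.exp_ne_zero _)

lemma norm_puncCover (hr : 0 < r) : ‖puncCover r t θ x‖ = r * Real.exp (-(t * (cayley x).re)) := by
  rw [puncCover, norm_mul, Complex.norm_real, Real.norm_of_nonneg hr.le, Complex.norm_exp]
  simp

lemma norm_puncCover_lt (hr : 0 < r) (ht : 0 < t) (hx : x ∈ Metric.ball (0 : ℂ) 1) :
    ‖puncCover r t θ x‖ < r := by
  rw [norm_puncCover hr]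
  refine mul_lt_of_lt_one_right hr (Real.exp_lt_one_iff.mpr ?_)
  have := mul_pos ht (cayley_re_pos hx)
  linarith

lemma hasDerivAt_puncCover (hx : x ∈ Metric.ball (0 : ℂ) 1) :
    HasDerivAt (puncCover r t θ) (-(puncCover r t θ x * (t * (2 / (1 - x) ^ 2)))) x := by
  have h := (((hasDerivAt_cayley hx).const_mul (t : ℂ)).const_sub (θ * Complex.I)).cexp.const_mul
    (r : ℂ)
  refine h.congr_deriv ?_
  rw [puncCover]
  ring

lemma puncCover_zero : puncCover r t θ 0 = r * Complex.exp (θ * Complex.I - t) := by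
  simp [puncCover, cayley]

lemma norm_deriv_puncCover (ht : 0 < t) (hx : x ∈ Metric.ball (0 : ℂ) 1) :
    ‖deriv (puncCover r t θ) x‖ = ‖puncCover r t θ x‖ * (2 * t / ‖1 - x‖ ^ 2) := by
  rw [(hasDerivAt_puncCover hx).deriv]
  rw [norm_neg, norm_mul, norm_mul, norm_div, norm_pow, Complex.norm_real, Real.norm_of_nonneg ht.le,
    Complex.norm_two]
  ring

lemma deriv_puncCover_ne_zero (hr : 0 < r) (ht : 0 < t) (hx : x ∈ Metric.ball (0 : ℂ) 1) :
    deriv (puncCover r t θ) x ≠ 0 := by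
  rw [← norm_pos_iff, norm_deriv_puncCover ht hx]
  have h1 := norm_pos_iff.mpr (puncCover_ne_zero (t := t) (θ := θ) (x := x) hr)
  have h2 := norm_pos_iff.mpr (one_sub_ne_zero_of_mem_ball hx)
  positivity

end PuncCover

/-- The conformal factor of `F` with respect to the cylindrical metric `|dz| / |z|`. -/
def cylFactor (F : ℂ → Mink4) (z : ℂ) : ℝ := Real.sqrt (mink (dX F z) (dX F z)) * ‖z‖

/-- A spacelike CMC-1 immersion of a punctured disc. -/
structure IsCMC1Puncture (s : ℝ) (F : ℂ → Mink4) (r : ℝ) : Prop where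
  coord : IsCMC1Coord s F (Metric.ball 0 r \ {0})
  pos : ∀ z ∈ Metric.ball (0 : ℂ) r \ {0}, 0 < mink (dX F z) (dX F z)

/-- Curves of bounded speed in the punctured disc that stay away from the boundary circle do not
run into the puncture. -/
def IsCompletePuncture (F : ℂ → Mink4) (r : ℝ) : Prop :=
  ∀ r₁ < r, ∀ τ > 0, ∀ (σ σ' : ℝ → ℂ) (L : ℝ), (∀ s ∈ Ioo 0 τ, HasDerivAt σ (σ' s) s) →
    ContinuousOn σ' (Ioo 0 τ) →
    (∀ s ∈ Ioo 0 τ, σ s ≠ 0 ∧ ‖σ s‖ ≤ r₁ ∧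
      Real.sqrt (mink (dX F (σ s)) (dX F (σ s))) * ‖σ' s‖ ≤ L) →
    ∃ z, z ≠ 0 ∧ Tendsto σ (𝓝[<] τ) (𝓝 z)

namespace IsCMC1Puncture

variable {s : ℝ} {F : ℂ → Mink4} {r r' t θ : ℝ}

lemma continuousOn_sqrt (h : IsCMC1Puncture s F r) :
    ContinuousOn (fun z => Real.sqrt (mink (dX F z) (dX F z))) (Metric.ball 0 r \ {0}) := by
  have h1 : ContinuousOn (dX F) (Metric.ball 0 r \ {0}) :=
    (contDiffOn_dX h.coord.isOpen h.coord.smooth).continuousOn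
  have h2 := continuousOn_pi.mp h1
  refine ContinuousOn.sqrt ?_
  unfold mink
  have a0 := h2 0
  have a1 := h2 1
  have a2 := h2 2
  have a3 := h2 3
  fun_prop

/-- The normal form on the universal covering of a smaller punctured disc. -/
lemma exists_normal_form (h : IsCMC1Puncture s F r') (hr : 0 < r) (hrr : r ≤ r') (ht : 0 < t) :
    ∃ k g : ℂ → ℂ, DifferentiableOn ℂ k (Metric.ball 0 1) ∧
      DifferentiableOn ℂ g (Metric.ball 0 1) ∧ g 0 = 0 ∧ ∀ x ∈ Metric.ball (0 : ℂ) 1,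
        k x ≠ 0 ∧ ‖g x‖ < 1 ∧
        Real.sqrt (mink (dX F (puncCover r t θ x)) (dX F (puncCover r t θ x))) *
          ‖deriv (puncCover r t θ) x‖ = ‖k x‖ * (1 - ‖g x‖ ^ 2) ∧
        hopfCoeff s F (puncCover r t θ x) * deriv (puncCover r t θ) x ^ 2 = k x * deriv g x := by
  have hτ : DifferentiableOn ℂ (puncCover r t θ) (Metric.ball 0 1) := fun x hx =>
    (hasDerivAt_puncCover hx).differentiableAt.differentiableWithinAt
  have hmaps : MapsTo (puncCover r t θ) (Metric.ball 0 1) (Metric.ball 0 r' \ {0}) := fun x hx =>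
    ⟨mem_ball_zero_iff.mpr ((norm_puncCover_lt hr ht hx).trans_le hrr), puncCover_ne_zero hr⟩
  have hne : ∀ x ∈ Metric.ball (0 : ℂ) 1, deriv (puncCover r t θ) x ≠ 0 := fun x hx =>
    deriv_puncCover_ne_zero hr ht hx
  obtain ⟨hc, hq⟩ := h.coord.comp Metric.isOpen_ball hτ hmaps hne
  have hE : ∀ x ∈ Metric.ball (0 : ℂ) 1,
      mink (dX (fun ζ => F (puncCover r t θ ζ)) x) (dX (fun ζ => F (puncCover r t θ ζ)) x) =
        ‖deriv (puncCover r t θ) x‖ ^ 2 *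
          mink (dX F (puncCover r t θ x)) (dX F (puncCover r t θ x)) := fun x hx =>
    mink_dX_comp (h.coord.smooth.differentiableAt_of_isOpen h.coord.isOpen (hmaps hx))
      (hasDerivAt_puncCover hx).differentiableAt (h.coord.conf _ (hmaps hx))
      (h.coord.orth _ (hmaps hx))
  obtain ⟨k, g, hk, hg, hg0, hkg⟩ := exists_disc_normal_form hc fun x hx => by
    rw [hE x hx]
    exact mul_pos (pow_pos (norm_pos_iff.mpr (hne x hx)) 2) (h.pos _ (hmaps hx))
  refine ⟨k, g, hk, hg, hg0, fun x hx => ?_⟩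
  obtain ⟨h1, h2, h3, h4⟩ := hkg x hx
  refine ⟨h1, h2, ?_, ?_⟩
  · rw [← h3, hE x hx, Real.sqrt_mul (sq_nonneg _), Real.sqrt_sq (norm_nonneg _), mul_comm]
  · rw [← h4, hq x hx, mul_comm]

end IsCMC1Puncture

/-- A curve in the disc converges if its projection to the punctured disc has bounded speed and
converges to an interior point. -/
lemma tendsto_of_tendsto_puncCover {r t θ C τ : ℝ} (hr : 0 < r) (ht : 0 < t) (hτ : 0 < τ)
    {γ γ' : ℝ → ℂ} (hγ : ∀ s ∈ Ioo 0 τ, γ s ∈ Metric.ball (0 : ℂ) 1)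
    (hγ' : ∀ s ∈ Ioo 0 τ, HasDerivAt γ (γ' s) s) {z : ℂ} (hz : z ≠ 0) (hzr : ‖z‖ < r)
    (hlim : Tendsto (fun s => puncCover r t θ (γ s)) (𝓝[<] τ) (𝓝 z))
    (hC : ∀ᶠ s in 𝓝[<] τ, ‖deriv (puncCover r t θ) (γ s)‖ * ‖γ' s‖ ≤ C) :
    ∃ y ∈ Metric.ball (0 : ℂ) 1, Tendsto γ (𝓝[<] τ) (𝓝 y) := by
  have hz0 := norm_pos_iff.mpr hz
  have hnz : ∀ᶠ s in 𝓝[<] τ, ‖z‖ / 2 < ‖puncCover r t θ (γ s)‖ :=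
    hlim.norm.eventually_const_lt (half_lt_self hz0)
  obtain ⟨l, hl, hsub⟩ := (mem_nhdsLT_iff_exists_Ioo_subset).mp
    (inter_mem (inter_mem hC hnz) (Ioo_mem_nhdsLT hτ))
  -- In the half-plane coordinate `cayley` the covering is an exponential, so away from the puncture
  -- a bounded speed downstairs bounds the speed upstairs. The curve is then Lipschitz there and has
  -- a limit.
  have hυ : ∀ s ∈ Ioo l τ, HasDerivAt (fun s => cayley (γ s)) (2 / (1 - γ s) ^ 2 * γ' s) s :=
    fun s hs => (hasDerivAt_cayley (hγ s (hsub hs).2)).comp s (hγ' s (hsub hs).2)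
  have hC0 : 0 ≤ C := by
    obtain ⟨s, hs⟩ := exists_between (show l < τ from hl)
    exact (by positivity : (0 : ℝ) ≤ _).trans (hsub hs).1.1
  have hbd : ∀ s ∈ Ioo l τ, ‖2 / (1 - γ s) ^ 2 * γ' s‖₊ ≤ Real.toNNReal (C / (t * (‖z‖ / 2))) := by
    intro s hs
    obtain ⟨⟨h1, h2⟩, h3⟩ := hsub hs
    simp only [mem_ofPred_eq] at h1 h2
    rw [norm_deriv_puncCover ht (hγ s h3)] at h1
    rw [← NNReal.coe_le_coe, Real.coe_toNNReal _ (by positivity), coe_nnnorm, le_div_iff₀ (by positivity),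
      norm_mul, norm_div, norm_pow, Complex.norm_two]
    refine le_trans ?_ h1
    have h4 : 0 ≤ 2 / ‖1 - γ s‖ ^ 2 * ‖γ' s‖ * t := by positivity
    calc 2 / ‖1 - γ s‖ ^ 2 * ‖γ' s‖ * (t * (‖z‖ / 2))
        = (2 / ‖1 - γ s‖ ^ 2 * ‖γ' s‖ * t) * (‖z‖ / 2) := by ring
      _ ≤ (2 / ‖1 - γ s‖ ^ 2 * ‖γ' s‖ * t) * ‖puncCover r t θ (γ s)‖ := by gcongr
      _ = _ := by ring
  have hlip := (convex_Ioo l τ).lipschitzOnWith_of_nnnorm_hasDerivWithin_le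
    (fun s hs => (hυ s hs).hasDerivWithinAt) hbd
  have hcau : Cauchy (map (fun s => cayley (γ s)) (𝓝[<] τ)) :=
    (cauchy_nhds.mono nhdsWithin_le_nhds).map_of_le hlip.uniformContinuousOn
      (le_principal_iff.mpr (Ioo_mem_nhdsLT hl))
  obtain ⟨u, hu⟩ := CompleteSpace.complete hcau
  have hu' : Tendsto (fun s => cayley (γ s)) (𝓝[<] τ) (𝓝 u) := hu
  have hre : 0 < u.re := by
    have h1 : Tendsto (fun s => ‖puncCover r t θ (γ s)‖) (𝓝[<] τ)
        (𝓝 (r * Real.exp (-(t * u.re)))) := by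
      simp only [norm_puncCover hr]
      have h2 := (Complex.continuous_re.tendsto u).comp hu'
      exact (((h2.const_mul t).neg).rexp).const_mul r
    have h3 := tendsto_nhds_unique hlim.norm h1
    rw [h3] at hzr
    have h4 := Real.exp_lt_one_iff.mp ((mul_lt_iff_lt_one_right hr).mp hzr)
    by_contra! hcon
    nlinarith
  refine ⟨(u - 1) / (u + 1), cayley_inv_mem_ball hre, ?_⟩
  have hne : u + 1 ≠ 0 := fun h => by
    have := congrArg Complex.re h
    simp at this
    linarith
  refine ((hu'.sub_const 1).div (hu'.add_const 1) hne).congr' ?_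
  filter_upwards [Ioo_mem_nhdsLT hl] with s hs
  exact cayley_left_inv (hγ s (hsub hs).2)

namespace IsCMC1Puncture

variable {s : ℝ} {F : ℂ → Mink4} {r r' t θ : ℝ}

/-- Completeness at the puncture bounds the metric from below. -/
lemma le_cylFactor_mul (h : IsCMC1Puncture s F r') (hr : 0 < r) (hrr : r < r') (ht : 0 < t)
    (hcomp : IsCompletePuncture F r) {c : ℝ} (hc : 0 < c)
    (hcz : ∀ z : ℂ, r / 2 ≤ ‖z‖ → ‖z‖ ≤ r → c ≤ Real.sqrt (mink (dX F z) (dX F z)))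
    (hz : ‖puncCover r t θ 0‖ ≤ r / 2) :
    c * r / 4 ≤ cylFactor F (puncCover r t θ 0) * (2 * t) := by
  have h0 : (0 : ℂ) ∈ Metric.ball (0 : ℂ) 1 := Metric.mem_ball_self one_pos
  obtain ⟨k, g, hk, hg, hg0, hkg⟩ := h.exists_normal_form (θ := θ) hr hrr.le ht
  obtain ⟨w, hw0, hw⟩ := hk.isExactOn_ball.with_val_at 0 0
  -- A curve starting in `‖z‖ ≤ r / 2` must have `ds`-length at least `c r / 4` to reach `‖z‖ = 3 r
  -- / 4`. Shorter rays can escape neither there nor, by completeness, into the puncture.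
  have hle : c * r / 4 ≤ ‖k 0‖ := by
    refine le_norm_of_forall_tendsto (by positivity) hw (fun x hx => (hkg x hx).1) hw0 ?_
    intro a ha τ hτ γ hγ0 hγ
    have hγD := fun q hq => (hγ q hq).1
    have hγc : ContinuousOn γ (Ico 0 τ) := fun q hq => (hγ q hq).2.continuousWithinAt
    set σ : ℝ → ℂ := fun q => puncCover r t θ (γ q) with hσ
    set σ' : ℝ → ℂ := fun q => deriv (puncCover r t θ) (γ q) * (a / k (γ q)) with hσ'
    have hσd : ∀ q ∈ Ico 0 τ, HasDerivWithinAt σ (σ' q) (Ico 0 τ) q := fun q hq =>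
      (hasDerivAt_puncCover (hγD q hq)).differentiableAt.hasDerivAt.comp_hasDerivWithinAt q
        (hγ q hq).2
    -- `ds = |k| (1 - |g|²) |dx|` is at most `|k| |dx|`, and the lifted ray has constant speed `‖a‖`
    -- for the latter.
    have hspeed : ∀ q ∈ Ico 0 τ,
        Real.sqrt (mink (dX F (σ q)) (dX F (σ q))) * ‖σ' q‖ ≤ ‖a‖ := by
      intro q hq
      obtain ⟨h1, h2, h3, -⟩ := hkg (γ q) (hγD q hq)
      have h1' := norm_pos_iff.mpr h1
      rw [hσ', norm_mul, norm_div, ← mul_assoc, h3]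
      have : ‖k (γ q)‖ * (1 - ‖g (γ q)‖ ^ 2) * (‖a‖ / ‖k (γ q)‖) = ‖a‖ * (1 - ‖g (γ q)‖ ^ 2) := by
        field_simp
      rw [this]
      exact mul_le_of_le_one_right (norm_nonneg a) (by nlinarith [sq_nonneg ‖g (γ q)‖])
    -- The derivative estimate is needed only where the curve meets the barrier `r / 2 + r q / 4`,
    -- that is, in the annulus where the lower bound `c` holds.
    have hfence : ∀ q ∈ Ico 0 τ, ‖σ q‖ ≤ r / 2 + r / 4 * q := by
      intro q hq
      refine image_norm_le_of_norm_deriv_right_lt_deriv_boundary (f := σ) (f' := σ') (a := 0)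
        (b := q) (B := fun q => r / 2 + r / 4 * q) (B' := fun _ => r / 4) ?_ ?_ ?_ ?_ ?_
        (right_mem_Icc.mpr hq.1)
      · exact fun p hp => ((hσd p ⟨hp.1, hp.2.trans_lt hq.2⟩).continuousWithinAt).mono
          fun y hy => ⟨hy.1, hy.2.trans_lt hq.2⟩
      · intro p hp
        refine (hσd p ⟨hp.1, hp.2.trans hq.2⟩).mono_of_mem_nhdsWithin ?_
        filter_upwards [self_mem_nhdsWithin,
          mem_nhdsWithin_of_mem_nhds (Iio_mem_nhds (hp.2.trans hq.2))] with y hy hy'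
        exact ⟨hp.1.trans hy, hy'⟩
      · simpa [hσ, hγ0] using hz
      · intro p
        simpa using ((hasDerivAt_id p).const_mul (r / 4)).const_add (r / 2)
      · intro p hp heq
        have hp' : p ∈ Ico 0 τ := ⟨hp.1, hp.2.trans hq.2⟩
        have hp1 : p ≤ 1 := hp'.2.le.trans hτ.2
        have h1 := hcz (σ p) (by rw [heq]; nlinarith [hp.1]) (by rw [heq]; nlinarith)
        have h2 := hspeed p hp'
        have h3 : c * ‖σ' p‖ ≤ ‖a‖ := le_trans (by gcongr) h2
        have h4 : c * ‖σ' p‖ < c * (r / 4) := by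
          calc c * ‖σ' p‖ ≤ ‖a‖ := h3
            _ < c * r / 4 := ha
            _ = c * (r / 4) := by ring
        exact lt_of_mul_lt_mul_left h4 hc.le
    have hσ1 : ∀ q ∈ Ioo 0 τ, ‖σ q‖ ≤ 3 * r / 4 := fun q hq => by
      have := hfence q ⟨hq.1.le, hq.2⟩
      have hq1 : q ≤ 1 := hq.2.le.trans hτ.2
      nlinarith
    have hnhds : ∀ q ∈ Ioo 0 τ, Ico 0 τ ∈ 𝓝 q := fun q hq => Ico_mem_nhds hq.1 hq.2
    have hDiff : DifferentiableOn ℂ (puncCover r t θ) (Metric.ball 0 1) := fun x hx =>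
      (hasDerivAt_puncCover hx).differentiableAt.differentiableWithinAt
    obtain ⟨z, hz0, hlim⟩ := hcomp (3 * r / 4) (by linarith) τ hτ.1 σ σ' ‖a‖
      (fun q hq => (hσd q ⟨hq.1.le, hq.2⟩).hasDerivAt (hnhds q hq))
      (by
        have hm : MapsTo γ (Ioo 0 τ) (Metric.ball 0 1) := fun q hq => hγD q ⟨hq.1.le, hq.2⟩
        have hγc' := hγc.mono Ioo_subset_Ico_self
        refine ((hDiff.deriv Metric.isOpen_ball).continuousOn.comp hγc' hm).mul
          (continuousOn_const.div (hk.continuousOn.comp hγc' hm) fun q hq => (hkg _ (hm hq)).1))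
      (fun q hq => ⟨puncCover_ne_zero hr, hσ1 q hq, hspeed q ⟨hq.1.le, hq.2⟩⟩)
    have hzr : ‖z‖ < r := by
      have h1 : ‖z‖ ≤ 3 * r / 4 := le_of_tendsto hlim.norm (by
        filter_upwards [Ioo_mem_nhdsLT hτ.1] with q hq using hσ1 q hq)
      linarith
    have hzmem : z ∈ Metric.ball (0 : ℂ) r' \ {0} := ⟨mem_ball_zero_iff.mpr (hzr.trans hrr), hz0⟩
    have hEz : 0 < Real.sqrt (mink (dX F z) (dX F z)) := Real.sqrt_pos.mpr (h.pos z hzmem)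
    have hEc : Tendsto (fun q => Real.sqrt (mink (dX F (σ q)) (dX F (σ q)))) (𝓝[<] τ)
        (𝓝 (Real.sqrt (mink (dX F z) (dX F z)))) :=
      ((h.continuousOn_sqrt.continuousAt (h.coord.isOpen.mem_nhds hzmem)).tendsto).comp hlim
    -- Near the limit point the conformal factor exceeds half its value there, so bounded `ds`-speed
    -- becomes bounded Euclidean speed.
    refine tendsto_of_tendsto_puncCover hr ht hτ.1 (γ' := fun q => a / k (γ q))
      (C := ‖a‖ / (Real.sqrt (mink (dX F z) (dX F z)) / 2))
      (fun q hq => hγD q ⟨hq.1.le, hq.2⟩)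
      (fun q hq => (hγ q ⟨hq.1.le, hq.2⟩).2.hasDerivAt (hnhds q hq)) hz0 hzr hlim ?_
    filter_upwards [hEc.eventually_const_lt (half_lt_self hEz), Ioo_mem_nhdsLT hτ.1] with q hq hq'
    have h1 := hspeed q ⟨hq'.1.le, hq'.2⟩
    rw [← norm_mul, le_div_iff₀ (half_pos hEz), mul_comm]
    exact le_trans (by gcongr) h1
  obtain ⟨-, -, h3, -⟩ := hkg 0 h0
  rw [hg0, norm_deriv_puncCover ht h0] at h3
  simp only [norm_zero, sub_zero, norm_one] at h3
  rw [cylFactor]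
  refine hle.trans (le_of_eq ?_)
  linear_combination -h3

end IsCMC1Puncture

/-! ### The Hopf differential at a puncture -/

/-- Harnack's inequality for `log |K|`, for a holomorphic function `K` with `1 ≤ |K|`. -/
lemma norm_le_sq_norm_of_one_le {K : ℂ → ℂ} (hK : DifferentiableOn ℂ K (Metric.ball 0 1))
    (h1 : ∀ x ∈ Metric.ball (0 : ℂ) 1, 1 ≤ ‖K x‖) {x : ℂ} (hx : ‖x‖ ≤ 1 / 3) :
    ‖K 0‖ ≤ ‖K x‖ ^ 2 := by
  have h0 : (0 : ℂ) ∈ Metric.ball (0 : ℂ) 1 := Metric.mem_ball_self one_pos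
  have hxD : x ∈ Metric.ball (0 : ℂ) 1 := by rw [mem_ball_zero_iff]; linarith
  have hne : ∀ x ∈ Metric.ball (0 : ℂ) 1, K x ≠ 0 := fun x hx => norm_pos_iff.mp (by
    linarith [h1 x hx])
  -- A holomorphic logarithm of `K`, as a primitive of `K' / K`; the hypothesis becomes `0 ≤ Re L`.
  obtain ⟨L, hL0, hL⟩ := ((hK.deriv Metric.isOpen_ball).fun_div hK hne).isExactOn_ball.with_val_at 0
    (Complex.log (K 0))
  have hexp : ∀ x ∈ Metric.ball (0 : ℂ) 1, K x = Complex.exp (L x) := by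
    have hd : ∀ x ∈ Metric.ball (0 : ℂ) 1,
        HasDerivAt (fun x => K x * Complex.exp (-L x)) 0 x := by
      intro x hx
      have hKx := (hK.differentiableAt (Metric.isOpen_ball.mem_nhds hx)).hasDerivAt
      refine (hKx.fun_mul (hL x hx).fun_neg.cexp).congr_deriv ?_
      have := hne x hx
      field_simp
      ring
    intro x hx
    have h2 : K x * Complex.exp (-L x) = K 0 * Complex.exp (-L 0) :=
      (convex_ball (0 : ℂ) 1).is_const_of_fderivWithin_eq_zero (𝕜 := ℂ)
        (fun y hy => (hd y hy).differentiableAt.differentiableWithinAt)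
        (fun y hy => by
          rw [(hd y hy).hasFDerivAt.hasFDerivWithinAt.fderivWithin
            (Metric.isOpen_ball.uniqueDiffWithinAt hy)]
          ext; simp) hx h0
    rw [hL0, Complex.exp_neg, Complex.exp_neg, Complex.exp_log (hne 0 h0),
      mul_inv_cancel₀ (hne 0 h0)] at h2
    exact (mul_inv_eq_one₀ (Complex.exp_ne_zero _)).mp h2
  have hnorm : ∀ x ∈ Metric.ball (0 : ℂ) 1, ‖K x‖ = Real.exp (L x).re := fun x hx => by
    rw [hexp x hx, Complex.norm_exp]
  have hre : ∀ x ∈ Metric.ball (0 : ℂ) 1, 0 ≤ (L x).re := fun x hx => by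
    have := h1 x hx
    rw [hnorm x hx] at this
    exact Real.one_le_exp_iff.mp this
  suffices h : (L 0).re ≤ 2 * (L x).re by
    rw [hnorm 0 h0, hnorm x hxD, ← Real.exp_nat_mul]
    exact Real.exp_le_exp.mpr (by exact_mod_cast h)
  -- If `Re L 0 = 0`, the inequality is immediate; otherwise the denominator `L + conj (L 0)` has no
  -- zeros.
  rcases (hre 0 h0).eq_or_lt with h2 | h2
  · linarith [hre x hxD]
  have hden : ∀ x ∈ Metric.ball (0 : ℂ) 1, L x + conj (L 0) ≠ 0 := fun x hx h => by
    have h3 := congrArg Complex.re h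
    simp at h3
    linarith [hre x hx]
  have hLd : DifferentiableOn ℂ L (Metric.ball 0 1) := fun x hx =>
    (hL x hx).differentiableAt.differentiableWithinAt
  have hsq : ∀ x, ‖L x - L 0‖ ^ 2 = ((L x).re - (L 0).re) ^ 2 + ((L x).im - (L 0).im) ^ 2 ∧
      ‖L x + conj (L 0)‖ ^ 2 = ((L x).re + (L 0).re) ^ 2 + ((L x).im - (L 0).im) ^ 2 := fun x => by
    rw [← Complex.normSq_eq_norm_sq, ← Complex.normSq_eq_norm_sq]
    simp [Complex.normSq_apply]
    constructor <;> ring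
  -- Schwarz lemma after moving the right half-plane to the unit disc with `L 0 ↦ 0`. The Harnack
  -- constant at radius `1 / 3` is `(1 + 1/3) / (1 - 1/3) = 2`, whence the square.
  have hS := Complex.norm_le_norm_of_mapsTo_ball
    (f := fun x => (L x - L 0) / (L x + conj (L 0))) (R := 1) (z := x)
    ((hLd.sub_const _).fun_div (hLd.add_const _) hden) (fun y hy => by
      rw [mem_closedBall_zero_iff, norm_div, div_le_one (norm_pos_iff.mpr (hden y hy)),
        ← sq_le_sq₀ (norm_nonneg _) (norm_nonneg _), (hsq y).1, (hsq y).2]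
      nlinarith [hre y hy]) (by simp) (mem_ball_zero_iff.mp hxD)
  rw [norm_div, div_le_iff₀ (norm_pos_iff.mpr (hden x hxD))] at hS
  have h3 : ‖L x - L 0‖ * 3 ≤ ‖L x + conj (L 0)‖ := by
    nlinarith [norm_nonneg (L x + conj (L 0))]
  have h4 := pow_le_pow_left₀ (by positivity) h3 2
  rw [mul_pow, (hsq x).1, (hsq x).2] at h4
  have h5 : (3 * ((L x).re - (L 0).re)) ^ 2 ≤ ((L x).re + (L 0).re) ^ 2 := by
    nlinarith [sq_nonneg ((L x).im - (L 0).im)]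
  have h6 := abs_le_of_sq_le_sq h5 (by linarith [hre x hxD])
  linarith [(abs_le.mp h6).1, neg_abs_le (3 * ((L x).re - (L 0).re))]

/-- The submultiplicativity `Λ t ≤ Λ (t / 2) ^ 2` forces at most exponential growth. -/
lemma exists_le_exp_of_le_sq {Λ : ℝ → ℝ → ℝ} {B : ℝ} (hB : 0 ≤ B)
    (h0 : ∀ t > 0, ∀ θ, 0 ≤ Λ t θ) (h : ∀ t > 0, ∀ θ, Λ t θ ≤ Λ (t / 2) θ ^ 2)
    (hb : ∀ t ∈ Icc (1 : ℝ) 2, ∀ θ, Λ t θ ≤ Real.exp B) :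
    ∀ t ≥ 1, ∀ θ, Λ t θ ≤ Real.exp (B * t) := by
  -- Induction on the dyadic range of `t`: for `t > 2` one halving stays in `t ≥ 1`, and squaring
  -- doubles the exponent.
  have key : ∀ n : ℕ, ∀ t ∈ Icc (1 : ℝ) (2 ^ (n + 1)), ∀ θ, Λ t θ ≤ Real.exp (B * t) := by
    intro n
    induction n with
    | zero =>
      intro t ht θ
      refine (hb t (by simpa using ht) θ).trans (Real.exp_le_exp.mpr ?_)
      nlinarith [ht.1]
    | succ n ih =>
      intro t ht θ
      rcases le_or_gt t 2 with h2 | h2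
      · refine (hb t ⟨ht.1, h2⟩ θ).trans (Real.exp_le_exp.mpr ?_)
        nlinarith [ht.1]
      · have h3 := ih (t / 2) ⟨by linarith, by
          have := ht.2
          rw [pow_succ] at this
          linarith⟩ θ
        refine (h t (by linarith) θ).trans ((pow_le_pow_left₀ (h0 (t / 2) (by linarith) θ) h3 2).trans (le_of_eq ?_))
        rw [← Real.exp_nat_mul]
        congr 1
        push_cast
        ring
  intro t ht θ
  obtain ⟨n, hn⟩ := pow_unbounded_of_one_lt t (one_lt_two)
  exact key n t ⟨ht, hn.le.trans (pow_le_pow_right₀ one_le_two (Nat.le_succ n))⟩ θ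

lemma norm_puncCover_zero {r t θ : ℝ} (hr : 0 < r) :
    ‖puncCover r t θ 0‖ = r * Real.exp (-t) := by
  rw [norm_puncCover hr]; simp [cayley]

/-- `cayley (-1 / 3) = 1 / 2`, so moving from the centre to this point, at the radius where
Harnack's constant is `2`, halves `t`. -/
lemma puncCover_neg_third (r t θ : ℝ) :
    puncCover r t θ (-1 / 3) = puncCover r (t / 2) θ 0 := by
  have : cayley (-1 / 3) = 1 / 2 := by rw [cayley]; norm_num
  rw [puncCover, this, puncCover_zero]
  push_cast
  congr 3
  ring

/-- Every nonzero point can be taken as the centre of a covering, so estimates at the centres are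
pointwise estimates. -/
lemma exists_puncCover_eq {r : ℝ} (hr : 0 < r) {z : ℂ} (hz : z ≠ 0) :
    puncCover r (Real.log (r / ‖z‖)) z.arg 0 = z := by
  have hz' := norm_pos_iff.mpr hz
  rw [puncCover_zero, Complex.exp_sub, ← Complex.ofReal_exp, Real.exp_log (by positivity)]
  have h := Complex.norm_mul_exp_arg_mul_I z
  have hrC : (r : ℂ) ≠ 0 := Complex.ofReal_ne_zero.mpr hr.ne'
  have hzC : ((‖z‖ : ℝ) : ℂ) ≠ 0 := Complex.ofReal_ne_zero.mpr hz'.ne'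
  push_cast
  field_simp
  rw [mul_comm]
  exact h

namespace IsCMC1Puncture

variable {s : ℝ} {F : ℂ → Mink4} {r r' t θ : ℝ}

lemma continuousOn_cylFactor (h : IsCMC1Puncture s F r) :
    ContinuousOn (cylFactor F) (Metric.ball 0 r \ {0}) :=
  h.continuousOn_sqrt.mul continuous_norm.continuousOn

lemma isCompact_annulus (a b : ℝ) : IsCompact {z : ℂ | a ≤ ‖z‖ ∧ ‖z‖ ≤ b} := by
  refine Metric.isCompact_of_isClosed_isBounded ?_ ?_
  · exact (isClosed_le continuous_const continuous_norm).inter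
      (isClosed_le continuous_norm continuous_const)
  · exact (Metric.isBounded_closedBall (x := (0 : ℂ)) (r := b)).subset fun z hz =>
      mem_closedBall_zero_iff.mpr hz.2

lemma annulus_subset {a b : ℝ} (ha : 0 < a) (hb : b < r) :
    {z : ℂ | a ≤ ‖z‖ ∧ ‖z‖ ≤ b} ⊆ Metric.ball 0 r \ {0} := fun z hz =>
  ⟨mem_ball_zero_iff.mpr (hz.2.trans_lt hb), fun h => by
    rw [mem_singleton_iff.mp h] at hz
    have := hz.1
    simp at this
    linarith⟩

/-- The lower bound for the metric on the whole punctured disc. -/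
lemma exists_le_cylFactor (h : IsCMC1Puncture s F r') (hr : 0 < r) (hrr : r < r')
    (hcomp : IsCompletePuncture F r) :
    ∃ d > 0, ∀ t > 0, ∀ θ, d ≤ cylFactor F (puncCover r t θ 0) * (1 + t) := by
  have hsub := annulus_subset (r := r') (half_pos hr) hrr
  obtain ⟨c, hc, hcz⟩ : ∃ c > 0, ∀ z : ℂ, r / 2 ≤ ‖z‖ → ‖z‖ ≤ r →
      c ≤ Real.sqrt (mink (dX F z) (dX F z)) := by
    obtain ⟨c, hc, hcz⟩ := (isCompact_annulus (r / 2) r).exists_forall_le' (a := 0)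
      (h.continuousOn_sqrt.mono hsub) fun z hz => Real.sqrt_pos.mpr (h.pos z (hsub hz))
    exact ⟨c, hc, fun z h1 h2 => hcz z ⟨h1, h2⟩⟩
  -- For `‖z‖ ≤ r / 2` the bound `c r / 4` on `M · 2t` is divided by two; in the outer annulus `M ≥
  -- c r / 2` holds directly.
  refine ⟨c * r / 8, by positivity, fun t ht θ => ?_⟩
  have hM : 0 ≤ cylFactor F (puncCover r t θ 0) := by unfold cylFactor; positivity
  rcases le_or_gt ‖puncCover r t θ 0‖ (r / 2) with hz | hz
  · have := h.le_cylFactor_mul hr hrr ht hcomp hc hcz hz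
    nlinarith
  · have h1 : ‖puncCover r t θ 0‖ ≤ r :=
      (norm_puncCover_lt hr ht (Metric.mem_ball_self one_pos)).le
    have h2 : c * (r / 2) ≤ cylFactor F (puncCover r t θ 0) :=
      mul_le_mul (hcz _ hz.le h1) hz.le (by positivity) (Real.sqrt_nonneg _)
    nlinarith [mul_pos hc hr]

/-- The Schwarz lemma for the Gauss map bounds the Hopf differential. -/
lemma norm_hopfCoeff_le (h : IsCMC1Puncture s F r') (hr : 0 < r) (hrr : r < r') (ht : 0 < t) :
    ‖hopfCoeff s F (puncCover r t θ 0)‖ * (‖puncCover r t θ 0‖ * (2 * t)) ≤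
      Real.sqrt (mink (dX F (puncCover r t θ 0)) (dX F (puncCover r t θ 0))) := by
  have h0 : (0 : ℂ) ∈ Metric.ball (0 : ℂ) 1 := Metric.mem_ball_self one_pos
  obtain ⟨k, g, hk, hg, hg0, hkg⟩ := h.exists_normal_form (θ := θ) hr hrr.le ht
  obtain ⟨-, -, h3, h4⟩ := hkg 0 h0
  have hs := Complex.norm_deriv_le_div_of_mapsTo_ball (f := g) (c := 0) (R₁ := 1) (R₂ := 1) hg
    (fun x hx => by rw [hg0, mem_closedBall_zero_iff]; exact (hkg x hx).2.1.le) one_pos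
  have hd : ‖deriv (puncCover r t θ) 0‖ = ‖puncCover r t θ 0‖ * (2 * t) := by
    rw [norm_deriv_puncCover ht h0]; simp
  have hdpos : 0 < ‖deriv (puncCover r t θ) 0‖ :=
    norm_pos_iff.mpr (deriv_puncCover_ne_zero hr ht h0)
  rw [hg0, norm_zero] at h3
  have h5 := congrArg norm h4
  rw [norm_mul, norm_mul, norm_pow] at h5
  have h6 : ‖k 0‖ * ‖deriv g 0‖ ≤ ‖k 0‖ := mul_le_of_le_one_right (norm_nonneg _) (by simpa using hs)
  rw [← hd]
  refine le_of_mul_le_mul_right ?_ hdpos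
  rw [h3, mul_assoc, ← pow_two, h5]
  linarith

/-- Doubling the distance to the boundary at most squares the conformal factor. -/
lemma cylFactor_le_sq (h : IsCMC1Puncture s F r') (hr : 0 < r) (hrr : r < r') {d : ℝ} (hd : 0 < d)
    (hdM : ∀ t > 0, ∀ θ, d ≤ cylFactor F (puncCover r t θ 0) * (1 + t)) (ht : 0 < t) :
    cylFactor F (puncCover r t θ 0) * (1 + t) / d ≤
      (9 / 8 * (cylFactor F (puncCover r (t / 2) θ 0) * (1 + t / 2) / d)) ^ 2 := by
  have h0 : (0 : ℂ) ∈ Metric.ball (0 : ℂ) 1 := Metric.mem_ball_self one_pos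
  obtain ⟨k, g, hk, hg, hg0, hkg⟩ := h.exists_normal_form (θ := θ) hr hrr.le ht
  have hkM : ∀ x ∈ Metric.ball (0 : ℂ) 1, cylFactor F (puncCover r t θ x) * (2 * t) =
      ‖k x‖ * ‖1 - x‖ ^ 2 * (1 - ‖g x‖ ^ 2) := fun x hx => by
    have h3 := (hkg x hx).2.2.1
    have hne := norm_pos_iff.mpr (one_sub_ne_zero_of_mem_ball hx)
    rw [norm_deriv_puncCover ht hx] at h3
    rw [cylFactor]
    have h4 : ‖k x‖ * ‖1 - x‖ ^ 2 * (1 - ‖g x‖ ^ 2) = (‖k x‖ * (1 - ‖g x‖ ^ 2)) * ‖1 - x‖ ^ 2 := by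
      ring
    rw [h4, ← h3]
    field_simp
  -- The factor `(1 - x)²` removes the derivative of the Cayley transform. The factor `1 + t ·
  -- cayley` is holomorphic and in norm at least `1 + t Re cayley`, which is the weight in the lower
  -- bound; hence `|K| ≥ 1`.
  let K : ℂ → ℂ := fun x => k x * (1 - x) ^ 2 * (1 + t * cayley x) / (2 * t * d : ℝ)
  have hKn : ∀ x, ‖K x‖ = ‖k x‖ * ‖1 - x‖ ^ 2 * ‖1 + t * cayley x‖ / (2 * t * d) := fun x => by
    simp only [K]
    rw [norm_div, norm_mul, norm_mul, norm_pow, Complex.norm_real,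
      Real.norm_of_nonneg (by positivity)]
  have hcay : DifferentiableOn ℂ cayley (Metric.ball 0 1) := fun x hx =>
    (hasDerivAt_cayley hx).differentiableAt.differentiableWithinAt
  have hKd : DifferentiableOn ℂ K (Metric.ball 0 1) :=
    ((hk.mul ((differentiableOn_const _).sub differentiableOn_id |>.pow 2)).mul
      ((hcay.const_mul _).const_add _)).div_const _
  have hK1 : ∀ x ∈ Metric.ball (0 : ℂ) 1, 1 ≤ ‖K x‖ := by
    intro x hx
    have hre := mul_pos ht (cayley_re_pos hx)
    -- The point over `x` is also the centre of the covering with parameter `t Re (cayley x)` and a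
    -- suitable angle, so the lower bound applies to it.
    have h1 := hdM (t * (cayley x).re) hre ((θ * Complex.I - t * cayley x).im)
    have h2 : puncCover r (t * (cayley x).re) ((θ * Complex.I - t * cayley x).im) 0 =
        puncCover r t θ x := by
      rw [puncCover_zero, puncCover]
      congr 2
      apply Complex.ext <;> simp
    rw [h2] at h1
    have h3 : 1 + t * (cayley x).re ≤ ‖1 + t * cayley x‖ := by
      refine le_trans (le_of_eq ?_) (Complex.re_le_norm _)
      simp
    have h4 : cylFactor F (puncCover r t θ x) * (2 * t) ≤ ‖k x‖ * ‖1 - x‖ ^ 2 := by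
      rw [hkM x hx]
      exact mul_le_of_le_one_right (by positivity) (by nlinarith [sq_nonneg ‖g x‖])
    rw [hKn, le_div_iff₀ (by positivity), one_mul]
    calc 2 * t * d ≤ 2 * t * (cylFactor F (puncCover r t θ x) * (1 + t * (cayley x).re)) := by gcongr
      _ = cylFactor F (puncCover r t θ x) * (2 * t) * (1 + t * (cayley x).re) := by ring
      _ ≤ _ := mul_le_mul h4 h3 (by positivity) (by positivity)
  have hK0 : ‖K 0‖ = cylFactor F (puncCover r t θ 0) * (1 + t) / d := by
    have h1 := hkM 0 h0
    rw [hg0] at h1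
    have h2 : ‖(1 : ℂ) + t * cayley 0‖ = 1 + t := by
      rw [cayley]
      simp only [add_zero, sub_zero, div_one, mul_one]
      rw [← Complex.ofReal_one, ← Complex.ofReal_add, Complex.norm_real,
        Real.norm_of_nonneg (by positivity)]
    rw [hKn, h2]
    simp at h1 ⊢
    rw [← h1]
    field_simp
  have h3 : (-1 / 3 : ℂ) ∈ Metric.ball (0 : ℂ) 1 := by
    rw [mem_ball_zero_iff]; norm_num
  -- By the Schwarz lemma `1 - |g|² ≥ 8 / 9` at this point, the source of the factor `9 / 8`.
  have hg3 : ‖g (-1 / 3)‖ ≤ 1 / 3 := by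
    have h1 := Complex.norm_le_norm_of_mapsTo_ball (f := g) (R := 1) (z := -1 / 3) hg
      (fun x hx => by rw [mem_closedBall_zero_iff]; exact (hkg x hx).2.1.le) hg0
      (mem_ball_zero_iff.mp h3)
    refine h1.trans (le_of_eq ?_)
    norm_num
  have hK3 : ‖K (-1 / 3)‖ ≤ 9 / 8 * (cylFactor F (puncCover r (t / 2) θ 0) * (1 + t / 2) / d) := by
    have h1 := hkM (-1 / 3) h3
    have h2 : ‖(1 : ℂ) + t * cayley (-1 / 3)‖ = 1 + t / 2 := by
      have h4 : (1 : ℂ) + t * cayley (-1 / 3) = ((1 + t / 2 : ℝ) : ℂ) := by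
        have : cayley (-1 / 3) = 1 / 2 := by rw [cayley]; norm_num
        rw [this]; push_cast; ring
      rw [h4, Complex.norm_real, Real.norm_of_nonneg (by positivity)]
    rw [puncCover_neg_third] at h1
    rw [hKn, h2]
    set a := ‖k (-1 / 3)‖ * ‖(1 : ℂ) - -1 / 3‖ ^ 2 with ha
    have ha0 : 0 ≤ a := by positivity
    have h5 : a ≤ 9 / 8 * (cylFactor F (puncCover r (t / 2) θ 0) * (2 * t)) := by
      rw [h1]
      have : ‖g (-1 / 3)‖ ^ 2 ≤ 1 / 9 := by nlinarith [norm_nonneg (g (-1 / 3))]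
      nlinarith
    calc a * (1 + t / 2) / (2 * t * d)
        ≤ 9 / 8 * (cylFactor F (puncCover r (t / 2) θ 0) * (2 * t)) * (1 + t / 2) / (2 * t * d) := by
          gcongr
      _ = _ := by field_simp
  have hH := norm_le_sq_norm_of_one_le hKd hK1 (x := -1 / 3) (by norm_num)
  rw [hK0] at hH
  exact hH.trans (pow_le_pow_left₀ (norm_nonneg _) hK3 2)

/-- The Hopf differential has at most a pole at a complete puncture. -/
theorem meromorphicAt_hopfCoeff (h : IsCMC1Puncture s F r') (hr : 0 < r) (hrr : r < r')
    (hcomp : IsCompletePuncture F r) : MeromorphicAt (hopfCoeff s F) 0 := by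
  obtain ⟨d, hd, hdM⟩ := h.exists_le_cylFactor hr hrr hcomp
  have hM : ∀ z, 0 ≤ cylFactor F z := fun z => by unfold cylFactor; positivity
  -- The factor `81 / 64 = (9 / 8)²` absorbs the constant of `cylFactor_le_sq`, leaving `Λ t ≤ Λ (t
  -- / 2) ^ 2`.
  let Λ : ℝ → ℝ → ℝ := fun t θ => 81 / 64 * (cylFactor F (puncCover r t θ 0) * (1 + t) / d)
  obtain ⟨B₀, hB₀⟩ := (isCompact_annulus (r * Real.exp (-2)) (r * Real.exp (-1))).bddAbove_image
    (f := cylFactor F) (h.continuousOn_cylFactor.mono (annulus_subset (by positivity)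
      ((mul_lt_of_lt_one_right hr (Real.exp_lt_one_iff.mpr (by norm_num))).trans hrr)))
  -- An integer exponent, so that `exp (N t)` with `t = log (r / ‖z‖)` becomes the power `(r / ‖z‖)
  -- ^ N`; on `1 ≤ t ≤ 2` one has `Λ ≤ N ≤ exp N`.
  obtain ⟨N, hN⟩ := exists_nat_ge (81 / 64 * (|B₀| * 3 / d))
  have hb : ∀ t ∈ Icc (1 : ℝ) 2, ∀ θ, cylFactor F (puncCover r t θ 0) ≤ |B₀| := fun t ht θ =>
    (hB₀ (mem_image_of_mem _ ⟨by
      rw [norm_puncCover_zero hr]; gcongr; linarith [ht.2], by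
      rw [norm_puncCover_zero hr]; gcongr; linarith [ht.1]⟩)).trans (le_abs_self _)
  have hΛ : ∀ t ≥ 1, ∀ θ, Λ t θ ≤ Real.exp (N * t) := by
    refine exists_le_exp_of_le_sq N.cast_nonneg (fun t ht θ => ?_) (fun t ht θ => ?_)
      fun t ht θ => ?_
    · have := hM (puncCover r t θ 0)
      positivity
    · have h1 := h.cylFactor_le_sq (θ := θ) hr hrr hd hdM ht
      simp only [Λ]
      nlinarith
    · have h1 := hb t ht θ
      have h2 : cylFactor F (puncCover r t θ 0) * (1 + t) ≤ |B₀| * 3 :=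
        mul_le_mul h1 (by linarith [ht.2]) (by linarith [ht.1]) (abs_nonneg _)
      have h3 : Λ t θ ≤ 81 / 64 * (|B₀| * 3 / d) := by simp only [Λ]; gcongr
      linarith [Real.add_one_le_exp (N : ℝ)]
  -- Here `t ≥ 1`, so the factors `1 + t` and `2 t` can be dropped and `|q| |z|² ≤ M ≤ d (r /
  -- |z|)^N`. The exponent is `N + 3` rather than `N + 2` so that the product tends to `0`, its
  -- value at the puncture.
  have hq : ∀ z : ℂ, z ≠ 0 → ‖z‖ ≤ r * Real.exp (-1) →
      ‖z ^ (N + 3) * hopfCoeff s F z‖ ≤ d * r ^ N * ‖z‖ := by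
    intro z hz hzr
    have hz' := norm_pos_iff.mpr hz
    have ht : 1 ≤ Real.log (r / ‖z‖) := by
      rw [Real.le_log_iff_exp_le (by positivity), le_div_iff₀ hz']
      calc Real.exp 1 * ‖z‖ ≤ Real.exp 1 * (r * Real.exp (-1)) := by gcongr
        _ = r := by rw [Real.exp_neg]; field_simp
    have h1 := hΛ _ ht z.arg
    have h2 := h.norm_hopfCoeff_le (θ := z.arg) hr hrr (by linarith : 0 < Real.log (r / ‖z‖))
    simp only [Λ] at h1
    rw [exists_puncCover_eq hr hz] at h1 h2
    rw [mul_comm (N : ℝ), Real.exp_mul, Real.exp_log (by positivity), Real.rpow_natCast,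
      div_pow] at h1
    set t := Real.log (r / ‖z‖)
    have h3 : cylFactor F z ≤ d * (r ^ N / ‖z‖ ^ N) := by
      have h4 : cylFactor F z / d ≤ 81 / 64 * (cylFactor F z * (1 + t) / d) := by
        have h5 : 0 ≤ cylFactor F z / d := div_nonneg (hM z) hd.le
        have h6 : 81 / 64 * (cylFactor F z * (1 + t) / d) =
          cylFactor F z / d * (81 / 64 * (1 + t)) := by ring
        rw [h6]
        exact le_mul_of_one_le_right h5 (by linarith)
      have h5 := h4.trans h1
      rw [div_le_iff₀ hd] at h5
      linarith
    have h4 : ‖hopfCoeff s F z‖ * ‖z‖ ^ 2 ≤ cylFactor F z := by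
      refine le_trans ?_ (mul_le_mul_of_nonneg_right h2 (norm_nonneg z))
      have h5 : ‖hopfCoeff s F z‖ * (‖z‖ * (2 * t)) * ‖z‖ =
        ‖hopfCoeff s F z‖ * ‖z‖ ^ 2 * (2 * t) := by ring
      rw [h5]
      exact le_mul_of_one_le_right (by positivity) (by linarith)
    have h5 := h4.trans h3
    rw [norm_mul, norm_pow]
    calc ‖z‖ ^ (N + 3) * ‖hopfCoeff s F z‖
        = ‖hopfCoeff s F z‖ * ‖z‖ ^ 2 * (‖z‖ ^ N * ‖z‖) := by ring
      _ ≤ d * (r ^ N / ‖z‖ ^ N) * (‖z‖ ^ N * ‖z‖) := by gcongr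
      _ = _ := by field_simp
  refine ⟨N + 3, ?_⟩
  have hnear : ∀ᶠ z in 𝓝 (0 : ℂ), ‖z‖ ≤ r * Real.exp (-1) := by
    filter_upwards [Metric.closedBall_mem_nhds (0 : ℂ) (by positivity : 0 < r * Real.exp (-1))]
      with z hz using mem_closedBall_zero_iff.mp hz
  -- Riemann's removable singularity theorem for `z ^ (N + 3) q`.
  refine Complex.analyticAt_of_differentiable_on_punctured_nhds_of_continuousAt ?_ ?_
  · have hball : Metric.ball (0 : ℂ) r' \ {0} ∈ 𝓝[≠] (0 : ℂ) :=
      inter_mem (mem_nhdsWithin_of_mem_nhds (Metric.ball_mem_nhds _ (hr.trans hrr)))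
        self_mem_nhdsWithin
    filter_upwards [hball] with z hz
    have := h.coord.differentiableOn_hopfCoeff.differentiableAt (h.coord.isOpen.mem_nhds hz)
    simp only [smul_eq_mul, sub_zero]
    fun_prop
  · have hval : ((0 : ℂ) - 0) ^ (N + 3) • hopfCoeff s F 0 = 0 := by simp
    rw [ContinuousAt, hval]
    refine squeeze_zero_norm' (a := fun z => d * r ^ N * ‖z‖) ?_ ?_
    · filter_upwards [hnear] with z hz
      rcases eq_or_ne z 0 with rfl | hz0
      · simp
      · simpa using hq z hz0 hz
    · have : ContinuousAt (fun z : ℂ => d * r ^ N * ‖z‖) 0 := by fun_prop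
      simpa [ContinuousAt] using this

end IsCMC1Puncture

/-! ### Holomorphic parametrizations of Riemann surfaces -/

section Param

variable {M : Type*} [TopologicalSpace M] [ChartedSpace ℂ M]

/-- The derivative at `z` of a parametrization, read in the preferred chart at its value. -/
def paramDeriv (ψ : ℂ → M) (z : ℂ) : ℂ := deriv (fun ζ => chartAt ℂ (ψ z) (ψ ζ)) z

/-- `ψ` is a locally injective holomorphic parametrization on the open set `Ω`. -/
structure IsParam (ψ : ℂ → M) (Ω : Set ℂ) : Prop where
  isOpen : IsOpen Ω
  cont : ContinuousOn ψ Ω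
  holo : ∀ x : M, DifferentiableOn ℂ (fun ζ => chartAt ℂ x (ψ ζ)) (Ω ∩ ψ ⁻¹' (chartAt ℂ x).source)
  deriv_ne_zero : ∀ z ∈ Ω, paramDeriv ψ z ≠ 0

namespace IsParam

variable {ψ : ℂ → M} {Ω : Set ℂ} {z : ℂ}

lemma continuousAt (h : IsParam ψ Ω) (hz : z ∈ Ω) : ContinuousAt ψ z :=
  h.cont.continuousAt (h.isOpen.mem_nhds hz)

lemma eventually_mem_source (h : IsParam ψ Ω) (hz : z ∈ Ω) :
    ∀ᶠ ζ in 𝓝 z, ψ ζ ∈ (chartAt ℂ (ψ z)).source :=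
  h.continuousAt hz ((chartAt ℂ (ψ z)).open_source.mem_nhds (mem_chart_source ℂ (ψ z)))

lemma differentiableAt (h : IsParam ψ Ω) (hz : z ∈ Ω) :
    ∀ᶠ ζ in 𝓝 z, DifferentiableAt ℂ (fun ζ => chartAt ℂ (ψ z) (ψ ζ)) ζ := by
  have hmem : Ω ∩ ψ ⁻¹' (chartAt ℂ (ψ z)).source ∈ 𝓝 z :=
    inter_mem (h.isOpen.mem_nhds hz) (h.eventually_mem_source hz)
  filter_upwards [eventually_mem_nhds_iff.mpr hmem] with ζ hζ
  exact (h.holo (ψ z)).differentiableAt hζ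

lemma hasDerivAt (h : IsParam ψ Ω) (hz : z ∈ Ω) :
    HasDerivAt (fun ζ => chartAt ℂ (ψ z) (ψ ζ)) (paramDeriv ψ z) z :=
  (h.differentiableAt hz).self_of_nhds.hasDerivAt

lemma analyticAt (h : IsParam ψ Ω) (hz : z ∈ Ω) :
    AnalyticAt ℂ (fun ζ => chartAt ℂ (ψ z) (ψ ζ)) z :=
  Complex.analyticAt_iff_eventually_differentiableAt.mpr (h.differentiableAt hz)

lemma contDiffAt (h : IsParam ψ Ω) (hz : z ∈ Ω) {n : ℕ∞ω} :
    ContDiffAt ℝ n (fun ζ => chartAt ℂ (ψ z) (ψ ζ)) z :=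
  (h.analyticAt hz).contDiffAt.restrict_scalars ℝ

/-- Parametrizations are open maps. -/
lemma map_nhds_eq (h : IsParam ψ Ω) (hz : z ∈ Ω) : map ψ (𝓝 z) = 𝓝 (ψ z) := by
  have h1 := (h.analyticAt hz).hasStrictDerivAt
  have h2 := (h1.hasStrictFDerivAt_equiv (h.deriv_ne_zero z hz)).map_nhds_eq_of_equiv
  have h3 := congrArg (map (chartAt ℂ (ψ z)).symm) h2
  rw [← (chartAt ℂ (ψ z)).symm_map_nhds_eq (mem_chart_source ℂ (ψ z)), ← h3, map_map]
  refine (map_congr ?_).symm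
  filter_upwards [h.eventually_mem_source hz] with ζ hζ
  exact (chartAt ℂ (ψ z)).left_inv hζ

/-- A dense set has dense preimage because a parametrization is an open map. -/
lemma subset_closure_preimage (h : IsParam ψ Ω) {W : Set M} (hW : Dense W) :
    Ω ⊆ closure (Ω ∩ ψ ⁻¹' W) := by
  intro z hz
  rw [mem_closure_iff_nhds]
  intro U hU
  have h1 : ψ '' (U ∩ Ω) ∈ 𝓝 (ψ z) := by
    rw [← h.map_nhds_eq hz]
    exact image_mem_map (inter_mem hU (h.isOpen.mem_nhds hz))
  obtain ⟨V, hV, hVo, hzV⟩ := mem_nhds_iff.mp h1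
  obtain ⟨y, hyV, hyW⟩ := hW.inter_open_nonempty V hVo ⟨_, hzV⟩
  obtain ⟨w, hw, rfl⟩ := hV hyV
  exact ⟨w, hw.1, hw.2, hyW⟩

lemma isOpen_preimage (h : IsParam ψ Ω) {W : Set M} (hW : IsOpen W) : IsOpen (Ω ∩ ψ ⁻¹' W) :=
  h.cont.isOpen_inter_preimage h.isOpen hW

section Smooth

variable {f : M → Mink4}

lemma contDiffAt_chart {x : M} (hf : ContMDiffAt 𝓘(ℝ, ℂ) 𝓘(ℝ, Mink4) ∞ f x) :
    ContDiffAt ℝ ∞ (f ∘ (chartAt ℂ x).symm) (chartAt ℂ x x) := by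
  have h := (contMDiffAt_iff.mp hf).2
  simp [extChartAt, contDiffWithinAt_univ] at h
  exact h

lemma surfDeriv_eq {x : M} (hf : ContMDiffAt 𝓘(ℝ, ℂ) 𝓘(ℝ, Mink4) ∞ f x) (v : ℂ) :
    surfDeriv f x v = fderiv ℝ (f ∘ (chartAt ℂ x).symm) (chartAt ℂ x x) v := by
  have h := (hf.mdifferentiableAt (by simp)).mfderiv
  rw [surfDeriv, h]
  simp [writtenInExtChartAt, extChartAt, fderivWithin_univ, Function.comp_def]
  rfl

lemma comp_eventuallyEq (h : IsParam ψ Ω) (hz : z ∈ Ω) :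
    (fun ζ => f (ψ ζ)) =ᶠ[𝓝 z]
      (f ∘ (chartAt ℂ (ψ z)).symm) ∘ (fun ζ => chartAt ℂ (ψ z) (ψ ζ)) := by
  filter_upwards [h.eventually_mem_source hz] with ζ hζ
  simp [(chartAt ℂ (ψ z)).left_inv hζ]

lemma contDiffAt_comp (h : IsParam ψ Ω) (hz : z ∈ Ω)
    (hf : ContMDiffAt 𝓘(ℝ, ℂ) 𝓘(ℝ, Mink4) ∞ f (ψ z)) : ContDiffAt ℝ ∞ (fun ζ => f (ψ ζ)) z :=
  ((contDiffAt_chart hf).comp z (h.contDiffAt hz)).congr_of_eventuallyEq (h.comp_eventuallyEq hz)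

lemma fderiv_comp (h : IsParam ψ Ω) (hz : z ∈ Ω)
    (hf : ContMDiffAt 𝓘(ℝ, ℂ) 𝓘(ℝ, Mink4) ∞ f (ψ z)) (v : ℂ) :
    fderiv ℝ (fun ζ => f (ψ ζ)) z v = surfDeriv f (ψ z) (paramDeriv ψ z * v) := by
  rw [(h.comp_eventuallyEq hz).fderiv_eq, surfDeriv_eq hf]
  have h1 := ((contDiffAt_chart hf).differentiableAt (by simp)).hasFDerivAt
  have h2 : HasFDerivAt (fun ζ => chartAt ℂ (ψ z) (ψ ζ)) _ z :=
    (h.hasDerivAt hz).hasFDerivAt.restrictScalars ℝ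
  rw [(h1.comp z h2).fderiv]
  simp [mul_comm]

end Smooth

end IsParam

variable [IsManifold 𝓘(ℂ) ω M]

lemma differentiableOn_chart_symm {e e' : OpenPartialHomeomorph M ℂ} (he : e ∈ atlas ℂ M)
    (he' : e' ∈ atlas ℂ M) :
    DifferentiableOn ℂ (fun ζ => e' (e.symm ζ)) (e.target ∩ e.symm ⁻¹' e'.source) := by
  have h1 := (contDiffGroupoid ω 𝓘(ℂ)).compatible he he'
  rw [contDiffGroupoid, mem_groupoid_of_pregroupoid] at h1
  have h2 : ContDiffOn ℂ ω _ _ := h1.1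
  have h3 := h2.differentiableOn (by simp)
  simpa [contDiffPregroupoid, Function.comp_def] using h3

lemma isParam_chart_symm {e : OpenPartialHomeomorph M ℂ} (he : e ∈ atlas ℂ M) :
    IsParam e.symm e.target := by
  refine ⟨e.open_target, e.continuousOn_symm, fun x =>
    differentiableOn_chart_symm he (chart_mem_atlas ℂ x), fun z hz => ?_⟩
  set c := chartAt ℂ (e.symm z) with hc
  have hmem : e.symm z ∈ c.source := mem_chart_source ℂ _
  have ho : IsOpen (e.target ∩ e.symm ⁻¹' c.source) :=
    e.continuousOn_symm.isOpen_inter_preimage e.open_target c.open_source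
  have ho' : IsOpen (c.target ∩ c.symm ⁻¹' e.source) :=
    c.continuousOn_symm.isOpen_inter_preimage c.open_target e.open_source
  have hz' : c (e.symm z) ∈ c.target ∩ c.symm ⁻¹' e.source :=
    ⟨c.map_source hmem, by rw [mem_preimage, c.left_inv hmem]; exact e.map_target hz⟩
  have h1 := ((differentiableOn_chart_symm he (chart_mem_atlas ℂ (e.symm z))).differentiableAt
    (ho.mem_nhds ⟨hz, hmem⟩)).hasDerivAt
  have h2 := ((differentiableOn_chart_symm (chart_mem_atlas ℂ (e.symm z)) he).differentiableAt
    (ho'.mem_nhds hz')).hasDerivAt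
  have h3 := (h2.comp z h1).deriv
  have h4 : (fun ζ => e (c.symm ζ)) ∘ (fun ζ => c (e.symm ζ)) =ᶠ[𝓝 z] id := by
    filter_upwards [ho.mem_nhds ⟨hz, hmem⟩] with ζ hζ
    simp [c.left_inv hζ.2, e.right_inv hζ.1]
  intro h0
  rw [h4.deriv_eq, deriv_id] at h3
  have h5 : deriv (fun ζ => c (e.symm ζ)) z = 0 := h0
  rw [h5, mul_zero] at h3
  exact one_ne_zero h3

end Param

/-! ### CMC-1 faces in holomorphic parametrizations -/

section Face

lemma det_lin (x a b n : Mink4) (p q : ℝ) :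
    (Matrix.of ![x, p • a + q • b, -q • a + p • b, n]).det =
      (p ^ 2 + q ^ 2) * (Matrix.of ![x, a, b, n]).det := by
  simp [Matrix.det_succ_row_zero, Fin.sum_univ_succ, Fin.succAbove]
  ring

variable {M : Type*} [TopologicalSpace M] [ChartedSpace ℂ M]

lemma surfDeriv_mul (f : M → Mink4) (x : M) (c : ℂ) :
    surfDeriv f x (c * 1) = c.re • surfDeriv f x 1 + c.im • surfDeriv f x Complex.I ∧
    surfDeriv f x (c * Complex.I) = -c.im • surfDeriv f x 1 + c.re • surfDeriv f x Complex.I := by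
  let L : ℂ →L[ℝ] Mink4 := mfderiv 𝓘(ℝ, ℂ) 𝓘(ℝ, Mink4) f x
  have h := clm_complex_apply L
  constructor
  · exact (h _).trans (by simp; rfl)
  · exact (h _).trans (by simp; rfl)

/-- The sign of the spinor representation belonging to an orientation of de Sitter space. -/
def orientationSign (o : ℝ) : ℝ := if 0 < o then -1 else 1

lemma orientationSign_sq (o : ℝ) : orientationSign o ^ 2 = 1 := by
  unfold orientationSign; split_ifs <;> norm_num

lemma orientationSign_mul_pos {o d : ℝ} (h : 0 < o * d) : 0 < -orientationSign o * d := by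
  unfold orientationSign
  split_ifs with ho
  · simpa using (mul_pos_iff_of_pos_left ho).mp h
  · have : o < 0 := lt_of_le_of_ne (not_lt.mp ho) fun h0 => by simp [h0] at h
    have := neg_of_mul_pos_right h this.le
    simpa using this

/-- Invariance under `i` applied to the pair `1`, `i` gives `⟨i, -1⟩ = ⟨1, i⟩`, so the mixed term
vanishes. -/
lemma IsConformalFace.firstForm_I {f : M → Mink4} (hconf : IsConformalFace f) (x : M) :
    firstForm f x Complex.I Complex.I = firstForm f x 1 1 ∧ firstForm f x 1 Complex.I = 0 := by
  have h1 := hconf x 1 1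
  have h2 := hconf x 1 Complex.I
  rw [mul_one] at h1 h2
  refine ⟨h1, ?_⟩
  have h3 : surfDeriv f x (Complex.I * Complex.I) = -surfDeriv f x 1 := by
    rw [Complex.I_mul_I]
    exact map_neg (mfderiv 𝓘(ℝ, ℂ) 𝓘(ℝ, Mink4) f x) (1 : ℂ)
  simp only [firstForm, mink, h3, Pi.neg_apply] at h2 ⊢
  linarith

variable {ψ : ℂ → M} {Ω : Set ℂ} {f ν : M → Mink4} {W : Set M} {o : ℝ} {z : ℂ}

lemma IsParam.dX_dY (h : IsParam ψ Ω) (hz : z ∈ Ω)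
    (hf : ContMDiffAt 𝓘(ℝ, ℂ) 𝓘(ℝ, Mink4) ∞ f (ψ z)) :
    dX (fun ζ => f (ψ ζ)) z = (paramDeriv ψ z).re • surfDeriv f (ψ z) 1
      + (paramDeriv ψ z).im • surfDeriv f (ψ z) Complex.I ∧
    dY (fun ζ => f (ψ ζ)) z = -(paramDeriv ψ z).im • surfDeriv f (ψ z) 1
      + (paramDeriv ψ z).re • surfDeriv f (ψ z) Complex.I := by
  refine ⟨?_, ?_⟩
  · rw [← fderiv_one_eq, h.fderiv_comp hz hf]; exact (surfDeriv_mul f _ _).1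
  · rw [← fderiv_I_eq, h.fderiv_comp hz hf]; exact (surfDeriv_mul f _ _).2

variable [IsManifold 𝓘(ℂ) ω M]

/-- A conformal CMC-1 face in a holomorphic parametrization. -/
lemma isCMC1Coord_of_face (hf : IsCMC1Face f) (hconf : IsConformalFace f) (hWo : IsOpen W)
    (hWd : Dense W) (hν : IsSpacelikeCMC1 o f ν W) (h : IsParam ψ Ω) :
    IsCMC1Coord (orientationSign o) (fun ζ => f (ψ ζ)) Ω ∧
    (∀ z ∈ Ω, ψ z ∈ W → ∀ v : ℂ, secondForm f ν (ψ z) (paramDeriv ψ z * v) (paramDeriv ψ z * v) =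
      2 * (hopfCoeff (orientationSign o) (fun ζ => f (ψ ζ)) z * v ^ 2).re +
        firstForm f (ψ z) (paramDeriv ψ z * v) (paramDeriv ψ z * v)) ∧
    ∀ z ∈ Ω, ψ z ∈ W → normalLaplacian (fun ζ => f (ψ ζ)) z =
        (Complex.I * orientationSign o) • tripleProd (cvec (f (ψ z)))
          (wirt (dX (fun ζ => f (ψ ζ)) z) (dY (fun ζ => f (ψ ζ)) z))
          (wirtBar (dX (fun ζ => f (ψ ζ)) z) (dY (fun ζ => f (ψ ζ)) z)) ∧
      tripleProd (cvec (f (ψ z))) (wirt (dX (fun ζ => f (ψ ζ)) z) (dY (fun ζ => f (ψ ζ)) z))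
        (wirtBar (dX (fun ζ => f (ψ ζ)) z) (dY (fun ζ => f (ψ ζ)) z)) ≠ 0 := by
  have hfs := fun z => hf.smooth.contMDiffAt (x := ψ z)
  have hνs := fun z (hz : ψ z ∈ W) => hν.isUnitNormal.smooth.contMDiffAt (hWo.mem_nhds hz)
  have hconf' := fun z => hconf.firstForm_I (ψ z)
  have hne := h.deriv_ne_zero
  have hd := fun z (hz : z ∈ Ω) => h.dX_dY hz (hfs z)
  have hc : ∀ z ∈ Ω, 0 < (paramDeriv ψ z).re ^ 2 + (paramDeriv ψ z).im ^ 2 := fun z hz => by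
    have := Complex.normSq_pos.mpr (hne z hz)
    rw [Complex.normSq_apply] at this
    linarith
  have hE : ∀ z ∈ Ω, mink (dX (fun ζ => f (ψ ζ)) z) (dX (fun ζ => f (ψ ζ)) z) =
      ((paramDeriv ψ z).re ^ 2 + (paramDeriv ψ z).im ^ 2) * firstForm f (ψ z) 1 1 := by
    intro z hz
    rw [(hd z hz).1, mink_lin]
    have := hconf' z
    simp only [firstForm] at this ⊢
    rw [this.1, this.2]
    ring
  have key := IsCMC1Coord.of_normal (s := orientationSign o) (F := fun ζ => f (ψ ζ))
    (ν := fun ζ => ν (ψ ζ)) h.isOpen (h.isOpen_preimage hWo) inter_subset_left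
    (h.subset_closure_preimage hWd) (orientationSign_sq o)
    (fun z hz => (h.contDiffAt_comp hz (hfs z)).contDiffWithinAt)
    (fun z hz => (h.contDiffAt_comp hz.1 (hνs z hz.2)).contDiffWithinAt)
    (fun z _ => hf.mem_deSitter3 (ψ z)) ?_ ?_ ?_ ?_ (fun z hz => hν.isUnitNormal.unit _ hz.2)
    (fun z hz => hν.isUnitNormal.tangent _ hz.2) ?_ ?_ ?_ ?_
  · refine ⟨key.1, fun z hz hzW v => ?_, fun z hz hzW => key.2.2 z ⟨hz, hzW⟩⟩
    have h1 := key.2.1 z ⟨hz, hzW⟩ v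
    rw [h.fderiv_comp hz (hfs z), h.fderiv_comp hz (hνs z hzW)] at h1
    exact h1
  · intro z hz
    rw [hE z hz, (hd z hz).2, mink_lin]
    have := hconf' z
    simp only [firstForm] at this ⊢
    rw [this.1, this.2]
    ring
  · intro z hz
    rw [(hd z hz).1, (hd z hz).2, mink_lin]
    have := hconf' z
    simp only [firstForm] at this ⊢
    rw [this.1, this.2]
    ring
  · intro z hz h0
    obtain ⟨v, hv⟩ := hf.deriv_ne_zero (ψ z)
    refine hv ?_
    rw [← mul_div_cancel₀ v (hne z hz), ← h.fderiv_comp hz (hfs z), h0]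
    simp
  · intro z hz
    rw [hE z hz.1]
    exact mul_pos (hc z hz.1) (hν.spacelike _ hz.2 1 one_ne_zero)
  · intro z hz
    rw [← fderiv_one_eq, h.fderiv_comp hz.1 (hfs z)]
    exact hν.isUnitNormal.normal _ hz.2 _
  · intro z hz
    rw [← fderiv_I_eq, h.fderiv_comp hz.1 (hfs z)]
    exact hν.isUnitNormal.normal _ hz.2 _
  · intro z hz
    rw [(hd z hz.1).1, (hd z hz.1).2, det_lin, mul_left_comm]
    exact mul_pos (hc z hz.1) (orientationSign_mul_pos (hν.isUnitNormal.oriented _ hz.2))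
  · intro z hz
    have hdν := h.dX_dY hz.1 (hνs z hz.2)
    have hm := hν.meanCurvature_eq_one _ hz.2
    have hpos := hν.spacelike _ hz.2 1 one_ne_zero
    have hconfz := hconf' z
    rw [meanCurvature, hconfz.1, hconfz.2, div_eq_one_iff_eq (ne_of_gt (by nlinarith [mul_pos hpos hpos]))] at hm
    have hm' : secondForm f ν (ψ z) Complex.I Complex.I + secondForm f ν (ψ z) 1 1 =
        2 * firstForm f (ψ z) 1 1 := by
      refine mul_left_cancel₀ hpos.ne' ?_
      linear_combination hm
    rw [hE z hz.1, (hd z hz.1).1, (hd z hz.1).2, hdν.1, hdν.2]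
    simp only [secondForm] at hm'
    have e1 : ∀ (a b : ℝ) (p q p' q' : Mink4), mink (a • p + b • q) (a • p' + b • q') +
        mink (-b • p + a • q) (-b • p' + a • q') =
        (a ^ 2 + b ^ 2) * (mink p p' + mink q q') := by
      intros; simp only [mink, Pi.add_apply, Pi.smul_apply, smul_eq_mul]; ring
    rw [e1]
    linear_combination -((paramDeriv ψ z).re ^ 2 + (paramDeriv ψ z).im ^ 2) * hm'

end Face

/-! ### The Hopf differential of a CMC-1 face -/

section Hopf

variable {M : Type*} [TopologicalSpace M] [ChartedSpace ℂ M]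

/-- The Hopf differential computed in the preferred charts. -/
def faceHopf (s : ℝ) (f : M → Mink4) (x : M) : ℂ :=
  hopfCoeff s (fun ζ => f ((chartAt ℂ x).symm ζ)) (chartAt ℂ x x)

/-- Coordinate independence: near `z`, `f ∘ ψ` is the chart expression of `f` composed with a
holomorphic map, to which `IsCMC1Coord.comp` applies. -/
lemma faceHopf_mul_paramDeriv_sq {s : ℝ} {f : M → Mink4}
    (hs : ∀ x : M, IsCMC1Coord s (fun ζ => f ((chartAt ℂ x).symm ζ)) (chartAt ℂ x).target)
    {ψ : ℂ → M} {Ω : Set ℂ} (h : IsParam ψ Ω) {z : ℂ} (hz : z ∈ Ω) :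
    faceHopf s f (ψ z) * paramDeriv ψ z ^ 2 = hopfCoeff s (fun ζ => f (ψ ζ)) z := by
  have han := h.analyticAt hz
  have hev : ∀ᶠ ζ in 𝓝 z, DifferentiableAt ℂ (fun ζ => chartAt ℂ (ψ z) (ψ ζ)) ζ ∧
      deriv (fun ζ => chartAt ℂ (ψ z) (ψ ζ)) ζ ≠ 0 ∧ ψ ζ ∈ (chartAt ℂ (ψ z)).source :=
    (h.differentiableAt hz).and ((han.deriv.continuousAt.eventually_ne
      (h.deriv_ne_zero z hz)).and (h.eventually_mem_source hz))
  obtain ⟨Ω', hΩ', hΩo, hzΩ⟩ := eventually_nhds_iff.mp hev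
  have hcomp := ((hs (ψ z)).comp hΩo
    (fun ζ hζ => (hΩ' ζ hζ).1.differentiableWithinAt)
    (fun ζ hζ => (chartAt ℂ (ψ z)).map_source (hΩ' ζ hζ).2.2)
    (fun ζ hζ => (hΩ' ζ hζ).2.1)).2 z hzΩ
  rw [faceHopf, mul_comm]
  refine hcomp.symm.trans (hopfCoeff_congr ?_)
  filter_upwards [hΩo.mem_nhds hzΩ] with ζ hζ
  rw [(chartAt ℂ (ψ z)).left_inv (hΩ' ζ hζ).2.2]

variable [IsManifold 𝓘(ℂ) ω M]

section Face

variable {f ν ν' : M → Mink4} {W W' : Set M} {o o' : ℝ}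

lemma isHopfDifferential_faceHopf (hf : IsCMC1Face f) (hconf : IsConformalFace f) (hWo : IsOpen W)
    (hWd : Dense W) (hν : IsSpacelikeCMC1 o f ν W) :
    IsHopfDifferential f (faceHopf (orientationSign o) f) := by
  have hall := fun x : M => (isCMC1Coord_of_face hf hconf hWo hWd hν
    (isParam_chart_symm (chart_mem_atlas ℂ x))).1
  refine ⟨fun e he => ?_, W, hWo, hWd, o, ν, hν, fun x hx v => ?_⟩
  · have hp := isParam_chart_symm he
    have hc := (isCMC1Coord_of_face hf hconf hWo hWd hν hp).1
    exact hc.differentiableOn_hopfCoeff.congr fun z hz => faceHopf_mul_paramDeriv_sq hall hp hz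
  · have hp := isParam_chart_symm (chart_mem_atlas ℂ x)
    have hz := mem_chart_target ℂ x
    have hx' : (chartAt ℂ x).symm (chartAt ℂ x x) = x :=
      (chartAt ℂ x).left_inv (mem_chart_source ℂ x)
    have h1 := (isCMC1Coord_of_face hf hconf hWo hWd hν hp).2.1 _ hz (by rwa [hx'])
      (v / paramDeriv (chartAt ℂ x).symm (chartAt ℂ x x))
    have hne := hp.deriv_ne_zero _ hz
    rw [mul_div_cancel₀ v hne, ← faceHopf_mul_paramDeriv_sq hall hp hz, hx', div_pow,
      mul_assoc, mul_div_cancel₀ _ (pow_ne_zero 2 hne)] at h1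
    exact h1

/-- A Hopf differential is determined by the orientation of de Sitter space. -/
lemma eq_faceHopf_of_secondForm (hf : IsCMC1Face f) (hconf : IsConformalFace f) (hWo : IsOpen W)
    (hWd : Dense W) (hν : IsSpacelikeCMC1 o f ν W) {Q : M → ℂ} (hQ : IsHolomorphicQuad Q)
    (hII : ∀ x ∈ W, ∀ v : ℂ,
      secondForm f ν x v v = 2 * (Q x * v ^ 2).re + firstForm f x v v) :
    Q = faceHopf (orientationSign o) f := by
  obtain ⟨hQ', -⟩ := isHopfDifferential_faceHopf hf hconf hWo hWd hν
  have hall := fun x : M => (isCMC1Coord_of_face hf hconf hWo hWd hν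
    (isParam_chart_symm (chart_mem_atlas ℂ x))).1
  funext x
  have he := chart_mem_atlas ℂ x
  have hp := isParam_chart_symm he
  have hz := mem_chart_target ℂ x
  have hx' : (chartAt ℂ x).symm (chartAt ℂ x x) = x :=
    (chartAt ℂ x).left_inv (mem_chart_source ℂ x)
  have heq : EqOn (quadCoeff Q (chartAt ℂ x))
      (quadCoeff (faceHopf (orientationSign o) f) (chartAt ℂ x))
      ((chartAt ℂ x).target ∩ (chartAt ℂ x).symm ⁻¹' W) := by
    intro z hzW
    have h1 := fun v => (isCMC1Coord_of_face hf hconf hWo hWd hν hp).2.1 z hzW.1 hzW.2 v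
    have h2 := fun v => hII _ hzW.2 (paramDeriv (chartAt ℂ x).symm z * v)
    have h3 : ∀ v : ℂ, (quadCoeff Q (chartAt ℂ x) z * v ^ 2).re =
        (quadCoeff (faceHopf (orientationSign o) f) (chartAt ℂ x) z * v ^ 2).re := by
      intro v
      have h4 := (h2 v).symm.trans (h1 v)
      rw [← faceHopf_mul_paramDeriv_sq hall hp hzW.1, mul_pow, ← mul_assoc] at h4
      have h5 := add_right_cancel h4
      exact mul_left_cancel₀ two_ne_zero h5
    -- As `(1 + i)² = 2i`, the vectors `1` and `1 + i` give the real and the imaginary part of the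
    -- coefficient.
    have h4 := h3 1
    have h5 := h3 (1 + Complex.I)
    have h6 : (1 + Complex.I) ^ 2 = 2 * Complex.I := by
      ring_nf; rw [Complex.I_sq]; ring
    rw [h6] at h5
    apply Complex.ext
    · simpa using h4
    · simpa using h5
  -- The coefficients agree on a dense set and are continuous, so they agree at every point.
  have h1 := heq.of_subset_closure (hQ _ he).continuousOn (hQ' _ he).continuousOn
    inter_subset_left (hp.subset_closure_preimage hWd) hz
  have h2 := mul_right_cancel₀ (pow_ne_zero 2 (hp.deriv_ne_zero _ hz)) h1
  rwa [hx'] at h2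

/-- The orientation of de Sitter space is determined by the sign of the mean curvature. -/
lemma orientationSign_eq (hf : IsCMC1Face f) (hconf : IsConformalFace f) [Nonempty M]
    (hWo : IsOpen W) (hWd : Dense W) (hν : IsSpacelikeCMC1 o f ν W)
    (hWo' : IsOpen W') (hWd' : Dense W') (hν' : IsSpacelikeCMC1 o' f ν' W') :
    orientationSign o = orientationSign o' := by
  obtain ⟨x, hx, hx'⟩ := (hWd.inter_of_isOpen_left hWd' hWo).nonempty
  have hp := isParam_chart_symm (chart_mem_atlas ℂ x)
  have hz := mem_chart_target ℂ x
  have hxe : (chartAt ℂ x).symm (chartAt ℂ x x) = x :=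
    (chartAt ℂ x).left_inv (mem_chart_source ℂ x)
  obtain ⟨h1, h2⟩ := (isCMC1Coord_of_face hf hconf hWo hWd hν hp).2.2 _ hz (by rwa [hxe])
  obtain ⟨h3, -⟩ := (isCMC1Coord_of_face hf hconf hWo' hWd' hν' hp).2.2 _ hz (by rwa [hxe])
  -- At a common regular point both signs multiply the same nonzero triple product to give the same
  -- normal Laplacian.
  have h4 := smul_left_injective ℂ h2 (h1.symm.trans h3)
  exact_mod_cast mul_left_cancel₀ Complex.I_ne_zero h4

/-- The Hopf differential exists and is unique. -/
theorem existsUnique_isHopfDifferential (hf : IsCMC1Face f) (hconf : IsConformalFace f) :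
    ∃! Q : M → ℂ, IsHopfDifferential f Q := by
  obtain ⟨W, hWo, hWd, ⟨o, ν, hν⟩, -⟩ := hf.exists_regular
  refine ⟨_, isHopfDifferential_faceHopf hf hconf hWo hWd hν, ?_⟩
  rintro Q ⟨hQ, W', hWo', hWd', o', ν', hν', hII⟩
  rcases isEmpty_or_nonempty M with hM | hM
  · exact Subsingleton.elim _ _
  · rw [orientationSign_eq hf hconf hWo hWd hν hWo' hWd' hν']
    exact eq_faceHopf_of_secondForm hf hconf hWo' hWd' hν' hQ hII

end Face

end Hopf

/-! ### Completeness -/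

/-- A map along a countably generated filter converges if it converges along all sequences. -/
lemma exists_tendsto_of_forall_seq {α Y : Type*} [TopologicalSpace Y] [T2Space Y] {l : Filter α}
    [l.IsCountablyGenerated] [l.NeBot] {F : α → Y}
    (h : ∀ u : ℕ → α, Tendsto u atTop l → ∃ y, Tendsto (F ∘ u) atTop (𝓝 y)) :
    ∃ y, Tendsto F l (𝓝 y) := by
  obtain ⟨u, hu⟩ := exists_seq_tendsto l
  obtain ⟨y, hy⟩ := h u hu
  refine ⟨y, tendsto_of_seq_tendsto fun v hv => ?_⟩
  -- Interleaving two sequences yields a single convergent one, so the limits along all sequences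
  -- coincide.
  let w : ℕ → α := fun n => if Even n then u (n / 2) else v (n / 2)
  have h2 : Tendsto (fun n : ℕ => n / 2) atTop atTop := Nat.tendsto_div_const_atTop two_ne_zero
  have hw : Tendsto w atTop l := Tendsto.if' (hu.comp h2) (hv.comp h2)
  obtain ⟨x, hx⟩ := h w hw
  have he : Tendsto (fun n : ℕ => 2 * n) atTop atTop :=
    tendsto_id.const_mul_atTop' two_pos
  have ho : Tendsto (fun n : ℕ => 2 * n + 1) atTop atTop := (tendsto_add_atTop_nat 1).comp he
  have h3 : Tendsto (F ∘ u) atTop (𝓝 x) := by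
    refine (hx.comp he).congr fun n => ?_
    simp [w]
  have h4 : Tendsto (F ∘ v) atTop (𝓝 x) := by
    refine (hx.comp ho).congr fun n => ?_
    have : ¬ Even (2 * n + 1) := by simp
    have h5 : (2 * n + 1) / 2 = n := by omega
    simp [w, h5]
  rwa [tendsto_nhds_unique hy h3]

section Length

variable {M : Type*} [TopologicalSpace M] [ChartedSpace ℂ M]

variable {ψ : ℂ → M} {Ω : Set ℂ} {σ : ℝ → ℂ} {s : ℝ}

lemma IsParam.contMDiffAt_curve (h : IsParam ψ Ω) (hs : σ s ∈ Ω) (hσ : ContDiffAt ℝ 1 σ s) :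
    ContMDiffAt 𝓘(ℝ, ℝ) 𝓘(ℝ, ℂ) 1 (fun t => ψ (σ t)) s := by
  rw [contMDiffAt_iff]
  refine ⟨(h.continuousAt hs).comp hσ.continuousAt, ?_⟩
  have h1 : ContDiffAt ℝ 1 (fun ζ => chartAt ℂ (ψ (σ s)) (ψ ζ)) (σ s) := h.contDiffAt hs
  have h2 := h1.comp s hσ
  simp [extChartAt, contDiffWithinAt_univ]
  exact h2

lemma IsParam.mfderiv_curve (h : IsParam ψ Ω) (hs : σ s ∈ Ω) (hσ : ContDiffAt ℝ 1 σ s) :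
    mfderiv 𝓘(ℝ, ℝ) 𝓘(ℝ, ℂ) (fun t => ψ (σ t)) s (1 : ℝ) =
      (paramDeriv ψ (σ s) * deriv σ s : ℂ) := by
  have h0 := ((h.contMDiffAt_curve hs hσ).mdifferentiableAt one_ne_zero).mfderiv
  rw [h0]
  have h1 := (hσ.differentiableAt one_ne_zero).hasDerivAt
  have h2 := (h.hasDerivAt hs).comp_of_eq s h1 rfl
  simp [writtenInExtChartAt, extChartAt, fderivWithin_univ, Function.comp_def]
  exact h2.deriv

variable [IsManifold 𝓘(ℂ) ω M]

/-- The distance of the endpoints is at most the length of the curve, and the integrand of the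
length is at most `L`. -/
lemma riemannianEDist_param_le
    (g : ContinuousRiemannianMetric ℂ (fun x : M => TangentSpace 𝓘(ℝ, ℂ) x))
    (h : IsParam ψ Ω) {L a b : ℝ} (hab : a ≤ b) (hσ : ∀ s ∈ Icc a b, ContDiffAt ℝ 1 σ s)
    (hΩ : ∀ s ∈ Icc a b, σ s ∈ Ω)
    (hL : ∀ s ∈ Icc a b, Real.sqrt (g.inner (ψ (σ s)) (paramDeriv ψ (σ s) * deriv σ s : ℂ)
      (paramDeriv ψ (σ s) * deriv σ s : ℂ)) ≤ L) :
    letI : RiemannianBundle (fun x : M => TangentSpace 𝓘(ℝ, ℂ) x) := ⟨g.toRiemannianMetric⟩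
    Manifold.riemannianEDist 𝓘(ℝ, ℂ) (ψ (σ a)) (ψ (σ b)) ≤ ENNReal.ofReal (L * (b - a)) := by
  let : RiemannianBundle (fun x : M => TangentSpace 𝓘(ℝ, ℂ) x) := ⟨g.toRiemannianMetric⟩
  have hnorm : ∀ (x : M) (v : TangentSpace 𝓘(ℝ, ℂ) x), ‖v‖ₑ =
      ENNReal.ofReal (Real.sqrt (g.inner x v v)) := by
    intro x v
    rw [← ofReal_norm, norm_eq_sqrt_real_inner]
    rfl
  refine (Manifold.riemannianEDist_le_pathELength (γ := fun t => ψ (σ t))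
    (fun s hs => (h.contMDiffAt_curve (hΩ s hs) (hσ s hs)).contMDiffWithinAt) rfl rfl hab).trans ?_
  rw [Manifold.pathELength_eq_lintegral_mfderiv_Icc]
  have hle : ∀ s ∈ Icc a b, ‖mfderiv 𝓘(ℝ, ℝ) 𝓘(ℝ, ℂ) (fun t => ψ (σ t)) s (1 : ℝ)‖ₑ ≤
      ENNReal.ofReal L := by
    intro s hs
    rw [hnorm, h.mfderiv_curve (hΩ s hs) (hσ s hs)]
    exact ENNReal.ofReal_le_ofReal (hL s hs)
  refine (MeasureTheory.setLIntegral_mono' measurableSet_Icc hle).trans ?_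
  rw [MeasureTheory.setLIntegral_const, Real.volume_Icc,
    ← ENNReal.ofReal_mul ((Real.sqrt_nonneg _).trans (hL a ⟨le_rfl, hab⟩))]

/-- In a complete surface, a parametrized curve of bounded speed converges. -/
lemma exists_tendsto_param [T2Space M]
    {g : ContinuousRiemannianMetric ℂ (fun x : M => TangentSpace 𝓘(ℝ, ℂ) x)}
    (hg : IsCompleteMetric g) (h : IsParam ψ Ω) {L τ : ℝ} (hτ : 0 < τ)
    (hσ : ∀ s ∈ Ioo 0 τ, ContDiffAt ℝ 1 σ s) (hΩ : ∀ s ∈ Ioo 0 τ, σ s ∈ Ω)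
    (hL : ∀ s ∈ Ioo 0 τ, Real.sqrt (g.inner (ψ (σ s)) (paramDeriv ψ (σ s) * deriv σ s : ℂ)
      (paramDeriv ψ (σ s) * deriv σ s : ℂ)) ≤ L) :
    ∃ x : M, Tendsto (fun s => ψ (σ s)) (𝓝[<] τ) (𝓝 x) := by
  let : RiemannianBundle (fun x : M => TangentSpace 𝓘(ℝ, ℂ) x) := ⟨g.toRiemannianMetric⟩
  refine exists_tendsto_of_forall_seq fun u hu => hg _ fun ε hε => ?_
  have hL0 : 0 ≤ L := (Real.sqrt_nonneg _).trans (hL (τ / 2) ⟨by linarith, by linarith⟩)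
  have hdist : ∀ a ∈ Ioo 0 τ, ∀ b ∈ Ioo 0 τ, Manifold.riemannianEDist 𝓘(ℝ, ℂ) (ψ (σ a)) (ψ (σ b)) ≤
      ENNReal.ofReal (L * |b - a|) := by
    have h1 : ∀ a ∈ Ioo 0 τ, ∀ b ∈ Ioo 0 τ, a ≤ b →
        Manifold.riemannianEDist 𝓘(ℝ, ℂ) (ψ (σ a)) (ψ (σ b)) ≤ ENNReal.ofReal (L * (b - a)) := by
      intro a ha b hb hab
      have hsub : Icc a b ⊆ Ioo 0 τ := fun s hs => ⟨ha.1.trans_le hs.1, hs.2.trans_lt hb.2⟩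
      exact riemannianEDist_param_le g h hab (fun s hs => hσ s (hsub hs))
        (fun s hs => hΩ s (hsub hs)) fun s hs => hL s (hsub hs)
    intro a ha b hb
    rcases le_total a b with hab | hab
    · rw [abs_of_nonneg (sub_nonneg.mpr hab)]
      exact h1 a ha b hb hab
    · rw [Manifold.riemannianEDist_comm, abs_sub_comm, abs_of_nonneg (sub_nonneg.mpr hab)]
      exact h1 b hb a ha hab
  have hcau : CauchySeq u := (hu.mono_right nhdsWithin_le_nhds).cauchySeq
  obtain ⟨δ, hδ, hδε⟩ : ∃ δ > 0, ENNReal.ofReal (L * δ) < ε := by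
    have hc : ContinuousAt (fun δ : ℝ => ENNReal.ofReal (L * δ)) 0 :=
      (ENNReal.continuous_ofReal.comp (continuous_const.mul continuous_id)).continuousAt
    have h2 : ∀ᶠ δ in 𝓝 (0 : ℝ), ENNReal.ofReal (L * δ) < ε := by
      refine hc.eventually_lt continuousAt_const ?_
      simpa using hε
    have h3 := (h2.filter_mono (nhdsWithin_le_nhds (s := Ioi 0))).and self_mem_nhdsWithin
    obtain ⟨δ, h4, h5⟩ := h3.exists
    exact ⟨δ, h5, h4⟩
  obtain ⟨N₁, hN₁⟩ := Metric.cauchySeq_iff.mp hcau δ hδ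
  obtain ⟨N₂, hN₂⟩ := eventually_atTop.mp (hu.eventually (Ioo_mem_nhdsLT hτ))
  refine ⟨max N₁ N₂, fun m hm n hn => ?_⟩
  have h1 := hN₁ n ((le_max_left _ _).trans hn) m ((le_max_left _ _).trans hm)
  rw [Real.dist_eq] at h1
  refine (hdist _ (hN₂ m ((le_max_right _ _).trans hm)) _
    (hN₂ n ((le_max_right _ _).trans hn))).trans_lt (lt_of_le_of_lt ?_ hδε)
  exact ENNReal.ofReal_le_ofReal (mul_le_mul_of_nonneg_left h1.le hL0)

end Length

/-! ### Punctured Riemann surfaces -/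

section Translate

variable {M : Type*} [TopologicalSpace M] [ChartedSpace ℂ M] {ψ : ℂ → M} {Ω Ω' : Set ℂ}

lemma IsParam.mono (h : IsParam ψ Ω) (hΩ' : IsOpen Ω') (hsub : Ω' ⊆ Ω) : IsParam ψ Ω' :=
  ⟨hΩ', h.cont.mono hsub, fun x => (h.holo x).mono (inter_subset_inter_left _ hsub),
    fun z hz => h.deriv_ne_zero z (hsub hz)⟩

lemma paramDeriv_translate (ψ : ℂ → M) (z₀ ζ : ℂ) :
    paramDeriv (fun ζ => ψ (z₀ + ζ)) ζ = paramDeriv ψ (z₀ + ζ) :=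
  deriv_comp_const_add (fun ζ' => chartAt ℂ (ψ (z₀ + ζ)) (ψ ζ')) z₀ ζ

lemma IsParam.translate (h : IsParam ψ Ω) (z₀ : ℂ) :
    IsParam (fun ζ => ψ (z₀ + ζ)) ((fun ζ => z₀ + ζ) ⁻¹' Ω) := by
  refine ⟨h.isOpen.preimage (by fun_prop), h.cont.comp (by fun_prop) (mapsTo_preimage _ _),
    fun x => ?_, fun ζ hζ => ?_⟩
  · exact (h.holo x).comp (f := fun ζ => z₀ + ζ) (by fun_prop) fun ζ hζ => hζ
  · rw [paramDeriv_translate]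
    exact h.deriv_ne_zero _ hζ

end Translate

section Punctured

variable {X : Type*} [TopologicalSpace X] [T2Space X] [ChartedSpace ℂ X] {P : Finset X}

/-- The charts of the open subset are restrictions of those of `X`, so a parametrization whose
values avoid `P` keeps its coordinate expressions. -/
lemma IsParam.lift {φ : ℂ → X} {Ω : Set ℂ} (h : IsParam φ Ω) {ψ : ℂ → punctured P}
    (hψ : ∀ ζ ∈ Ω, (ψ ζ : X) = φ ζ) :
    IsParam ψ Ω ∧ ∀ ζ ∈ Ω, paramDeriv ψ ζ = paramDeriv φ ζ := by
  have hchart : ∀ x y : punctured P, chartAt ℂ x y = chartAt ℂ (x : X) (y : X) := fun x y => rfl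
  have hsource : ∀ x : punctured P,
      (chartAt ℂ x).source = Subtype.val ⁻¹' (chartAt ℂ (x : X)).source := fun x =>
    OpenPartialHomeomorph.subtypeRestr_source _ _
  have hder : ∀ ζ ∈ Ω, paramDeriv ψ ζ = paramDeriv φ ζ := by
    intro ζ hζ
    refine Filter.EventuallyEq.deriv_eq ?_
    filter_upwards [h.isOpen.mem_nhds hζ] with ζ' hζ'
    rw [hchart, hψ ζ hζ, hψ ζ' hζ']
  refine ⟨⟨h.isOpen, ?_, fun x => ?_, fun ζ hζ => ?_⟩, hder⟩
  · rw [Topology.IsInducing.subtypeVal.continuousOn_iff]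
    exact h.cont.congr hψ
  · refine ((h.holo (x : X)).mono ?_).congr fun ζ hζ => ?_
    · rintro ζ ⟨hζ, hζ'⟩
      rw [mem_preimage, hsource, mem_preimage, hψ ζ hζ] at hζ'
      exact ⟨hζ, hζ'⟩
    · rw [hchart, hψ ζ hζ.1]
  · rw [hder ζ hζ]
    exact h.deriv_ne_zero ζ hζ

variable [IsManifold 𝓘(ℂ) ω X]

/-- A chart of `X`, centred at `z₀`, as a parametrization of the punctured surface. -/
lemma exists_isParam_punctured [Nonempty (punctured P)] {e : OpenPartialHomeomorph X ℂ}
    (he : e ∈ atlas ℂ X) (z₀ : ℂ) {Ω : Set ℂ} (hΩ : IsOpen Ω)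
    (hsub : ∀ ζ ∈ Ω, z₀ + ζ ∈ e.target ∧ e.symm (z₀ + ζ) ∉ P) :
    ∃ ψ : ℂ → punctured P, IsParam ψ Ω ∧ (∀ ζ ∈ Ω, (ψ ζ : X) = e.symm (z₀ + ζ)) ∧
      ∀ Q : punctured P → ℂ, ∀ ζ ∈ Ω,
        quadCoeff (extendQuad P Q) e (z₀ + ζ) = Q (ψ ζ) * paramDeriv ψ ζ ^ 2 := by
  have hex : ∀ ζ ∈ Ω, ∃ y : punctured P, (y : X) = e.symm (z₀ + ζ) := fun ζ hζ =>
    ⟨⟨e.symm (z₀ + ζ), (hsub ζ hζ).2⟩, rfl⟩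
  choose! ψ hψ using hex
  obtain ⟨h1, h2⟩ := (((isParam_chart_symm he).translate z₀).mono hΩ
    fun ζ hζ => (hsub ζ hζ).1).lift hψ
  refine ⟨ψ, h1, hψ, fun Q ζ hζ => ?_⟩
  have hval : extendQuad P Q (e.symm (z₀ + ζ)) = Q (ψ ζ) := by
    rw [← hψ ζ hζ, extendQuad, dif_pos (ψ ζ).2]
  rw [h2 ζ hζ, paramDeriv_translate, quadCoeff, hval]
  rfl

lemma meromorphicAt_of_translate {q : ℂ → ℂ} {z₀ : ℂ}
    (h : MeromorphicAt (fun ζ => q (z₀ + ζ)) 0) : MeromorphicAt q z₀ := by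
  have h1 : MeromorphicAt (fun ζ => q (z₀ + ζ)) (z₀ - z₀) := by rwa [sub_self]
  have h2 := h1.comp_analyticAt (f := fun ζ => q (z₀ + ζ)) (g := fun z => z - z₀) (by fun_prop)
  refine h2.congr (Eventually.of_forall fun z => ?_)
  simp

end Punctured

/-! ### Ends of complete CMC-1 faces -/

section Ends

lemma contDiffAt_one_of_hasDerivAt {σ σ' : ℝ → ℂ} {S : Set ℝ} (hS : IsOpen S)
    (h : ∀ s ∈ S, HasDerivAt σ (σ' s) s) (hc : ContinuousOn σ' S) {s : ℝ} (hs : s ∈ S) :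
    ContDiffAt ℝ 1 σ s := by
  have h1 : ContDiffOn ℝ 1 σ S := by
    rw [contDiffOn_one_iff_derivWithin hS.uniqueDiffOn]
    exact ⟨fun s hs => (h s hs).differentiableAt.differentiableWithinAt, hc.congr fun s hs => by
      rw [derivWithin_of_isOpen hS hs, (h s hs).deriv]⟩
  exact h1.contDiffAt (hS.mem_nhds hs)

variable {X : Type*} [TopologicalSpace X] [T2Space X] [ChartedSpace ℂ X] [IsManifold 𝓘(ℂ) ω X]
  {P : Finset X} {f : punctured P → Mink4} {ψ : ℂ → punctured P} {s R : ℝ}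

lemma isCMC1Puncture_of_param (hf : IsCMC1Face f) (h : IsParam ψ (Metric.ball 0 R \ {0}))
    (hc : IsCMC1Coord s (fun ζ => f (ψ ζ)) (Metric.ball 0 R \ {0}))
    (hpos : ∀ ζ ∈ Metric.ball (0 : ℂ) R \ {0}, ∀ v : ℂ, v ≠ 0 → 0 < firstForm f (ψ ζ) v v) :
    IsCMC1Puncture s (fun ζ => f (ψ ζ)) R := by
  refine ⟨hc, fun ζ hζ => ?_⟩
  rw [← fderiv_one_eq, h.fderiv_comp hζ hf.smooth.contMDiffAt]
  exact hpos ζ hζ _ (mul_ne_zero (h.deriv_ne_zero ζ hζ) one_ne_zero)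

/-- Bounded `ds`-speed makes the curve converge in the punctured surface. The limit cannot be the
puncture, which is not a point of that surface, so in the coordinate it is nonzero. -/
lemma isCompletePuncture_of_param (hf : IsCMC1Face f) {e : OpenPartialHomeomorph X ℂ} {z₀ : ℂ}
    (h : IsParam ψ (Metric.ball 0 R \ {0}))
    (hc : IsCMC1Coord s (fun ζ => f (ψ ζ)) (Metric.ball 0 R \ {0}))
    (hψ : ∀ ζ ∈ Metric.ball (0 : ℂ) R \ {0}, (ψ ζ : X) = e.symm (z₀ + ζ))
    (hball : ∀ ζ ∈ Metric.ball (0 : ℂ) R, z₀ + ζ ∈ e.target) (hz₀ : e.symm z₀ ∈ P)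
    {g : ContinuousRiemannianMetric ℂ (fun x : punctured P => TangentSpace 𝓘(ℝ, ℂ) x)}
    (hg : IsCompleteMetric g)
    (hgf : ∀ ζ ∈ Metric.ball (0 : ℂ) R \ {0}, ∀ v : ℂ, g.inner (ψ ζ) v v = firstForm f (ψ ζ) v v)
    {r : ℝ} (hrR : r < R) : IsCompletePuncture (fun ζ => f (ψ ζ)) r := by
  intro r₁ hr₁ τ hτ σ σ' L hσ hσ' hb
  have hΩ : ∀ q ∈ Ioo 0 τ, σ q ∈ Metric.ball (0 : ℂ) R \ {0} := fun q hq =>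
    ⟨mem_ball_zero_iff.mpr ((hb q hq).2.1.trans_lt (hr₁.trans hrR)), (hb q hq).1⟩
  obtain ⟨x, hx⟩ := exists_tendsto_param hg h (L := L) hτ
    (fun q hq => contDiffAt_one_of_hasDerivAt isOpen_Ioo hσ hσ' hq) hΩ (fun q hq => by
      rw [hgf _ (hΩ q hq), (hσ q hq).deriv]
      refine le_trans (le_of_eq ?_) (hb q hq).2.2
      have h1 : firstForm f (ψ (σ q)) (paramDeriv ψ (σ q) * σ' q) (paramDeriv ψ (σ q) * σ' q) =
          ‖σ' q‖ ^ 2 * mink (dX (fun ζ => f (ψ ζ)) (σ q)) (dX (fun ζ => f (ψ ζ)) (σ q)) := by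
        rw [firstForm, ← h.fderiv_comp (hΩ q hq) hf.smooth.contMDiffAt, clm_complex_apply,
          fderiv_one_eq, fderiv_I_eq, mink_lin, hc.conf _ (hΩ q hq), hc.orth _ (hΩ q hq),
          ← Complex.normSq_eq_norm_sq, Complex.normSq_apply]
        ring
      rw [h1, Real.sqrt_mul (sq_nonneg _), Real.sqrt_sq (norm_nonneg _), mul_comm])
  have hx' : Tendsto (fun q => e.symm (z₀ + σ q)) (𝓝[<] τ) (𝓝 (x : X)) := by
    refine ((continuous_subtype_val.tendsto x).comp hx).congr' ?_
    filter_upwards [Ioo_mem_nhdsLT hτ] with q hq using hψ _ (hΩ q hq)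
  have hsubR : Metric.closedBall (0 : ℂ) r₁ ⊆ Metric.ball 0 R :=
    Metric.closedBall_subset_ball (hr₁.trans hrR)
  have hK : IsCompact ((fun ζ => e.symm (z₀ + ζ)) '' Metric.closedBall (0 : ℂ) r₁) :=
    (isCompact_closedBall 0 r₁).image_of_continuousOn
      (e.continuousOn_symm.comp (by fun_prop) fun ζ hζ => hball ζ (hsubR hζ))
  -- The curve stays in the compact image of a closed coordinate disc, so its limit lies in the
  -- chart.
  obtain ⟨y, hy, hyx⟩ := hK.isClosed.mem_of_tendsto hx' (by
    filter_upwards [Ioo_mem_nhdsLT hτ] with q hq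
    exact mem_image_of_mem _ (mem_closedBall_zero_iff.mpr (hb q hq).2.1))
  have hyt := hball y (hsubR hy)
  simp only at hyx
  refine ⟨y, ?_, ?_⟩
  · rintro rfl
    rw [add_zero] at hyx
    exact x.2 (hyx ▸ hz₀)
  · have h1 : Tendsto (fun q => e (e.symm (z₀ + σ q)) - z₀) (𝓝[<] τ) (𝓝 (e x - z₀)) := by
      refine ((e.continuousAt ?_).tendsto.comp hx').sub_const z₀
      rw [← hyx]; exact e.map_target hyt
    rw [← hyx, e.right_inv hyt, add_sub_cancel_left] at h1
    refine h1.congr' ?_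
    filter_upwards [Ioo_mem_nhdsLT hτ] with q hq
    rw [e.right_inv (hball _ (hΩ q hq).1), add_sub_cancel_left]

/-- The Hopf differential of a complete CMC-1 face is meromorphic at the punctures. -/
theorem isMeromorphicQuad_extendQuad (hf : IsCMC1Face f) (hconf : IsConformalFace f)
    (hcomplete : IsCompleteFace f) {Q : punctured P → ℂ} (hQ : IsHopfDifferential f Q) :
    IsMeromorphicQuad (extendQuad P Q) := by
  classical
  intro e he z₀ hz₀
  rcases isEmpty_or_nonempty (punctured P) with hM | hM
  -- Without points in the punctured surface the extension is identically zero; otherwise a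
  -- parametrization can be given arbitrary values off its domain.
  · have h0 : quadCoeff (extendQuad P Q) e = fun _ => 0 := by
      funext z
      have : e.symm z ∉ punctured P := fun h => hM.false ⟨_, h⟩
      rw [quadCoeff, extendQuad, dif_neg this, zero_mul]
    rw [h0]
    exact MeromorphicAt.const 0 z₀
  obtain ⟨hQ', W, hWo, hWd, o, ν, hν, hII⟩ := hQ
  have hQe := eq_faceHopf_of_secondForm hf hconf hWo hWd hν hQ' hII
  have hall := fun x : punctured P => (isCMC1Coord_of_face hf hconf hWo hWd hν
    (isParam_chart_symm (chart_mem_atlas ℂ x))).1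
  refine meromorphicAt_of_translate ?_
  have key : ∀ {Ω : Set ℂ} {ψ : ℂ → punctured P}, IsParam ψ Ω → (∀ Q : punctured P → ℂ, ∀ ζ ∈ Ω,
      quadCoeff (extendQuad P Q) e (z₀ + ζ) = Q (ψ ζ) * paramDeriv ψ ζ ^ 2) →
      IsCMC1Coord (orientationSign o) (fun ζ => f (ψ ζ)) Ω ∧ ∀ ζ ∈ Ω,
        hopfCoeff (orientationSign o) (fun ζ => f (ψ ζ)) ζ =
          quadCoeff (extendQuad P Q) e (z₀ + ζ) := fun h hq =>
    ⟨(isCMC1Coord_of_face hf hconf hWo hWd hν h).1, fun ζ hζ => by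
      rw [hq Q ζ hζ, hQe, faceHopf_mul_paramDeriv_sq hall h hζ]⟩
  have hΩ₀ : IsOpen ((fun ζ => z₀ + ζ) ⁻¹' e.target) := e.open_target.preimage (by fun_prop)
  have hφ : ContinuousOn (fun ζ => e.symm (z₀ + ζ)) ((fun ζ => z₀ + ζ) ⁻¹' e.target) :=
    e.continuousOn_symm.comp (by fun_prop) (mapsTo_preimage _ _)
  have h0 : (0 : ℂ) ∈ (fun ζ => z₀ + ζ) ⁻¹' e.target := by simpa using hz₀
  by_cases hP : e.symm z₀ ∈ P
  · obtain ⟨T, -, ⟨C, hC, hTC⟩, g, hg, hgc⟩ := hcomplete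
    have hC' : IsClosed (Subtype.val '' C : Set X) := (hC.image continuous_subtype_val).isClosed
    have hP' : IsClosed ((P.erase (e.symm z₀) : Finset X) : Set X) :=
      (Finset.finite_toSet _).isClosed
    -- A neighbourhood of the puncture free of the other punctures and of the support of `T`. On it
    -- `ds²` is the complete metric `g`, so there are no singular points.
    let N : Set X := (Subtype.val '' C)ᶜ ∩ ((P.erase (e.symm z₀) : Finset X) : Set X)ᶜ
    have hN : IsOpen N := hC'.isOpen_compl.inter hP'.isOpen_compl
    have hzN : e.symm z₀ ∈ N := by
      refine ⟨?_, by simp⟩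
      rintro ⟨y, -, hy⟩
      exact y.2 (hy ▸ hP)
    obtain ⟨R, hR, hball⟩ := Metric.isOpen_iff.mp (hφ.isOpen_inter_preimage hΩ₀ hN) 0
      ⟨h0, by simpa using hzN⟩
    have hΩ : IsOpen (Metric.ball (0 : ℂ) R \ {0}) := Metric.isOpen_ball.sdiff isClosed_singleton
    have hsub : ∀ ζ ∈ Metric.ball (0 : ℂ) R \ {0},
        z₀ + ζ ∈ e.target ∧ e.symm (z₀ + ζ) ∉ P := by
      intro ζ hζ
      have h1 := hball hζ.1
      refine ⟨h1.1, fun h2 => h1.2.2 ?_⟩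
      rw [Finset.mem_coe, Finset.mem_erase]
      refine ⟨fun h3 => hζ.2 ?_, h2⟩
      have h4 := e.symm.injOn h1.1 hz₀ h3
      simpa using h4
    obtain ⟨ψ, hp, hψ, hq⟩ := exists_isParam_punctured he z₀ hΩ hsub
    obtain ⟨hc, hqq⟩ := key hp hq
    have hgf : ∀ ζ ∈ Metric.ball (0 : ℂ) R \ {0}, ∀ v : ℂ,
        g.inner (ψ ζ) v v = firstForm f (ψ ζ) v v := by
      intro ζ hζ v
      have h1 : ψ ζ ∉ C := fun h => (hball hζ.1).2.1 ⟨ψ ζ, h, hψ ζ hζ⟩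
      rw [hg, hTC _ h1]
      exact zero_add _
    have hpunc := isCMC1Puncture_of_param hf hp hc fun ζ hζ v hv => by
      rw [← hgf ζ hζ v]; exact g.pos _ v hv
    have hcomp := isCompletePuncture_of_param hf hp hc hψ (fun ζ hζ => (hball hζ).1) hP hgc hgf
      (half_lt_self hR)
    refine (hpunc.meromorphicAt_hopfCoeff (half_pos hR) (half_lt_self hR) hcomp).congr ?_
    have hmem : Metric.ball (0 : ℂ) R \ {0} ∈ 𝓝[≠] (0 : ℂ) :=
      inter_mem (mem_nhdsWithin_of_mem_nhds (Metric.ball_mem_nhds _ hR)) self_mem_nhdsWithin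
    filter_upwards [hmem] with ζ hζ using hqq ζ hζ
  -- Away from `P` the coefficient is holomorphic near the point.
  · have hΩ := hφ.isOpen_inter_preimage hΩ₀ (punctured P).isOpen
    obtain ⟨ψ, hp, -, hq⟩ := exists_isParam_punctured he z₀ hΩ fun ζ hζ => hζ
    obtain ⟨hc, hqq⟩ := key hp hq
    have hmem := hΩ.mem_nhds (x := 0) ⟨h0, by rw [mem_preimage, add_zero]; exact hP⟩
    have han : AnalyticAt ℂ (fun ζ => quadCoeff (extendQuad P Q) e (z₀ + ζ)) 0 :=
      (hc.differentiableOn_hopfCoeff.congr fun ζ hζ => (hqq ζ hζ).symm).analyticAt hmem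
    exact han.meromorphicAt

end Ends

end

theorem mainTheorem7 {X : Type*} [TopologicalSpace X] [T2Space X] [CompactSpace X]
    [ConnectedSpace X] [ChartedSpace ℂ X] [IsManifold 𝓘(ℂ) ω X]
    (P : Finset X) (f : punctured P → Mink4)
    (hf : IsCMC1Face f) (hconf : IsConformalFace f) (hcomplete : IsCompleteFace f) :
    (∃! Q : punctured P → ℂ, IsHopfDifferential f Q) ∧
    ∀ Q : punctured P → ℂ, IsHopfDifferential f Q → IsMeromorphicQuad (extendQuad P Q) :=
  ⟨existsUnique_isHopfDifferential hf hconf, fun _ hQ =>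
    isMeromorphicQuad_extendQuad hf hconf hcomplete hQ⟩
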